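/- **Gaussian Equivalence Theorem.** Let $c\sim\mathcal N(0,I_D)$, let $A\in\mathbb R^{N\times D}$ ($N\ge 1$) have rows $a_1,\dots,a_N$, and let $x_n=\sigma(a_n^\top c)$ for $n=1,\dots,N$, where $\sigma:\mathbb R\to\mathbb R$. Let $W=(w_n^k)\in\mathbb R^{K\times N}$ (student weights) and $\tilde W=(\tilde w_r^m)\in\mathbb R^{M\times D}$ (teacher weights), and let $P$ be the law on $\mathbb R^{K+M}$ of $(\lambda,\nu)$, where $$\lambda^k=\frac1{\sqrt N}\sum_{n=1}^N w_n^k x_n\quad(1\le k\le K),\qquad \nu^m=\frac1{\sqrt D}\sum_{r=1}^D\tilde w_r^m c_r\quad(1\le m\le M).$$ Let $\hat P$ be the Gaussian distribution on $\mathbb R^{K+M}$ with the same first and second moments as $P$. Assume, with $u\sim\mathcal N(0,1)$: - (A1) $\|a_n\|=1$ for all $n$; - (A2) $\sigma$ is thrice differentiable and $\mathbb E|\sigma(u)|^4,\ \mathbb E|\sigma'(u)|^2,\ \mathbb E|\sigma''(u)|^2\le B_\sigma$; - (A3) $|w_n^k|\le B_w$ for all $k,n$. Put $\hat\sigma(1)=\mathbb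 E[\sigma(u)u]$, $\hat\sigma(2)=\frac1{\sqrt2}\mathbb E[\sigma(u)(u^2-1)]$, $\hat\sigma(3)=\frac1{\sqrt6}\mathbb E[\sigma(u)(u^3-3u)]$, $\rho=AA^\top$, $\tilde\rho=\rho-I_N$ and, with $\circ$ the Hadamard (entrywise) product, $$M_1=\frac1{\sqrt N}\left(\hat\sigma(1)^2\,\tilde\rho^2+\hat\sigma(2)^2\,\tilde\rho^2\circ\rho\right),\qquad M_2=\hat\sigma(2)^2(\tilde\rho\circ\tilde\rho)^2+\hat\sigma(3)^2(\tilde\rho\circ\tilde\rho)^2\circ\rho .$$ These are positive semidefinite; $M_i^{1/2}$ is the positive semidefinite square root. For probability measures on $\mathbb R$ let $d(P_1,P_2)=\sup_f|\mathbb E_{P_1}f-\mathbb E_{P_2}f|$, the supremum being over all thrice-differentiable $f:\mathbb R\to\mathbb R$ with $\|f''\|_\infty\le1$ and $\|f'''\|_\infty\le 1$, and for probability measures on $\mathbb R^d$ let $d_{\mathrm{MS}}(P_1,P_2)=\sup_{\|\alpha\|\le1}d(\alpha^\top P_1,\alpha^\top P_2)$, where $\alpha^\top P_i$ is the law of $\alpha^\top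 X$ for $X\sim P_i$. Then there is a constant $C$, depending only on $K$, $B_\sigma$ and $B_w$ (not on $N$, $D$, $M$, $\sigma$, $A$, $W$, $\tilde W$), such that $$d_{\mathrm{MS}}(P,\hat P)\le C\left(\Big\|\tfrac1{\sqrt N}WM_1^{1/2}\Big\|^2+\Big\|\tfrac1{\sqrt N}WM_2^{1/2}\Big\|+\tfrac1{\sqrt N}\Big\|\tfrac1{\sqrt D}\tilde WA^\top\Big\|^2+\frac{1+\sum_{i\ne j}(a_i^\top a_j)^4}{\sqrt N}\right),$$ where $\|\cdot\|$ of a matrix is the Euclidean operator norm. -/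

import Mathlib

open MeasureTheory ProbabilityTheory
open scoped ENNReal Matrix MatrixOrder Matrix.Norms.L2Operator

namespace GaussianEquivalence

noncomputable section

/-! ### The maximum-sliced distance -/

/-- The class of thrice-differentiable functions `f : ℝ → ℝ` with `‖f''‖_∞ ≤ 1` and
`‖f'''‖_∞ ≤ 1`. -/
def TestFunction (f : ℝ → ℝ) : Prop :=
  (∀ k < 3, Differentiable ℝ (iteratedDeriv k f)) ∧
    (∀ x, |iteratedDeriv 2 f x| ≤ 1) ∧ (∀ x, |iteratedDeriv 3 f x| ≤ 1)

open Classical in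
/-- `|E_P f - E_Q f|`, and `∞` if one of the two expectations does not exist. -/
def expectationGap (P Q : Measure ℝ) (f : ℝ → ℝ) : ℝ≥0∞ :=
  if Integrable f P ∧ Integrable f Q then ENNReal.ofReal |∫ x, f x ∂P - ∫ x, f x ∂Q| else ∞

/-- `d(P, Q) = sup_f |E_P f - E_Q f|`, the supremum being over all test functions. -/
def dist1 (P Q : Measure ℝ) : ℝ≥0∞ :=
  ⨆ (f : ℝ → ℝ) (_ : TestFunction f), expectationGap P Q f

/-- The law of `αᵀ X` for `X ∼ P`. -/
def slice {ι : Type*} [Fintype ι] (P : Measure (EuclideanSpace ℝ ι)) (α : EuclideanSpace ℝ ι) :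
    Measure ℝ :=
  P.map (fun x => inner ℝ α x)

/-- The maximum-sliced distance `sup_{‖α‖ ≤ 1} d(αᵀ P, αᵀ Q)`. -/
def distMS {ι : Type*} [Fintype ι] (P Q : Measure (EuclideanSpace ℝ ι)) : ℝ≥0∞ :=
  ⨆ (α : EuclideanSpace ℝ ι) (_ : ‖α‖ ≤ 1), dist1 (slice P α) (slice Q α)

/-- The Gaussian distribution with the same mean vector and covariance matrix as `P`. -/
def gaussianEquivalent {ι : Type*} [Fintype ι] [DecidableEq ι]
    (P : Measure (EuclideanSpace ℝ ι)) : Measure (EuclideanSpace ℝ ι) :=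
  multivariateGaussian (∫ x, x ∂P) (Matrix.of fun i j => cov[fun x => x i, fun x => x j; P])

/-! ### The model -/

/-- The pre-activations `(λ, ν)` as a function of the latent vector `c`:
`λ^k = N^{-1/2} ∑ i, w_i^k σ(a_iᵀ c)` and `ν^m = D^{-1/2} ∑ r, w̃_r^m c_r`. -/
def preactivation {K M N D : ℕ} (σ : ℝ → ℝ) (A : Matrix (Fin N) (Fin D) ℝ)
    (W : Matrix (Fin K) (Fin N) ℝ) (W' : Matrix (Fin M) (Fin D) ℝ)
    (c : EuclideanSpace ℝ (Fin D)) : EuclideanSpace ℝ (Fin K ⊕ Fin M) :=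
  WithLp.toLp 2 (Sum.elim
    (fun k => (1 / √(N : ℝ)) * ∑ i, W k i * σ (∑ r, A i r * c r))
    (fun m => (1 / √(D : ℝ)) * ∑ r, W' m r * c r))

/-- The joint law of `(λ, ν)` for `c ∼ N(0, I_D)`. -/
def preactivationLaw {K M N D : ℕ} (σ : ℝ → ℝ) (A : Matrix (Fin N) (Fin D) ℝ)
    (W : Matrix (Fin K) (Fin N) ℝ) (W' : Matrix (Fin M) (Fin D) ℝ) :
    Measure (EuclideanSpace ℝ (Fin K ⊕ Fin M)) :=
  (stdGaussian (EuclideanSpace ℝ (Fin D))).map (preactivation σ A W W')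

/-- `σ` is thrice differentiable, and `E|σ(u)|⁴`, `E|σ'(u)|²`, `E|σ''(u)|²` exist and are at most
`B`, for `u ∼ N(0, 1)`. -/
structure SmoothBounded (σ : ℝ → ℝ) (B : ℝ) : Prop where
  differentiable : ∀ k < 3, Differentiable ℝ (iteratedDeriv k σ)
  integrable_zero : Integrable (fun u => |σ u| ^ 4) (gaussianReal 0 1)
  integrable_one : Integrable (fun u => |deriv σ u| ^ 2) (gaussianReal 0 1)
  integrable_two : Integrable (fun u => |iteratedDeriv 2 σ u| ^ 2) (gaussianReal 0 1)
  le_zero : ∫ u, |σ u| ^ 4 ∂(gaussianReal 0 1) ≤ B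
  le_one : ∫ u, |deriv σ u| ^ 2 ∂(gaussianReal 0 1) ≤ B
  le_two : ∫ u, |iteratedDeriv 2 σ u| ^ 2 ∂(gaussianReal 0 1) ≤ B

/-- First Hermite coefficient `E[σ(u) u]`. -/
def hermite1 (σ : ℝ → ℝ) : ℝ := ∫ u, σ u * u ∂(gaussianReal 0 1)

/-- Second Hermite coefficient `E[σ(u) (u² - 1)] / √2`. -/
def hermite2 (σ : ℝ → ℝ) : ℝ := (1 / √2) * ∫ u, σ u * (u ^ 2 - 1) ∂(gaussianReal 0 1)

/-- Third Hermite coefficient `E[σ(u) (u³ - 3u)] / √6`. -/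
def hermite3 (σ : ℝ → ℝ) : ℝ := (1 / √6) * ∫ u, σ u * (u ^ 3 - 3 * u) ∂(gaussianReal 0 1)

/-- `ρ = A Aᵀ`. -/
def rho {N D : ℕ} (A : Matrix (Fin N) (Fin D) ℝ) : Matrix (Fin N) (Fin N) ℝ := A * Aᵀ

/-- `ρ̃ = A Aᵀ - I_N`. -/
def rhoTilde {N D : ℕ} (A : Matrix (Fin N) (Fin D) ℝ) : Matrix (Fin N) (Fin N) ℝ := rho A - 1

/-- `M₁ = N^{-1/2} (σ̂(1)² ρ̃² + σ̂(2)² (ρ̃² ∘ ρ))`. -/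
def matM1 {N D : ℕ} (σ : ℝ → ℝ) (A : Matrix (Fin N) (Fin D) ℝ) : Matrix (Fin N) (Fin N) ℝ :=
  (1 / √(N : ℝ)) •
    (hermite1 σ ^ 2 • rhoTilde A ^ 2 + hermite2 σ ^ 2 • ((rhoTilde A ^ 2) ⊙ rho A))

/-- `M₂ = σ̂(2)² (ρ̃ ∘ ρ̃)² + σ̂(3)² ((ρ̃ ∘ ρ̃)² ∘ ρ)`. -/
def matM2 {N D : ℕ} (σ : ℝ → ℝ) (A : Matrix (Fin N) (Fin D) ℝ) : Matrix (Fin N) (Fin N) ℝ :=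
  hermite2 σ ^ 2 • (rhoTilde A ⊙ rhoTilde A) ^ 2 +
    hermite3 σ ^ 2 • (((rhoTilde A ⊙ rhoTilde A) ^ 2) ⊙ rho A)

theorem rho_posSemidef {N D : ℕ} (A : Matrix (Fin N) (Fin D) ℝ) : (rho A).PosSemidef := by
  have h := Matrix.posSemidef_self_mul_conjTranspose A
  rwa [Matrix.conjTranspose_eq_transpose_of_trivial] at h

theorem rhoTilde_isHermitian {N D : ℕ} (A : Matrix (Fin N) (Fin D) ℝ) :
    (rhoTilde A).IsHermitian :=
  (rho_posSemidef A).isHermitian.sub Matrix.isHermitian_one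

theorem sq_posSemidef {N : ℕ} {S : Matrix (Fin N) (Fin N) ℝ} (hS : S.IsHermitian) :
    (S ^ 2).PosSemidef := by
  have h := Matrix.posSemidef_self_mul_conjTranspose S
  rwa [hS.eq, ← sq] at h

/-- `M₁` is positive semidefinite, so that `CFC.sqrt` is its positive semidefinite square root. -/
theorem matM1_posSemidef {N D : ℕ} (σ : ℝ → ℝ) (A : Matrix (Fin N) (Fin D) ℝ) :
    (matM1 σ A).PosSemidef :=
  have h := sq_posSemidef (rhoTilde_isHermitian A)
  ((h.smul (sq_nonneg _)).add ((h.hadamard (rho_posSemidef A)).smul (sq_nonneg _))).smul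
    (by positivity)

/-- `M₂` is positive semidefinite, so that `CFC.sqrt` is its positive semidefinite square root. -/
theorem matM2_posSemidef {N D : ℕ} (σ : ℝ → ℝ) (A : Matrix (Fin N) (Fin D) ℝ) :
    (matM2 σ A).PosSemidef :=
  have hH : (rhoTilde A ⊙ rhoTilde A).IsHermitian := by
    have := rhoTilde_isHermitian A
    rw [Matrix.IsHermitian, Matrix.conjTranspose_hadamard, this.eq]
  have h := sq_posSemidef hH
  (h.smul (sq_nonneg _)).add ((h.hadamard (rho_posSemidef A)).smul (sq_nonneg _))

/-- The sum of four terms in the error bound; `‖·‖` is the operator norm of a matrix with respect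
to the Euclidean norms, and `CFC.sqrt` is the positive semidefinite square root. -/
def errorBound {K M N D : ℕ} (σ : ℝ → ℝ) (A : Matrix (Fin N) (Fin D) ℝ)
    (W : Matrix (Fin K) (Fin N) ℝ) (W' : Matrix (Fin M) (Fin D) ℝ) : ℝ :=
  ‖(1 / √(N : ℝ)) • (W * CFC.sqrt (matM1 σ A))‖ ^ 2 +
    ‖(1 / √(N : ℝ)) • (W * CFC.sqrt (matM2 σ A))‖ +
    (1 / √(N : ℝ)) * ‖(1 / √(D : ℝ)) • (W' * Aᵀ)‖ ^ 2 +
    (1 + ∑ p ∈ (Finset.univ : Finset (Fin N)).offDiag, (A p.1 ⬝ᵥ A p.2) ^ 4) / √(N : ℝ)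

end

end GaussianEquivalence

namespace GaussianEquivalence

local notation "γ" => gaussianReal 0 1

open scoped RealInnerProductSpace

section

/-! ### One-dimensional Gaussian calculus -/

/-! Fix `α` in the unit ball. The slice of `(λ, ν)` is a constant plus `S = ∑ v_i σ(a_iᵀ c) + bᵀ c`,
where `σ` has been centred, `v = N^{-1/2} αᵀ W` has entries of order `N^{-1/2}` and `b = D^{-1/2} αᵀ
W̃`. The same slice of the Gaussian equivalent is normal with the same mean and variance, so the
theorem is a quantitative one-dimensional CLT for `S`, proved by Stein's method: it suffices that
`E[S g(S)]` is close to `E[S²] E[g'(S)]` whenever `|g'| ≤ 1` and `g'` is 1-Lipschitz (`SteinTest`,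
with `g = f'`). Interpolation along `sin θ · S + cos θ · qZ` turns this into a bound on test
functions (`abs_integral_comp_sub_gaussian_le`).

For the Stein equation, remove the `n`-th summand from `S`, leaving `H`. As a function of the single
coordinate `z = a_nᵀ c`, the rest fixed, `H` varies slowly: its derivative only involves the
correlations `a_iᵀ a_n`, `i ≠ n`, and `bᵀ a_n`. Taylor expansion and Poincaré inequalities give
`E[σ(z) g(H)] ≈ E[σ(u)u] E[g'(H) ∂H]` (`Activation.leave_one_out`, from a one-dimensional estimate
by resampling). Summing over `n` gives `E[S g(S)] ≈ E[g'(S) τ]`, where the kernel `τ` is a sum of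
functions of one coordinate each. Each of these is almost uncorrelated with `g'(S)`, so `τ` may be
replaced by its mean, and `g = id` identifies that mean with `E[S²]` up to the same error
(`Activation.stein_equation`).

The errors are sums over `n` of `E[(∂H)²]`, `E[k(z)(∂H)²]` and `E[(∂²H)²]`, where `k` is the weight
in a `|σ|`-weighted Poincaré inequality. For centred `φ`, the correlation `E[φ(aᵀc) φ(bᵀc)]` is `aᵀb
· E[uφ(u)]²` up to a multiple of `(aᵀb)²`, and a similar expansion holds with the third factor
`k(eᵀc)` (`MomentPair.abs_integral_triple_sub_le`). Applied to `σ'` and `σ''`, the mean and the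
linear part give exactly the quadratic forms of `M₁` and `M₂` at `v`; the remainders give `∑ (a_iᵀ
a_j)^4`. The weighted sum needs slightly more than `σ' ∈ L²`: since `k ∈ L⁴`, Hölder with `1/4 + 3/8
+ 3/8 = 1` asks for `σ' ∈ L^{8/3}`, which a Gaussian Gagliardo–Nirenberg inequality extracts from `σ
∈ L⁴` and `σ'' ∈ L²` (`Activation.momentPair`). `Activation.stein_bound` and `error_terms_le`
collect the terms. -/

theorem integrable_gaussianReal_iff {f : ℝ → ℝ} :
    Integrable f γ ↔ Integrable (fun x => gaussianPDFReal 0 1 x * f x) := by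
  rw [gaussianReal_of_var_ne_zero _ one_ne_zero,
    integrable_withDensity_iff_integrable_smul' (measurable_gaussianPDF _ _)
      (ae_of_all _ fun x => by simp [gaussianPDF])]
  simp [gaussianPDF, gaussianPDFReal_nonneg]

theorem integral_gaussianReal_eq (f : ℝ → ℝ) :
    ∫ x, f x ∂γ = ∫ x, gaussianPDFReal 0 1 x * f x := by
  rw [integral_gaussianReal_eq_integral_smul one_ne_zero]; simp

theorem hasDerivAt_gaussianPDFReal (x : ℝ) :
    HasDerivAt (gaussianPDFReal 0 1) (-x * gaussianPDFReal 0 1 x) x := by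
  rw [gaussianPDFReal_def]
  have h : HasDerivAt (fun x : ℝ => -(x - 0) ^ 2 / (2 * ((1 : NNReal) : ℝ))) (-x) x := by
    have := (((hasDerivAt_id x).sub_const 0).pow 2).neg.div_const (2 * ((1 : NNReal) : ℝ))
    refine this.congr_deriv ?_
    simp
    ring
  refine (h.exp.const_mul _).congr_deriv ?_
  ring

/-- Gaussian integration by parts. -/
theorem gaussian_integral_mul_self {h h' : ℝ → ℝ} (hd : ∀ x, HasDerivAt h (h' x) x)
    (hi : Integrable h γ) (hxi : Integrable (fun x => x * h x) γ) (hi' : Integrable h' γ) :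
    ∫ x, x * h x ∂γ = ∫ x, h' x ∂γ := by
  rw [integrable_gaussianReal_iff] at hi hxi hi'
  have := integral_mul_deriv_eq_deriv_mul_of_integrable (u := gaussianPDFReal 0 1) (v := h)
    (u' := fun x => -x * gaussianPDFReal 0 1 x) (v' := h')
    (fun x _ => hasDerivAt_gaussianPDFReal x) (fun x _ => hd x) hi'
    (by
      refine hxi.neg.congr (ae_of_all _ fun x => ?_)
      simp only [Pi.neg_apply, Pi.mul_apply]; ring) hi
  rw [integral_gaussianReal_eq, integral_gaussianReal_eq, this, ← integral_neg]
  congr 1; ext x; ring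

theorem memLp_id_pow (k : ℕ) (p : ℝ≥0∞) (hp : p ≠ ∞) : MemLp (fun x : ℝ => x ^ k) p γ := by
  rcases Nat.eq_zero_or_pos k with rfl | hk
  · simpa using memLp_const (1 : ℝ)
  have h := memLp_id_gaussianReal' (μ := 0) (v := 1) (p * k) (ENNReal.mul_ne_top hp (by simp))
  have h2 := h.norm_rpow_div (k : ℝ≥0∞)
  have h3 : MemLp (fun x : ℝ => ‖x ^ k‖) p γ := by
    convert h2 using 2
    · simp
    · rw [ENNReal.mul_div_cancel_right (by simp; omega) (by simp)]
  exact (memLp_norm_iff (by fun_prop)).1 h3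

theorem integrable_id_pow (k : ℕ) : Integrable (fun x : ℝ => x ^ k) γ :=
  memLp_one_iff_integrable.1 (memLp_id_pow k 1 (by simp))

theorem integral_id_sq : ∫ x : ℝ, x ^ 2 ∂γ = 1 := by
  have := gaussian_integral_mul_self (h := fun x => x) (h' := fun _ => 1) (fun x => hasDerivAt_id x)
    (by simpa using integrable_id_pow 1) (by simpa [← sq] using integrable_id_pow 2)
    (integrable_const _)
  simpa [← sq] using this

theorem integral_id_pow_four : ∫ x : ℝ, x ^ 4 ∂γ = 3 := by
  have := gaussian_integral_mul_self (h := fun x => x ^ 3) (h' := fun x => 3 * x ^ 2)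
    (fun x => by simpa using hasDerivAt_pow 3 x)
    (integrable_id_pow 3) (by simpa [← pow_succ'] using integrable_id_pow 4)
    ((integrable_id_pow 2).const_mul _)
  rw [integral_const_mul, integral_id_sq] at this
  simpa [← pow_succ'] using this

theorem map_rotation (θ : ℝ) :
    ((γ).prod γ).map (fun p : ℝ × ℝ => (Real.cos θ * p.1 + Real.sin θ * p.2,
      -Real.sin θ * p.1 + Real.cos θ * p.2)) = (γ).prod γ := by
  have h := IsGaussian.map_rotation_eq_self (μ := γ) (by simp) θ
  convert h using 2
  ext p <;> simp [ContinuousLinearMap.rotation]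

/-- The weight produced by transporting `ω` along the rotation from `z` to an independent copy. -/
noncomputable def rotationWeight (ω : ℝ → ℝ) (z : ℝ) : ℝ≥0∞ :=
  ENNReal.ofReal (Real.pi / 2) * ∫⁻ θ in Set.Ioc 0 (Real.pi / 2), ∫⁻ z',
    ENNReal.ofReal (ω (Real.cos θ * z - Real.sin θ * z') * z' ^ 2) ∂γ

theorem measurable_rotationWeight {ω : ℝ → ℝ} (hω : Measurable ω) :
    Measurable (rotationWeight ω) := by
  unfold rotationWeight
  refine Measurable.const_mul ?_ _
  refine Measurable.lintegral_prod_right' (f := fun q : ℝ × ℝ => ∫⁻ z',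
    ENNReal.ofReal (ω (Real.cos q.2 * q.1 - Real.sin q.2 * z') * z' ^ 2) ∂γ) ?_
  refine Measurable.lintegral_prod_right' (f := fun q : (ℝ × ℝ) × ℝ =>
    ENNReal.ofReal (ω (Real.cos q.1.2 * q.1.1 - Real.sin q.1.2 * q.2) * q.2 ^ 2)) ?_
  have : Measurable fun q : (ℝ × ℝ) × ℝ => Real.cos q.1.2 * q.1.1 - Real.sin q.1.2 * q.2 := by
    fun_prop
  have := hω.comp this
  fun_prop

/-- Integrate the derivative of `h (cos θ z + sin θ z')`, which runs from `h z` to `h z'` on a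
quarter circle, and apply Cauchy–Schwarz in `θ`. For independent Gaussian `z, z'` the two factors of
the integrand become independent at each `θ`. -/
theorem sq_sub_le_rotation {h h' : ℝ → ℝ} (hd : ∀ x, HasDerivAt h (h' x) x)
    (hc : Continuous h') (z z' : ℝ) :
    ENNReal.ofReal ((h z - h z') ^ 2) ≤ ENNReal.ofReal (Real.pi / 2) *
      ∫⁻ θ in Set.Ioc 0 (Real.pi / 2), ENNReal.ofReal
        ((h' (Real.cos θ * z + Real.sin θ * z') * (-Real.sin θ * z + Real.cos θ * z')) ^ 2) := by
  set F : ℝ → ℝ := fun θ =>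
    h' (Real.cos θ * z + Real.sin θ * z') * (-Real.sin θ * z + Real.cos θ * z') with hF
  have hFc : Continuous F := by fun_prop
  have hpi : (0 : ℝ) ≤ Real.pi / 2 := by positivity
  have hderiv : ∀ θ, HasDerivAt (fun θ => h (Real.cos θ * z + Real.sin θ * z')) (F θ) θ := by
    intro θ
    have h1 := ((Real.hasDerivAt_cos θ).mul_const z).add ((Real.hasDerivAt_sin θ).mul_const z')
    exact (hd (Real.cos θ * z + Real.sin θ * z')).comp θ h1
  have hint := intervalIntegral.integral_eq_sub_of_hasDerivAt
    (f := fun θ => h (Real.cos θ * z + Real.sin θ * z')) (fun θ _ => hderiv θ)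
    (hFc.intervalIntegrable 0 (Real.pi / 2))
  simp only [Real.cos_pi_div_two, Real.sin_pi_div_two, Real.cos_zero, Real.sin_zero, zero_mul,
    one_mul, zero_add, add_zero] at hint
  have hcs : (∫ θ in (0 : ℝ)..Real.pi / 2, F θ) ^ 2 ≤
      (Real.pi / 2) * ∫ θ in (0 : ℝ)..Real.pi / 2, F θ ^ 2 := by
    have h0 : ∀ t : ℝ, 0 ≤ ∫ θ in (0 : ℝ)..Real.pi / 2, (F θ - t) ^ 2 := fun t =>
      intervalIntegral.integral_nonneg hpi fun _ _ => sq_nonneg _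
    have hexp : ∀ t : ℝ, ∫ θ in (0 : ℝ)..Real.pi / 2, (F θ - t) ^ 2 =
        (∫ θ in (0 : ℝ)..Real.pi / 2, F θ ^ 2) - 2 * t * (∫ θ in (0 : ℝ)..Real.pi / 2, F θ)
          + Real.pi / 2 * t ^ 2 := by
      intro t
      have : (fun θ => (F θ - t) ^ 2) = fun θ => (F θ ^ 2 - 2 * t * F θ) + t ^ 2 := by
        ext θ; ring
      rw [this, intervalIntegral.integral_add, intervalIntegral.integral_sub]
      · simp
      all_goals exact Continuous.intervalIntegrable (by fun_prop) _ _
    set I := ∫ θ in (0 : ℝ)..Real.pi / 2, F θ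
    set J := ∫ θ in (0 : ℝ)..Real.pi / 2, F θ ^ 2
    -- The mean of `F` is the optimal `t`; it turns the nonnegative quadratic into Cauchy–Schwarz.
    have h1 := h0 (I / (Real.pi / 2))
    rw [hexp] at h1
    have hp : 0 < Real.pi / 2 := by positivity
    have : J - 2 * (I / (Real.pi / 2)) * I + Real.pi / 2 * (I / (Real.pi / 2)) ^ 2
        = J - I ^ 2 / (Real.pi / 2) := by field_simp; ring
    rw [this, sub_nonneg, div_le_iff₀ hp] at h1
    linarith
  have hsq : (h z - h z') ^ 2 = (∫ θ in (0 : ℝ)..Real.pi / 2, F θ) ^ 2 := by rw [hint]; ring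
  rw [hsq]
  refine (ENNReal.ofReal_le_ofReal hcs).trans ?_
  rw [ENNReal.ofReal_mul hpi, intervalIntegral.integral_of_le hpi,
    ofReal_integral_eq_lintegral_ofReal]
  · exact ((hFc.pow 2).intervalIntegrable 0 (Real.pi / 2)).1
  · exact ae_of_all _ fun _ => sq_nonneg _

/-- A weighted Poincaré inequality. -/
theorem lintegral_weight_mul_sq_sub_le {ω h h' : ℝ → ℝ} (hω : Measurable ω) (hω0 : ∀ x, 0 ≤ ω x)
    (hd : ∀ x, HasDerivAt h (h' x) x) (hc : Continuous h') :
    ∫⁻ p, ENNReal.ofReal (ω p.1 * (h p.1 - h p.2) ^ 2) ∂((γ).prod γ) ≤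
      ∫⁻ z, rotationWeight ω z * ENNReal.ofReal (h' z ^ 2) ∂γ := by
  have hpi : (0 : ℝ) ≤ Real.pi / 2 := by positivity
  have hω' : ∀ θ : ℝ, Measurable fun p : ℝ × ℝ => ω (Real.cos θ * p.1 - Real.sin θ * p.2) :=
    fun θ => hω.comp (by fun_prop)
  calc ∫⁻ p, ENNReal.ofReal (ω p.1 * (h p.1 - h p.2) ^ 2) ∂((γ).prod γ)
      ≤ ∫⁻ p, (ENNReal.ofReal (Real.pi / 2) * ∫⁻ θ in Set.Ioc 0 (Real.pi / 2),
          ENNReal.ofReal (ω p.1) * ENNReal.ofReal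
        ((h' (Real.cos θ * p.1 + Real.sin θ * p.2) *
          (-Real.sin θ * p.1 + Real.cos θ * p.2)) ^ 2)) ∂((γ).prod γ) := by
        refine lintegral_mono fun p => ?_
        rw [ENNReal.ofReal_mul (hω0 _), lintegral_const_mul' _ _ ENNReal.ofReal_ne_top,
          mul_left_comm]
        gcongr
        exact sq_sub_le_rotation hd hc _ _
    _ = ENNReal.ofReal (Real.pi / 2) * ∫⁻ θ in Set.Ioc 0 (Real.pi / 2), ∫⁻ p : ℝ × ℝ,
          ENNReal.ofReal (ω p.1) * ENNReal.ofReal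
        ((h' (Real.cos θ * p.1 + Real.sin θ * p.2) *
          (-Real.sin θ * p.1 + Real.cos θ * p.2)) ^ 2) ∂((γ).prod γ) := by
        rw [lintegral_const_mul' _ _ ENNReal.ofReal_ne_top, lintegral_lintegral_swap]
        refine Measurable.aemeasurable ?_
        simp only [Function.uncurry_def]
        have h1 : Measurable fun q : (ℝ × ℝ) × ℝ => ω q.1.1 := hω.comp (by fun_prop)
        have h2 : Measurable h' := hc.measurable
        fun_prop
    _ = ENNReal.ofReal (Real.pi / 2) * ∫⁻ θ in Set.Ioc 0 (Real.pi / 2), ∫⁻ p : ℝ × ℝ,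
          ENNReal.ofReal (ω (Real.cos θ * p.1 - Real.sin θ * p.2) * p.2 ^ 2) *
            ENNReal.ofReal (h' p.1 ^ 2) ∂((γ).prod γ) := by
        congr 1
        refine lintegral_congr fun θ => ?_
        -- Rotation invariance makes the argument of `h'` a coordinate of its own; the inverse
        -- rotation then appears inside `ω`.
        conv_rhs => rw [← map_rotation θ]
        rw [lintegral_map]
        · refine lintegral_congr fun p => ?_
          have e1 : Real.cos θ * (Real.cos θ * p.1 + Real.sin θ * p.2) -
              Real.sin θ * (-Real.sin θ * p.1 + Real.cos θ * p.2) = p.1 := by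
            linear_combination p.1 * Real.sin_sq_add_cos_sq θ
          simp only [e1]
          rw [← ENNReal.ofReal_mul (hω0 _),
            ← ENNReal.ofReal_mul (mul_nonneg (hω0 _) (sq_nonneg _))]
          congr 1; ring
        · have h2 : Measurable h' := hc.measurable
          have := hω' θ
          fun_prop
        · fun_prop
    _ = ENNReal.ofReal (Real.pi / 2) * ∫⁻ θ in Set.Ioc 0 (Real.pi / 2), ∫⁻ z,
          (∫⁻ z', ENNReal.ofReal (ω (Real.cos θ * z - Real.sin θ * z') * z' ^ 2) ∂γ) *
            ENNReal.ofReal (h' z ^ 2) ∂γ := by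
        congr 1
        refine lintegral_congr fun θ => ?_
        have h2 : Measurable h' := hc.measurable
        have := hω' θ
        rw [lintegral_prod _ (by fun_prop)]
        refine lintegral_congr fun z => ?_
        dsimp only
        rw [lintegral_mul_const' _ _ ENNReal.ofReal_ne_top]
    _ = ∫⁻ z, rotationWeight ω z * ENNReal.ofReal (h' z ^ 2) ∂γ := by
        rw [lintegral_lintegral_swap, ← lintegral_const_mul' _ _ ENNReal.ofReal_ne_top]
        · refine lintegral_congr fun z => ?_
          rw [lintegral_mul_const' _ _ ENNReal.ofReal_ne_top, rotationWeight, mul_assoc]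
        · refine Measurable.aemeasurable ?_
          simp only [Function.uncurry_def]
          have h2 : Measurable h' := hc.measurable
          refine Measurable.mul ?_ (by fun_prop)
          refine Measurable.lintegral_prod_right' (f := fun q : (ℝ × ℝ) × ℝ =>
            ENNReal.ofReal (ω (Real.cos q.1.1 * q.1.2 - Real.sin q.1.1 * q.2) * q.2 ^ 2)) ?_
          have : Measurable fun q : (ℝ × ℝ) × ℝ =>
            ω (Real.cos q.1.1 * q.1.2 - Real.sin q.1.1 * q.2) := hω.comp (by fun_prop)
          fun_prop

end

section

/-! ### Cauchy–Schwarz and Poincaré inequalities -/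

theorem integral_sub_add {α : Type*} [MeasurableSpace α] {ν : Measure α} {f g h : α → ℝ}
    (hf : Integrable f ν) (hg : Integrable g ν) (hh : Integrable h ν) :
    ∫ x, (f x - g x + h x) ∂ν = (∫ x, f x ∂ν) - (∫ x, g x ∂ν) + ∫ x, h x ∂ν := by
  rw [← integral_sub hf hg, ← integral_add _ hh]
  exact hf.sub hg

theorem lintegral_mul_sq_le {α : Type*} [MeasurableSpace α] {ν : Measure α} {f g : α → ℝ≥0∞}
    (hf : AEMeasurable f ν) (hg : AEMeasurable g ν) :
    (∫⁻ x, f x * g x ∂ν) ^ 2 ≤ (∫⁻ x, f x ^ 2 ∂ν) * ∫⁻ x, g x ^ 2 ∂ν := by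
  have h := ENNReal.lintegral_mul_le_Lp_mul_Lq ν Real.HolderConjugate.two_two hf hg
  have h2 := pow_le_pow_left' h 2
  refine h2.trans (le_of_eq ?_)
  rw [mul_pow, ← ENNReal.rpow_mul_natCast, ← ENNReal.rpow_mul_natCast]
  norm_num

/-- Cauchy–Schwarz read off from the nonnegative quadratic form `∫ (s f - t g)²` in `s, t`. -/
theorem integral_mul_sq_le {α : Type*} [MeasurableSpace α] {ν : Measure α} {f g : α → ℝ}
    (hf : MemLp f 2 ν) (hg : MemLp g 2 ν) :
    (∫ x, f x * g x ∂ν) ^ 2 ≤ (∫ x, f x ^ 2 ∂ν) * ∫ x, g x ^ 2 ∂ν := by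
  have hfg : Integrable (fun x => f x * g x) ν := hf.integrable_mul hg
  have hF := hf.integrable_sq
  have hG := hg.integrable_sq
  have key : ∀ s t : ℝ, 0 ≤ s ^ 2 * (∫ x, f x ^ 2 ∂ν) - 2 * s * t * (∫ x, f x * g x ∂ν)
      + t ^ 2 * ∫ x, g x ^ 2 ∂ν := by
    intro s t
    have : 0 ≤ ∫ x, (s * f x - t * g x) ^ 2 ∂ν := integral_nonneg fun _ => sq_nonneg _
    have e : (fun x => (s * f x - t * g x) ^ 2) = fun x =>
        (s ^ 2 * f x ^ 2 - 2 * s * t * (f x * g x)) + t ^ 2 * g x ^ 2 := by ext x; ring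
    rw [e, integral_sub_add (hF.const_mul _) (hfg.const_mul _) (hG.const_mul _)] at this
    simpa only [integral_const_mul] using this
  set A := ∫ x, f x ^ 2 ∂ν
  set I := ∫ x, f x * g x ∂ν
  set G := ∫ x, g x ^ 2 ∂ν
  have hA : 0 ≤ A := integral_nonneg fun _ => sq_nonneg _
  rcases hA.eq_or_lt with h0 | h0
  · have h1 := key 1 0
    have hI : I = 0 := by
      -- With `A = 0` this choice makes the form equal to `-I⁴ (G + 2)`, which forces `I = 0`.
      have hk1 := key (I * (G + 1)) (I ^ 2)
      rw [← h0] at hk1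
      have hG0 : 0 ≤ G := integral_nonneg fun _ => sq_nonneg _
      by_contra hne
      have : 0 < I ^ 4 := by positivity
      nlinarith
    rw [← h0, hI]; simp
  · have := key I A
    nlinarith

theorem abs_integral_mul_le {α : Type*} [MeasurableSpace α] {ν : Measure α} {f g : α → ℝ}
    (hf : MemLp f 2 ν) (hg : MemLp g 2 ν) :
    |∫ x, f x * g x ∂ν| ≤ √(∫ x, f x ^ 2 ∂ν) * √(∫ x, g x ^ 2 ∂ν) := by
  rw [← Real.sqrt_mul (integral_nonneg fun _ => sq_nonneg _), ← Real.sqrt_sq_eq_abs]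
  exact Real.sqrt_le_sqrt (integral_mul_sq_le hf hg)

/-- The weight is an average over `θ` and an independent `z'`. One Cauchy–Schwarz separates `z'²`,
whose second moment `3` is squared to `9`, a second one raises `ω` to the fourth power, and rotation
invariance removes `θ` from `E ω⁴`. The powers of `π/2` come from the prefactor and the total mass
of the `θ`-interval. -/
theorem lintegral_rotationWeight_pow_four {ω : ℝ → ℝ} (hω : Measurable ω) (hω0 : ∀ x, 0 ≤ ω x) :
    ∫⁻ z, rotationWeight ω z ^ 4 ∂γ ≤
      ENNReal.ofReal (9 * (Real.pi / 2) ^ 8) * ∫⁻ z, ENNReal.ofReal (ω z ^ 4) ∂γ := by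
  set c : ℝ≥0∞ := ENNReal.ofReal (Real.pi / 2) with hc
  have hpi : (0 : ℝ) ≤ Real.pi / 2 := by positivity
  set ν : Measure (ℝ × ℝ) := (volume.restrict (Set.Ioc 0 (Real.pi / 2))).prod γ with hν
  have hm : Measurable fun q : ℝ × ℝ × ℝ => ω (Real.cos q.2.1 * q.1 - Real.sin q.2.1 * q.2.2) :=
    hω.comp (by fun_prop)
  have hmz : ∀ z : ℝ, Measurable fun q : ℝ × ℝ =>
      ω (Real.cos q.1 * z - Real.sin q.1 * q.2) := fun z => hω.comp (by fun_prop)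
  have hmass : ν Set.univ = c := by
    rw [hν, Measure.prod_apply MeasurableSet.univ]
    simp [hc]
  have hz4 : ∫⁻ q : ℝ × ℝ, ENNReal.ofReal (q.2 ^ 2) ^ 2 ∂ν = c * 3 := by
    rw [hν, lintegral_prod _ (by fun_prop)]
    have : ∫⁻ y : ℝ, ENNReal.ofReal (y ^ 2) ^ 2 ∂γ = 3 := by
      have e : (fun y : ℝ => ENNReal.ofReal (y ^ 2) ^ 2) = fun y => ENNReal.ofReal (y ^ 4) := by
        ext y; rw [← ENNReal.ofReal_pow (sq_nonneg y)]; ring_nf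
      rw [e, ← ofReal_integral_eq_lintegral_ofReal (integrable_id_pow 4)
        (ae_of_all _ fun y => by positivity), integral_id_pow_four]
      simp
    simp only [this]
    simp [hc, mul_comm]
  have hK : ∀ z, rotationWeight ω z ^ 4 ≤ c ^ 4 * ((c * 9 * c ^ 2) *
      ∫⁻ q, ENNReal.ofReal (ω (Real.cos q.1 * z - Real.sin q.1 * q.2) ^ 4) ∂ν) := by
    intro z
    have e : rotationWeight ω z = c * ∫⁻ q,
        ENNReal.ofReal (ω (Real.cos q.1 * z - Real.sin q.1 * q.2)) * ENNReal.ofReal (q.2 ^ 2) ∂ν := by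
      have := hmz z
      rw [rotationWeight, hν, lintegral_prod _ (by fun_prop)]
      simp only [ENNReal.ofReal_mul (hω0 _)]
      rfl
    have := hmz z
    rw [e, mul_pow]
    refine mul_le_mul_right ?_ _
    set f : ℝ × ℝ → ℝ≥0∞ := fun q =>
      ENNReal.ofReal (ω (Real.cos q.1 * z - Real.sin q.1 * q.2)) with hf
    have hfm : Measurable f := by fun_prop
    have h1 := lintegral_mul_sq_le (ν := ν) (f := f) (g := fun q => ENNReal.ofReal (q.2 ^ 2))
      hfm.aemeasurable (by fun_prop)
    have h2 := lintegral_mul_sq_le (ν := ν) (f := fun q => f q ^ 2) (g := fun _ => 1)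
      (by fun_prop) (by fun_prop)
    rw [hz4] at h1
    simp only [mul_one, one_pow, lintegral_const, one_mul, hmass] at h2
    calc (∫⁻ q, f q * ENNReal.ofReal (q.2 ^ 2) ∂ν) ^ 4
        = ((∫⁻ q, f q * ENNReal.ofReal (q.2 ^ 2) ∂ν) ^ 2) ^ 2 := by ring
      _ ≤ ((∫⁻ q, f q ^ 2 ∂ν) * (c * 3)) ^ 2 := pow_le_pow_left' h1 2
      _ = (∫⁻ q, f q ^ 2 ∂ν) ^ 2 * (9 * c ^ 2) := by ring
      _ ≤ ((∫⁻ q, (f q ^ 2) ^ 2 ∂ν) * c) * (9 * c ^ 2) := by gcongr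
      _ = (c * 9 * c ^ 2) * ∫⁻ q, (f q ^ 2) ^ 2 ∂ν := by ring
      _ = _ := by
        congr 1
        refine lintegral_congr fun q => ?_
        rw [hf, ← pow_mul, ← ENNReal.ofReal_pow (hω0 _)]
  have hrot : ∀ θ : ℝ, ∫⁻ z, ∫⁻ y, ENNReal.ofReal (ω (Real.cos θ * z - Real.sin θ * y) ^ 4) ∂γ ∂γ
      = ∫⁻ z, ENNReal.ofReal (ω z ^ 4) ∂γ := by
    intro θ
    have hmt : Measurable fun q : ℝ × ℝ => ω (Real.cos θ * q.1 - Real.sin θ * q.2) :=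
      hω.comp (by fun_prop)
    have h1 := lintegral_prod (μ := γ) (ν := γ)
      (fun q : ℝ × ℝ => ENNReal.ofReal (ω (Real.cos θ * q.1 - Real.sin θ * q.2) ^ 4)) (by fun_prop)
    rw [← h1]
    conv_lhs => rw [← map_rotation θ]
    rw [lintegral_map (by fun_prop) (by fun_prop), lintegral_prod]
    · have e1 : ∀ p : ℝ × ℝ, Real.cos θ * (Real.cos θ * p.1 + Real.sin θ * p.2) -
          Real.sin θ * (-Real.sin θ * p.1 + Real.cos θ * p.2) = p.1 := fun p => by
        linear_combination p.1 * Real.sin_sq_add_cos_sq θ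
      dsimp only at e1 ⊢
      have e2 := fun x y => e1 (x, y)
      dsimp only at e2
      simp only [e2]
      simp
    · have : Measurable fun p : ℝ × ℝ => ω (Real.cos θ * (Real.cos θ * p.1 + Real.sin θ * p.2) -
          Real.sin θ * (-Real.sin θ * p.1 + Real.cos θ * p.2)) := hω.comp (by fun_prop)
      fun_prop
  calc ∫⁻ z, rotationWeight ω z ^ 4 ∂γ
      ≤ ∫⁻ z, c ^ 4 * ((c * 9 * c ^ 2) *
          ∫⁻ q, ENNReal.ofReal (ω (Real.cos q.1 * z - Real.sin q.1 * q.2) ^ 4) ∂ν) ∂γ :=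
        lintegral_mono hK
    _ = c ^ 4 * ((c * 9 * c ^ 2) * ∫⁻ z,
          ∫⁻ q, ENNReal.ofReal (ω (Real.cos q.1 * z - Real.sin q.1 * q.2) ^ 4) ∂ν ∂γ) := by
        rw [lintegral_const_mul' _ _ (by simp [hc]), lintegral_const_mul' _ _ (by simp [hc]; finiteness)]
    _ = c ^ 4 * ((c * 9 * c ^ 2) * (c * ∫⁻ z, ENNReal.ofReal (ω z ^ 4) ∂γ)) := by
        congr 2
        have : ∀ z, ∫⁻ q, ENNReal.ofReal (ω (Real.cos q.1 * z - Real.sin q.1 * q.2) ^ 4) ∂ν =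
            ∫⁻ θ in Set.Ioc 0 (Real.pi / 2), ∫⁻ y,
              ENNReal.ofReal (ω (Real.cos θ * z - Real.sin θ * y) ^ 4) ∂γ := by
          intro z
          have := hmz z
          rw [hν, lintegral_prod _ (by fun_prop)]
        simp only [this]
        rw [lintegral_lintegral_swap]
        · simp only [hrot]
          simp [hc, mul_comm]
        · refine Measurable.aemeasurable ?_
          simp only [Function.uncurry_def]
          refine Measurable.lintegral_prod_right' (f := fun q : (ℝ × ℝ) × ℝ =>
            ENNReal.ofReal (ω (Real.cos q.1.2 * q.1.1 - Real.sin q.1.2 * q.2) ^ 4)) ?_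
          have : Measurable fun q : (ℝ × ℝ) × ℝ =>
            ω (Real.cos q.1.2 * q.1.1 - Real.sin q.1.2 * q.2) := hω.comp (by fun_prop)
          fun_prop
    _ = _ := by
        rw [← mul_assoc, ← mul_assoc]
        congr 1
        rw [ENNReal.ofReal_mul (by norm_num), ENNReal.ofReal_pow hpi]
        simp only [ENNReal.ofReal_ofNat]
        ring

theorem pi_div_two_le : Real.pi / 2 ≤ 5 / 3 := by
  have := Real.pi_lt_d2; linarith

theorem integrable_of_lintegral_ofReal_le {α : Type*} [MeasurableSpace α] {ν : Measure α}
    {f : α → ℝ} (hf : AEStronglyMeasurable f ν) (h0 : 0 ≤ f) {c : ℝ≥0∞} (hc : c ≠ ∞)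
    (h : ∫⁻ x, ENNReal.ofReal (f x) ∂ν ≤ c) : Integrable f ν := by
  refine ⟨hf, ?_⟩
  rw [hasFiniteIntegral_iff_ofReal (ae_of_all _ h0)]
  exact h.trans_lt hc.lt_top

/-- The weight of the Poincaré inequality as a function with finite fourth moment. -/
theorem exists_poincare_weight {ω : ℝ → ℝ} (hω : Measurable ω) (hω0 : ∀ x, 0 ≤ ω x)
    (hi : Integrable (fun x => ω x ^ 4) γ) {B : ℝ} (hB : ∫ x, ω x ^ 4 ∂γ ≤ B) :
    ∃ k : ℝ → ℝ, Measurable k ∧ (∀ x, 0 ≤ k x) ∧ Integrable (fun x => k x ^ 4) γ ∧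
      ∫ x, k x ^ 4 ∂γ ≤ 600 * B ∧
      ∀ h h' : ℝ → ℝ, (∀ x, HasDerivAt h (h' x) x) → Continuous h' →
        ∫⁻ p, ENNReal.ofReal (ω p.1 * (h p.1 - h p.2) ^ 2) ∂((γ).prod γ) ≤
          ∫⁻ z, ENNReal.ofReal (k z * h' z ^ 2) ∂γ := by
  have hm := measurable_rotationWeight hω
  have h4 := lintegral_rotationWeight_pow_four hω hω0
  rw [← ofReal_integral_eq_lintegral_ofReal hi (ae_of_all _ fun x => pow_nonneg (hω0 x) 4)] at h4
  -- `9 (5/3)^8` is about `536`.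
  have hconst : 9 * (Real.pi / 2) ^ 8 ≤ 600 := by
    have : (Real.pi / 2) ^ 8 ≤ (5 / 3) ^ 8 :=
      pow_le_pow_left₀ (by positivity) pi_div_two_le 8
    norm_num at this ⊢; linarith
  have hI0 : 0 ≤ ∫ x, ω x ^ 4 ∂γ := integral_nonneg fun x => pow_nonneg (hω0 x) 4
  have h4' : ∫⁻ z, rotationWeight ω z ^ 4 ∂γ ≤ ENNReal.ofReal (600 * B) := by
    refine h4.trans ?_
    rw [← ENNReal.ofReal_mul (by positivity)]
    refine ENNReal.ofReal_le_ofReal (mul_le_mul hconst hB hI0 (by norm_num))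
  -- A finite fourth moment makes the weight finite almost everywhere, so passing to `toReal` loses
  -- nothing.
  have hfin : ∀ᵐ z ∂γ, rotationWeight ω z < ∞ := by
    have := ae_lt_top' (hm.pow_const 4).aemeasurable (h4'.trans_lt ENNReal.ofReal_lt_top).ne
    filter_upwards [this] with z hz
    by_contra hcon
    simp only [not_lt, top_le_iff] at hcon
    simp [hcon] at hz
  have hk4 : ∫⁻ z, ENNReal.ofReal ((rotationWeight ω z).toReal ^ 4) ∂γ ≤
      ENNReal.ofReal (600 * B) := by
    refine le_trans (lintegral_mono fun z => ?_) h4'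
    rw [ENNReal.ofReal_pow ENNReal.toReal_nonneg]
    exact pow_le_pow_left' ENNReal.ofReal_toReal_le 4
  have hki : Integrable (fun z => (rotationWeight ω z).toReal ^ 4) γ :=
    integrable_of_lintegral_ofReal_le (hm.ennreal_toReal.pow_const 4).aestronglyMeasurable
      (fun z => by positivity) ENNReal.ofReal_ne_top hk4
  refine ⟨fun z => (rotationWeight ω z).toReal, hm.ennreal_toReal, fun _ => ENNReal.toReal_nonneg,
    hki, ?_, ?_⟩
  · rw [← ofReal_integral_eq_lintegral_ofReal hki (ae_of_all _ fun z => by positivity)] at hk4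
    exact (ENNReal.ofReal_le_ofReal_iff (by positivity [hI0.trans hB])).1 hk4
  · intro h h' hd hc
    refine (lintegral_weight_mul_sq_sub_le hω hω0 hd hc).trans (le_of_eq ?_)
    refine lintegral_congr_ae ?_
    filter_upwards [hfin] with z hz
    rw [ENNReal.ofReal_mul ENNReal.toReal_nonneg, ENNReal.ofReal_toReal hz.ne]

/-- The case `ω = 1`: the weight is the constant `(π/2)²`, and the double integral of `(h z - h
z')²` is twice the variance. The resulting `π²/8` is rounded up to `2`; the sharp constant `1` is
not needed. -/
theorem poincare {h h' : ℝ → ℝ} (hd : ∀ x, HasDerivAt h (h' x) x) (hc : Continuous h')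
    (hh : MemLp h 2 γ) (hh' : MemLp h' 2 γ) :
    ∫ x, (h x - ∫ y, h y ∂γ) ^ 2 ∂γ ≤ 2 * ∫ x, h' x ^ 2 ∂γ := by
  have h1 := lintegral_weight_mul_sq_sub_le (ω := fun _ => 1) measurable_const
    (fun _ => zero_le_one) hd hc
  have hw : ∀ z, rotationWeight (fun _ => 1) z = ENNReal.ofReal ((Real.pi / 2) ^ 2) := by
    intro z
    have : ∫⁻ y : ℝ, ENNReal.ofReal (y ^ 2) ∂γ = 1 := by
      rw [← ofReal_integral_eq_lintegral_ofReal (integrable_id_pow 2)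
        (ae_of_all _ fun y => by positivity), integral_id_sq]
      simp
    simp [rotationWeight, this, sq (Real.pi / 2), ENNReal.ofReal_mul (show (0:ℝ) ≤ Real.pi / 2 by positivity)]
  simp only [hw, one_mul] at h1
  have hm1 := hh.integrable one_le_two
  have hsq := hh.integrable_sq
  have hint1 : Integrable (fun p : ℝ × ℝ => h p.1 ^ 2) ((γ).prod γ) := hsq.comp_fst γ
  have hint2 : Integrable (fun p : ℝ × ℝ => h p.2 ^ 2) ((γ).prod γ) := hsq.comp_snd γ
  have hint3 : Integrable (fun p : ℝ × ℝ => h p.1 * h p.2) ((γ).prod γ) := hm1.mul_prod hm1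
  have e : (fun p : ℝ × ℝ => (h p.1 - h p.2) ^ 2) =
      fun p => (h p.1 ^ 2 - 2 * (h p.1 * h p.2)) + h p.2 ^ 2 := by ext p; ring
  have hint : Integrable (fun p : ℝ × ℝ => (h p.1 - h p.2) ^ 2) ((γ).prod γ) := by
    rw [e]; exact (hint1.sub (hint3.const_mul 2)).add hint2
  rw [lintegral_const_mul' _ _ ENNReal.ofReal_ne_top,
    ← ofReal_integral_eq_lintegral_ofReal hint (ae_of_all _ fun _ => sq_nonneg _),
    ← ofReal_integral_eq_lintegral_ofReal hh'.integrable_sq (ae_of_all _ fun _ => sq_nonneg _),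
    ← ENNReal.ofReal_mul (by positivity), ENNReal.ofReal_le_ofReal_iff
      (mul_nonneg (by positivity) (integral_nonneg fun _ => sq_nonneg _)), e,
    integral_sub_add hint1 (hint3.const_mul 2) hint2, integral_const_mul, integral_prod_mul, integral_fun_fst (fun x => h x ^ 2),
    integral_fun_snd (fun x => h x ^ 2)] at h1
  have e2 : ∫ x, (h x - ∫ y, h y ∂γ) ^ 2 ∂γ = (∫ x, h x ^ 2 ∂γ) - (∫ x, h x ∂γ) ^ 2 := by
    have : (fun x => (h x - ∫ y, h y ∂γ) ^ 2) = fun x =>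
        (h x ^ 2 - 2 * (∫ y, h y ∂γ) * h x) + (∫ y, h y ∂γ) ^ 2 := by ext x; ring
    rw [this, integral_sub_add hsq (hm1.const_mul _) (integrable_const _), integral_const_mul]
    simp; ring
  rw [e2]
  simp only [probReal_univ, one_smul] at h1
  have hp : (Real.pi / 2) ^ 2 ≤ (5 / 3) ^ 2 := pow_le_pow_left₀ (by positivity) pi_div_two_le 2
  have hI : 0 ≤ ∫ x, h' x ^ 2 ∂γ := integral_nonneg fun _ => sq_nonneg _
  nlinarith

end

section

/-! ### Functionals of one Gaussian coordinate -/

/-- `g` is differentiable with derivative `g'`, which is bounded by one and one-Lipschitz. -/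
structure SteinTest (g g' : ℝ → ℝ) : Prop where
  hasDerivAt : ∀ x, HasDerivAt g (g' x) x
  abs_le : ∀ x, |g' x| ≤ 1
  lipschitz : ∀ x y, |g' x - g' y| ≤ |x - y|

namespace SteinTest

variable {g g' : ℝ → ℝ}

theorem continuous (hg : SteinTest g g') : Continuous g :=
  continuous_iff_continuousAt.2 fun x => (hg.hasDerivAt x).continuousAt

theorem continuous' (hg : SteinTest g g') : Continuous g' := by
  have : LipschitzWith 1 g' := LipschitzWith.of_dist_le_mul fun x y => by
    simpa [Real.dist_eq] using hg.lipschitz x y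
  exact this.continuous

theorem abs_sub_le (hg : SteinTest g g') (x y : ℝ) : |g x - g y| ≤ |x - y| := by
  have := Convex.norm_image_sub_le_of_norm_hasDerivWithin_le (f := g) (f' := g') (C := 1)
    (s := Set.univ) (fun x _ => (hg.hasDerivAt x).hasDerivWithinAt) (fun x _ => hg.abs_le x)
    convex_univ (Set.mem_univ y) (Set.mem_univ x)
  simpa using this

theorem taylor (hg : SteinTest g g') (x y : ℝ) : |g y - g x - g' x * (y - x)| ≤ (y - x) ^ 2 := by
  have := Convex.norm_image_sub_le_of_norm_hasDerivWithin_le (f := fun t => g t - g' x * t)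
    (f' := fun t => g' t - g' x) (C := |y - x|) (s := Set.uIcc x y)
    (fun t _ => by
      have := (hg.hasDerivAt t).fun_sub ((hasDerivAt_id t).const_mul (g' x))
      simpa using this.hasDerivWithinAt)
    (fun t ht => (hg.lipschitz t x).trans (Set.abs_sub_left_of_mem_uIcc ht))
    (convex_uIcc x y) Set.left_mem_uIcc Set.right_mem_uIcc
  have e : g y - g' x * y - (g x - g' x * x) = g y - g x - g' x * (y - x) := by ring
  rw [e, Real.norm_eq_abs, Real.norm_eq_abs, ← sq, sq_abs] at this
  exact this

theorem memLp_comp (hg : SteinTest g g') {α : Type*} [MeasurableSpace α] {ν : Measure α}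
    [IsFiniteMeasure ν] {f : α → ℝ} {p : ℝ≥0∞} (hf : MemLp f p ν) :
    MemLp (fun x => g (f x)) p ν := by
  have h1 : MemLp (fun x => |f x| + |g 0|) p ν := hf.norm.add (memLp_const _)
  refine h1.mono (hg.continuous.comp_aestronglyMeasurable hf.1) (ae_of_all _ fun x => ?_)
  have := hg.abs_sub_le (f x) 0
  rw [sub_zero] at this
  have h2 := abs_sub_abs_le_abs_sub (g (f x)) (g 0)
  simp only [Real.norm_eq_abs]
  refine le_trans ?_ (le_abs_self _)
  linarith

theorem memLp_comp' (hg : SteinTest g g') {α : Type*} [MeasurableSpace α] {ν : Measure α}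
    [IsFiniteMeasure ν] {f : α → ℝ} {p : ℝ≥0∞} (hf : AEStronglyMeasurable f ν) :
    MemLp (fun x => g' (f x)) p ν :=
  MemLp.of_bound (hg.continuous'.comp_aestronglyMeasurable hf) 1 (ae_of_all _ fun _ => hg.abs_le _)

end SteinTest

theorem integral_sub_const_sq_le {α : Type*} [MeasurableSpace α] {ν : Measure α}
    [IsProbabilityMeasure ν] {f : α → ℝ} (hf : MemLp f 2 ν) :
    ∫ x, (f x - ∫ y, f y ∂ν) ^ 2 ∂ν ≤ ∫ x, f x ^ 2 ∂ν := by
  have hi := hf.integrable one_le_two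
  have : (fun x => (f x - ∫ y, f y ∂ν) ^ 2) = fun x =>
      (f x ^ 2 - 2 * (∫ y, f y ∂ν) * f x) + (∫ y, f y ∂ν) ^ 2 := by ext x; ring
  rw [this, integral_sub_add hf.integrable_sq (hi.const_mul _) (integrable_const _),
    integral_const_mul]
  simp only [integral_const, probReal_univ, smul_eq_mul]
  nlinarith [sq_nonneg (∫ y, f y ∂ν)]

/-- Since `ψ` is centred, `g' (h x)` may be replaced by its deviation from `g'` at the mean of `h`;
this is controlled by the Lipschitz bound and Poincaré. -/
theorem abs_integral_mul_comp_le {ψ h h' g g' : ℝ → ℝ} (hψ : MemLp ψ 2 γ) (hψ0 : ∫ x, ψ x ∂γ = 0)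
    (hg : SteinTest g g') (hd : ∀ x, HasDerivAt h (h' x) x) (hc : Continuous h')
    (hh : MemLp h 2 γ) (hh' : MemLp h' 2 γ) :
    |∫ x, ψ x * g' (h x) ∂γ| ≤ 2 * √(∫ x, ψ x ^ 2 ∂γ) * √(∫ x, h' x ^ 2 ∂γ) := by
  set m := ∫ x, h x ∂γ
  have hgm : MemLp (fun x => g' (h x) - g' m) 2 γ := (hg.memLp_comp' hh.1).sub (memLp_const _)
  have e : ∫ x, ψ x * g' (h x) ∂γ = ∫ x, ψ x * (g' (h x) - g' m) ∂γ := by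
    simp only [mul_sub]
    have i1 : Integrable (fun x => ψ x * g' (h x)) γ :=
      hψ.integrable_mul (q := 2) (hg.memLp_comp' hh.1)
    rw [integral_sub i1
      ((hψ.integrable one_le_two).mul_const _), integral_mul_const, hψ0]
    simp
  rw [e]
  refine (abs_integral_mul_le hψ hgm).trans ?_
  rw [mul_comm 2, mul_assoc]
  refine mul_le_mul_of_nonneg_left ?_ (Real.sqrt_nonneg _)
  rw [Real.sqrt_le_left (by positivity), mul_pow, Real.sq_sqrt (integral_nonneg fun _ => sq_nonneg _)]
  have h1 := poincare hd hc hh hh'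
  have h2 : ∫ x, (g' (h x) - g' m) ^ 2 ∂γ ≤ ∫ x, (h x - m) ^ 2 ∂γ :=
    integral_mono hgm.integrable_sq (hh.sub (memLp_const m)).integrable_sq fun x => by
      have := hg.lipschitz (h x) m
      exact sq_le_sq.2 this
  have h3 : 0 ≤ ∫ x, h' x ^ 2 ∂γ := integral_nonneg fun _ => sq_nonneg _
  linarith

/-- The difference is the covariance of `σ` with `h x - m x`, where `m` is the mean of `h'`. The
derivative of that function is centred, so Poincaré applies twice and reaches `h''`. -/
theorem abs_integral_mul_sub_le {σ h h' h'' : ℝ → ℝ} (hσ : MemLp σ 2 γ) (hσ0 : ∫ x, σ x ∂γ = 0)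
    (hd : ∀ x, HasDerivAt h (h' x) x) (hd' : ∀ x, HasDerivAt h' (h'' x) x) (hc : Continuous h'')
    (hh : MemLp h 2 γ) (hh' : MemLp h' 2 γ) (hh'' : MemLp h'' 2 γ) :
    |(∫ x, σ x * h x ∂γ) - (∫ x, σ x * x ∂γ) * ∫ x, h' x ∂γ| ≤
      2 * √(∫ x, σ x ^ 2 ∂γ) * √(∫ x, h'' x ^ 2 ∂γ) := by
  set m := ∫ x, h' x ∂γ with hm
  have hx : MemLp (fun x : ℝ => x) 2 γ := by simpa using memLp_id_pow 1 2 (by simp)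
  have hc' : Continuous h' := continuous_iff_continuousAt.2 fun x => (hd' x).continuousAt
  set ψ : ℝ → ℝ := fun x => h x - m * x with hψ
  have hψ2 : MemLp ψ 2 γ := hh.sub (hx.const_mul m)
  have hψ1 : MemLp (fun x => ψ x - ∫ y, ψ y ∂γ) 2 γ := hψ2.sub (memLp_const _)
  have e : (∫ x, σ x * h x ∂γ) - (∫ x, σ x * x ∂γ) * m = ∫ x, σ x * (ψ x - ∫ y, ψ y ∂γ) ∂γ := by
    simp only [mul_sub]
    have hσψ : Integrable (fun x => σ x * ψ x) γ := hσ.integrable_mul hψ2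
    rw [integral_sub hσψ ((hσ.integrable one_le_two).mul_const _), integral_mul_const, hσ0, hψ]
    have : (fun x => σ x * (h x - m * x)) = fun x => σ x * h x - (σ x * x) * m := by ext x; ring
    simp only [this]
    have h1 : Integrable (fun x => σ x * h x) γ := hσ.integrable_mul hh
    have h2 : Integrable (fun x => σ x * x) γ := hσ.integrable_mul hx
    rw [integral_sub h1 (h2.mul_const _), integral_mul_const]
    ring
  rw [e]
  refine (abs_integral_mul_le hσ hψ1).trans ?_
  rw [mul_comm 2, mul_assoc]
  refine mul_le_mul_of_nonneg_left ?_ (Real.sqrt_nonneg _)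
  rw [Real.sqrt_le_left (by positivity), mul_pow, Real.sq_sqrt (integral_nonneg fun _ => sq_nonneg _)]
  have h1 := poincare (h := ψ) (h' := fun x => h' x - m) (fun x => by
    have := (hd x).fun_sub ((hasDerivAt_id x).const_mul m)
    simpa using this) (by fun_prop) hψ2 (hh'.sub (memLp_const m))
  have h2 := poincare hd' hc hh' hh''
  rw [← hm] at h2
  linarith

/-- The one-dimensional core of the Stein argument. With `s = E[σ x]`, `G = E g'(h)`, `m = E h'`,
pass from `E[σ g(h)]` to `G E[σ h]`, then to `G s m`, then to `s E[g'(h) h']`. The first passage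
expands `g` around `h` at an independent point `z'`; centring of `σ` kills every term not containing
`h z`, and the remainder `|σ z| (h z - h z')²` is what the weight `k` bounds. The second removes the
constant and linear parts of `h`; the third decorrelates `h'` from `g'(h)`. -/
theorem abs_integral_mul_comp_sub_le {σ k h h' h'' g g' : ℝ → ℝ} {B : ℝ} (hB : 0 ≤ B)
    (hσ : MemLp σ 2 γ) (hσ0 : ∫ x, σ x ∂γ = 0) (hσB : ∫ x, σ x ^ 2 ∂γ ≤ B ^ 2)
    (hk0 : ∀ x, 0 ≤ k x)
    (hk : ∫⁻ p, ENNReal.ofReal (|σ p.1| * (h p.1 - h p.2) ^ 2) ∂((γ).prod γ) ≤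
          ∫⁻ z, ENNReal.ofReal (k z * h' z ^ 2) ∂γ)
    (hki : Integrable (fun z => k z * h' z ^ 2) γ)
    (hg : SteinTest g g')
    (hd : ∀ x, HasDerivAt h (h' x) x) (hd' : ∀ x, HasDerivAt h' (h'' x) x) (hc : Continuous h'')
    (hh : MemLp h 2 γ) (hh' : MemLp h' 2 γ) (hh'' : MemLp h'' 2 γ) :
    |(∫ x, σ x * g (h x) ∂γ) - (∫ x, σ x * x ∂γ) * ∫ x, g' (h x) * h' x ∂γ| ≤
      2 * B * √(∫ x, h'' x ^ 2 ∂γ) + 2 * B * (∫ x, h' x ^ 2 ∂γ) + ∫ z, k z * h' z ^ 2 ∂γ := by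
  have hc' : Continuous h' := continuous_iff_continuousAt.2 fun x => (hd' x).continuousAt
  have hx : MemLp (fun x : ℝ => x) 2 γ := by simpa using memLp_id_pow 1 2 (by simp)
  set m := ∫ x, h' x ∂γ with hm
  set s := ∫ x, σ x * x ∂γ with hs
  set G := ∫ x, g' (h x) ∂γ with hG
  have hsB : √(∫ x, σ x ^ 2 ∂γ) ≤ B := Real.sqrt_le_iff.2 ⟨hB, hσB⟩
  have hs1 : |s| ≤ B := by
    have := abs_integral_mul_le hσ hx
    rw [integral_id_sq, Real.sqrt_one, mul_one] at this
    exact this.trans hsB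
  have hG1 : |G| ≤ 1 := by
    have := norm_integral_le_of_norm_le_const (μ := γ) (f := fun x => g' (h x)) (C := 1)
      (ae_of_all _ fun x => hg.abs_le _)
    simpa using this
  have hgh := hg.memLp_comp hh
  have hgh' : MemLp (fun x => g' (h x)) 2 γ := hg.memLp_comp' hh.1
  have hσi := hσ.integrable one_le_two
  have hσh : Integrable (fun x => σ x * h x) γ := hσ.integrable_mul hh
  have hσg : Integrable (fun x => σ x * g (h x)) γ := hσ.integrable_mul hgh
  have hg'h : Integrable (fun x => g' (h x) * h x) γ := hgh'.integrable_mul hh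
  have T1 : |(∫ x, σ x * g (h x) ∂γ) - G * ∫ x, σ x * h x ∂γ| ≤ ∫ z, k z * h' z ^ 2 ∂γ := by
    have i1 : Integrable (fun p : ℝ × ℝ => σ p.1 * g (h p.1)) ((γ).prod γ) := hσg.comp_fst γ
    have i2 : Integrable (fun p : ℝ × ℝ => σ p.1 * g (h p.2)) ((γ).prod γ) :=
      hσi.mul_prod (hgh.integrable one_le_two)
    have i3 : Integrable (fun p : ℝ × ℝ => (σ p.1 * h p.1) * g' (h p.2)) ((γ).prod γ) :=
      hσh.mul_prod (hgh'.integrable one_le_two)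
    have i4 : Integrable (fun p : ℝ × ℝ => σ p.1 * (g' (h p.2) * h p.2)) ((γ).prod γ) :=
      hσi.mul_prod hg'h
    have e : (∫ x, σ x * g (h x) ∂γ) - G * ∫ x, σ x * h x ∂γ = ∫ p : ℝ × ℝ,
        σ p.1 * (g (h p.1) - g (h p.2) - g' (h p.2) * (h p.1 - h p.2)) ∂((γ).prod γ) := by
      have : (fun p : ℝ × ℝ => σ p.1 * (g (h p.1) - g (h p.2) - g' (h p.2) * (h p.1 - h p.2))) =
          fun p => (σ p.1 * g (h p.1) - σ p.1 * g (h p.2)) -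
            ((σ p.1 * h p.1) * g' (h p.2) - σ p.1 * (g' (h p.2) * h p.2)) := by ext p; ring
      have i12 : Integrable (fun p : ℝ × ℝ => σ p.1 * g (h p.1) - σ p.1 * g (h p.2))
        ((γ).prod γ) := i1.sub i2
      have i34 : Integrable (fun p : ℝ × ℝ => (σ p.1 * h p.1) * g' (h p.2) -
        σ p.1 * (g' (h p.2) * h p.2)) ((γ).prod γ) := i3.sub i4
      rw [this, integral_sub i12 i34,
        integral_sub i1 i2, integral_sub i3 i4,
        integral_fun_fst (fun x => σ x * g (h x)),
        integral_prod_mul σ (fun x => g (h x)), integral_prod_mul (fun x => σ x * h x) (fun x => g' (h x)),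
        integral_prod_mul σ (fun x => g' (h x) * h x), hσ0]
      simp only [probReal_univ, one_smul]
      ring
    rw [e]
    refine (abs_integral_le_integral_abs).trans ?_
    rw [integral_eq_lintegral_of_nonneg_ae (ae_of_all _ fun _ => abs_nonneg _)
      (((i1.sub i2).sub (i3.sub i4)).abs.1.congr (ae_of_all _ fun p => by
        simp only [Pi.sub_apply]; congr 1; ring)),
      integral_eq_lintegral_of_nonneg_ae (ae_of_all _ fun z => mul_nonneg (hk0 z) (sq_nonneg _))
        hki.1]
    refine ENNReal.toReal_mono ?_ (le_trans (lintegral_mono fun p => ?_) hk)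
    · exact (hasFiniteIntegral_iff_ofReal (ae_of_all _ fun z =>
        mul_nonneg (hk0 z) (sq_nonneg _))).1 hki.2 |>.ne
    · refine ENNReal.ofReal_le_ofReal ?_
      rw [abs_mul]
      exact mul_le_mul_of_nonneg_left (hg.taylor _ _) (abs_nonneg _)
  have T2 := abs_integral_mul_sub_le hσ hσ0 hd hd' hc hh hh' hh''
  rw [← hm, ← hs] at T2
  have T3 : |G * m - ∫ x, g' (h x) * h' x ∂γ| ≤ 2 * ∫ x, h' x ^ 2 ∂γ := by
    have hψ : MemLp (fun x => h' x - m) 2 γ := hh'.sub (memLp_const m)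
    have hψ0 : ∫ x, (h' x - m) ∂γ = 0 := by
      rw [integral_sub (hh'.integrable one_le_two) (integrable_const _)]
      simp [hm]
    have := abs_integral_mul_comp_le hψ hψ0 hg hd hc' hh hh'
    have e : ∫ x, (h' x - m) * g' (h x) ∂γ = (∫ x, g' (h x) * h' x ∂γ) - G * m := by
      have e1 : (fun x => (h' x - m) * g' (h x)) = fun x => g' (h x) * h' x - g' (h x) * m := by
        ext x; ring
      have i1 : Integrable (fun x => g' (h x) * h' x) γ := hgh'.integrable_mul hh'
      rw [e1, integral_sub i1 ((hgh'.integrable one_le_two).mul_const m), integral_mul_const]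
    rw [e, abs_sub_comm] at this
    refine this.trans ?_
    have h1 : √(∫ x, (h' x - m) ^ 2 ∂γ) ≤ √(∫ x, h' x ^ 2 ∂γ) :=
      Real.sqrt_le_sqrt (integral_sub_const_sq_le hh')
    have h2 : √(∫ x, h' x ^ 2 ∂γ) * √(∫ x, h' x ^ 2 ∂γ) = ∫ x, h' x ^ 2 ∂γ :=
      Real.mul_self_sqrt (integral_nonneg fun _ => sq_nonneg _)
    have h3 := Real.sqrt_nonneg (∫ x, h' x ^ 2 ∂γ)
    nlinarith
  set I1 := ∫ x, σ x * g (h x) ∂γ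
  set I2 := ∫ x, σ x * h x ∂γ
  set I3 := ∫ x, g' (h x) * h' x ∂γ
  have key : I1 - s * I3 = (I1 - G * I2) + G * (I2 - s * m) + s * (G * m - I3) := by ring
  rw [key]
  have a1 : |G * (I2 - s * m)| ≤ 2 * B * √(∫ x, h'' x ^ 2 ∂γ) := by
    rw [abs_mul]
    have h0 := Real.sqrt_nonneg (∫ x, h'' x ^ 2 ∂γ)
    calc |G| * |I2 - s * m| ≤ 1 * |I2 - s * m| :=
          mul_le_mul_of_nonneg_right hG1 (abs_nonneg _)
      _ ≤ 2 * √(∫ x, σ x ^ 2 ∂γ) * √(∫ x, h'' x ^ 2 ∂γ) := by rw [one_mul]; exact T2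
      _ ≤ _ := by gcongr
  have a2 : |s * (G * m - I3)| ≤ 2 * B * ∫ x, h' x ^ 2 ∂γ := by
    rw [abs_mul]
    calc |s| * |G * m - I3| ≤ B * (2 * ∫ x, h' x ^ 2 ∂γ) :=
          mul_le_mul hs1 T3 (abs_nonneg _) hB
      _ = _ := by ring
  have := abs_add_three (I1 - G * I2) (G * (I2 - s * m)) (s * (G * m - I3))
  linarith

end

section

/-! ### Resampling one direction of a standard Gaussian vector -/

section Resample

variable {E : Type*} [NormedAddCommGroup E] [InnerProductSpace ℝ E]

/-- Replace the coordinate of `p.1` in the direction `a` by `p.2`. -/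
def resample (a : E) (p : E × ℝ) : E := p.1 + (p.2 - ⟪a, p.1⟫) • a

@[fun_prop]
theorem continuous_resample (a : E) : Continuous (resample a) := by
  unfold resample; fun_prop

theorem inner_resample (a b c : E) (z : ℝ) :
    ⟪b, resample a (c, z)⟫ = ⟪b, c⟫ + (z - ⟪a, c⟫) * ⟪b, a⟫ := by
  simp [resample, inner_add_right, inner_smul_right]

theorem inner_resample_self {a : E} (ha : ‖a‖ = 1) (c : E) (z : ℝ) :
    ⟪a, resample a (c, z)⟫ = z := by
  rw [inner_resample, real_inner_self_eq_norm_sq, ha]; ring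

variable [FiniteDimensional ℝ E] [MeasurableSpace E] [BorelSpace E]

@[fun_prop]
theorem measurable_resample (a : E) : Measurable (resample a) := by
  have : SecondCountableTopology E := inferInstance
  exact (continuous_resample a).measurable

/-- Compare characteristic functions: the pairing with `t` splits into the independent pieces `⟪c, t
- ⟪a, t⟫ • a⟫` and `⟪a, t⟫ z`, and Pythagoras recombines the two exponents. -/
theorem map_resample {a : E} (ha : ‖a‖ = 1) :
    ((stdGaussian E).prod γ).map (resample a) = stdGaussian E := by
  apply Measure.ext_of_charFun
  ext t
  rw [charFun_apply, integral_map (by fun_prop) (by fun_prop)]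
  have e : ∀ p : E × ℝ, Complex.exp (⟪resample a p, t⟫ * Complex.I) =
      Complex.exp (⟪p.1, t - ⟪a, t⟫ • a⟫ * Complex.I) *
        Complex.exp (⟪p.2, ⟪a, t⟫⟫ * Complex.I) := by
    intro p
    rw [← Complex.exp_add, ← add_mul, ← Complex.ofReal_add]
    congr 3
    rw [resample, inner_add_left, inner_smul_left, inner_sub_right, inner_smul_right,
      real_inner_comm a p.1]
    simp
    ring
  simp_rw [e]
  rw [integral_prod_mul (fun c : E => Complex.exp (⟪c, t - ⟪a, t⟫ • a⟫ * Complex.I))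
    (fun z : ℝ => Complex.exp (⟪z, ⟪a, t⟫⟫ * Complex.I)), ← charFun_apply, ← charFun_apply,
    charFun_stdGaussian, charFun_stdGaussian, charFun_gaussianReal, ← Complex.exp_add]
  congr 1
  have h : ‖t - ⟪a, t⟫ • a‖ ^ 2 = ‖t‖ ^ 2 - ⟪a, t⟫ ^ 2 := by
    rw [norm_sub_sq_real, inner_smul_right, norm_smul, ha, real_inner_comm]
    simp; ring
  rw [← Complex.ofReal_pow, ← Complex.ofReal_pow, h]
  push_cast
  ring

theorem measurePreserving_resample {a : E} (ha : ‖a‖ = 1) :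
    MeasurePreserving (resample a) ((stdGaussian E).prod γ) (stdGaussian E) :=
  ⟨measurable_resample a, map_resample ha⟩

theorem measurePreserving_inner {a : E} (ha : ‖a‖ = 1) :
    MeasurePreserving (fun c : E => ⟪a, c⟫) (stdGaussian E) γ := by
  refine ⟨by fun_prop, ?_⟩
  apply Measure.ext_of_charFun
  ext t
  rw [charFun_apply, integral_map (by fun_prop) (by fun_prop)]
  have e : ∀ c : E, ⟪⟪a, c⟫, t⟫ = ⟪c, t • a⟫ := fun c => by
    rw [inner_smul_right, real_inner_comm c]; simp
  simp_rw [e, ← charFun_apply]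
  rw [charFun_stdGaussian, charFun_gaussianReal, norm_smul, ha]
  simp only [Real.norm_eq_abs, mul_one, Complex.ofReal_zero, mul_zero, zero_mul, zero_sub,
    NNReal.coe_one, Complex.ofReal_one, one_mul, ← Complex.ofReal_pow, sq_abs]
  congr 1; ring

variable {a : E}

theorem integrable_resample (ha : ‖a‖ = 1) {F : E → ℝ} (hF : Integrable F (stdGaussian E)) :
    Integrable (fun p => F (resample a p)) ((stdGaussian E).prod γ) :=
  (measurePreserving_resample ha).integrable_comp_of_integrable hF

theorem integral_resample (ha : ‖a‖ = 1) {F : E → ℝ} (hF : Integrable F (stdGaussian E)) :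
    ∫ c, F c ∂(stdGaussian E) = ∫ c, ∫ z, F (resample a (c, z)) ∂γ ∂(stdGaussian E) := by
  have h := integrable_resample ha hF
  rw [← integral_prod _ h, ← map_resample ha, integral_map (by fun_prop)
    (by rw [map_resample ha]; exact hF.1), map_resample ha]

theorem ae_integrable_resample (ha : ‖a‖ = 1) {F : E → ℝ} (hF : Integrable F (stdGaussian E)) :
    ∀ᵐ c ∂(stdGaussian E), Integrable (fun z => F (resample a (c, z))) γ :=
  (integrable_resample ha hF).prod_right_ae

theorem ae_memLp_resample (ha : ‖a‖ = 1) {F : E → ℝ} (hF : MemLp F 2 (stdGaussian E)) :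
    ∀ᵐ c ∂(stdGaussian E), MemLp (fun z => F (resample a (c, z))) 2 γ := by
  have h1 := (hF.comp_measurePreserving (measurePreserving_resample ha))
  filter_upwards [h1.1.prodMk_left, ae_integrable_resample ha hF.integrable_sq] with c hc1 hc2
  exact (memLp_two_iff_integrable_sq hc1).2 hc2

/-- Jensen for the square root; it pulls conditional `L²` norms out of the average over the
coordinates that are not resampled. -/
theorem integral_sqrt_le {α : Type*} [MeasurableSpace α] {ν : Measure α} [IsProbabilityMeasure ν]
    {J : α → ℝ} (hJ : Integrable J ν) (hJ0 : ∀ x, 0 ≤ J x) :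
    Integrable (fun x => √(J x)) ν ∧ ∫ x, √(J x) ∂ν ≤ √(∫ x, J x ∂ν) := by
  have hm : AEStronglyMeasurable (fun x => √(J x)) ν :=
    Real.continuous_sqrt.comp_aestronglyMeasurable hJ.1
  have hL : MemLp (fun x => √(J x)) 2 ν := by
    rw [memLp_two_iff_integrable_sq hm]
    simpa only [Real.sq_sqrt (hJ0 _)] using hJ
  refine ⟨hL.integrable one_le_two, ?_⟩
  have := abs_integral_mul_le hL (memLp_const (1 : ℝ))
  simp only [mul_one, Real.sq_sqrt (hJ0 _)] at this
  simpa using (le_abs_self _).trans this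

/-- `H` is twice differentiable in the direction `a`, with derivatives `H'` and `H''`, all of them
square integrable. -/
structure DirectionalC2 (a : E) (H H' H'' : E → ℝ) : Prop where
  hasDerivAt : ∀ c z, HasDerivAt (fun z => H (resample a (c, z))) (H' (resample a (c, z))) z
  hasDerivAt' : ∀ c z, HasDerivAt (fun z => H' (resample a (c, z))) (H'' (resample a (c, z))) z
  continuous : ∀ c, Continuous fun z => H'' (resample a (c, z))
  memLp : MemLp H 2 (stdGaussian E)
  memLp' : MemLp H' 2 (stdGaussian E)
  memLp'' : MemLp H'' 2 (stdGaussian E)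

/-- The one-dimensional estimate is applied to almost every line in the direction `a`, then averaged
over the lines. -/
theorem DirectionalC2.abs_integral_mul_comp_le {H H' H'' : E → ℝ} (hH : DirectionalC2 a H H' H'')
    (ha : ‖a‖ = 1) {ψ g g' : ℝ → ℝ} (hψ : MemLp ψ 2 γ) (hψ0 : ∫ x, ψ x ∂γ = 0)
    (hg : SteinTest g g') :
    |∫ c, ψ ⟪a, c⟫ * g' (H c) ∂(stdGaussian E)| ≤
      2 * √(∫ x, ψ x ^ 2 ∂γ) * √(∫ c, H' c ^ 2 ∂(stdGaussian E)) := by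
  have hψa : MemLp (fun c => ψ ⟪a, c⟫) 2 (stdGaussian E) :=
    hψ.comp_measurePreserving (measurePreserving_inner ha)
  have hF : Integrable (fun c => ψ ⟪a, c⟫ * g' (H c)) (stdGaussian E) :=
    hψa.integrable_mul (q := 2) (hg.memLp_comp' hH.memLp.1)
  rw [integral_resample ha hF, integral_resample ha hH.memLp'.integrable_sq]
  have hJ := (integrable_resample ha hH.memLp'.integrable_sq).integral_prod_left
  have hs := integral_sqrt_le hJ fun c => integral_nonneg fun _ => sq_nonneg _
  have hb := norm_integral_le_of_norm_le (hs.1.const_mul (2 * √(∫ x, ψ x ^ 2 ∂γ)))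
    (f := fun c => ∫ z, ψ ⟪a, resample a (c, z)⟫ * g' (H (resample a (c, z))) ∂γ) (by
      filter_upwards [ae_memLp_resample ha hH.memLp, ae_memLp_resample ha hH.memLp'] with c h1 h2
      simp only [inner_resample_self ha]
      exact GaussianEquivalence.abs_integral_mul_comp_le hψ hψ0 hg (hH.hasDerivAt c)
        (continuous_iff_continuousAt.2 fun z => (hH.hasDerivAt' c z).continuousAt) h1 h2)
  refine hb.trans ?_
  rw [integral_const_mul]
  exact mul_le_mul_of_nonneg_left hs.2 (by positivity)

/-- Resampling reduces to the one-dimensional core on each line. The weight `k` depends only on `σ`,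
so one weight serves all lines at once. -/
theorem DirectionalC2.abs_integral_mul_comp_sub_le {H H' H'' : E → ℝ}
    (hH : DirectionalC2 a H H' H'') (ha : ‖a‖ = 1) {σ k g g' : ℝ → ℝ} {B : ℝ} (hB : 0 ≤ B)
    (hσ : MemLp σ 2 γ) (hσ0 : ∫ x, σ x ∂γ = 0) (hσB : ∫ x, σ x ^ 2 ∂γ ≤ B ^ 2)
    (hk0 : ∀ x, 0 ≤ k x)
    (hk : ∀ h h' : ℝ → ℝ, (∀ x, HasDerivAt h (h' x) x) → Continuous h' →
        ∫⁻ p, ENNReal.ofReal (|σ p.1| * (h p.1 - h p.2) ^ 2) ∂((γ).prod γ) ≤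
          ∫⁻ z, ENNReal.ofReal (k z * h' z ^ 2) ∂γ)
    (hki : Integrable (fun c => k ⟪a, c⟫ * H' c ^ 2) (stdGaussian E))
    (hg : SteinTest g g') :
    |(∫ c, σ ⟪a, c⟫ * g (H c) ∂(stdGaussian E)) -
        (∫ x, σ x * x ∂γ) * ∫ c, g' (H c) * H' c ∂(stdGaussian E)| ≤
      2 * B * √(∫ c, H'' c ^ 2 ∂(stdGaussian E)) + 2 * B * (∫ c, H' c ^ 2 ∂(stdGaussian E)) +
        ∫ c, k ⟪a, c⟫ * H' c ^ 2 ∂(stdGaussian E) := by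
  have hσa : MemLp (fun c => σ ⟪a, c⟫) 2 (stdGaussian E) :=
    hσ.comp_measurePreserving (measurePreserving_inner ha)
  have hF1 : Integrable (fun c => σ ⟪a, c⟫ * g (H c)) (stdGaussian E) :=
    hσa.integrable_mul (q := 2) (hg.memLp_comp hH.memLp)
  have hF2 : Integrable (fun c => g' (H c) * H' c) (stdGaussian E) :=
    MemLp.integrable_mul (p := 2) (q := 2) (hg.memLp_comp' hH.memLp.1) hH.memLp'
  rw [integral_resample ha hF1, integral_resample ha hF2, integral_resample ha hki,
    integral_resample ha hH.memLp'.integrable_sq, integral_resample ha hH.memLp''.integrable_sq,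
    ← integral_const_mul, ← integral_sub (integrable_resample ha hF1).integral_prod_left
      ((integrable_resample ha hF2).integral_prod_left.const_mul _)]
  have hJ1 := (integrable_resample ha hH.memLp'.integrable_sq).integral_prod_left
  have hJ2 := (integrable_resample ha hH.memLp''.integrable_sq).integral_prod_left
  have hJ3 := (integrable_resample ha hki).integral_prod_left
  have hs := integral_sqrt_le hJ2 fun c => integral_nonneg fun _ => sq_nonneg _
  have hb := norm_integral_le_of_norm_le
    (((hs.1.const_mul (2 * B)).add (hJ1.const_mul (2 * B))).add hJ3)
    (f := fun c => (∫ z, σ ⟪a, resample a (c, z)⟫ * g (H (resample a (c, z))) ∂γ) -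
      (∫ x, σ x * x ∂γ) * ∫ z, g' (H (resample a (c, z))) * H' (resample a (c, z)) ∂γ) (by
      filter_upwards [ae_memLp_resample ha hH.memLp, ae_memLp_resample ha hH.memLp',
        ae_memLp_resample ha hH.memLp'', ae_integrable_resample ha hki] with c h1 h2 h3 h4
      simp only [inner_resample_self ha, Pi.add_apply] at h4 ⊢
      exact GaussianEquivalence.abs_integral_mul_comp_sub_le hB hσ hσ0 hσB hk0
        (hk _ _ (hH.hasDerivAt c)
          (continuous_iff_continuousAt.2 fun z => (hH.hasDerivAt' c z).continuousAt)) h4 hg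
        (hH.hasDerivAt c) (hH.hasDerivAt' c) (hH.continuous c) h1 h2 h3)
  refine hb.trans ?_
  have i12 : Integrable (fun c => 2 * B * √(∫ z, H'' (resample a (c, z)) ^ 2 ∂γ) +
    2 * B * ∫ z, H' (resample a (c, z)) ^ 2 ∂γ) (stdGaussian E) :=
    (hs.1.const_mul (2 * B)).add (hJ1.const_mul (2 * B))
  simp only [Pi.add_apply]
  rw [integral_add i12 hJ3, integral_add (hs.1.const_mul (2 * B)) (hJ1.const_mul (2 * B)),
    integral_const_mul, integral_const_mul]
  gcongr
  exact hs.2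

end Resample

end

section

/-! ### Sums of functions of Gaussian coordinates -/

/-- A centered activation function `σ` with derivatives `σ'`, `σ''` and moments bounded by `B`. -/
structure Activation (σ σ' σ'' : ℝ → ℝ) (B : ℝ) : Prop where
  one_le : 1 ≤ B
  hasDerivAt : ∀ x, HasDerivAt σ (σ' x) x
  hasDerivAt' : ∀ x, HasDerivAt σ' (σ'' x) x
  continuous'' : Continuous σ''
  mean : ∫ x, σ x ∂γ = 0
  integrable_four : Integrable (fun x => σ x ^ 4) γ
  integral_four : ∫ x, σ x ^ 4 ∂γ ≤ B
  memLp' : MemLp σ' 2 γ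
  integral' : ∫ x, σ' x ^ 2 ∂γ ≤ B
  memLp'' : MemLp σ'' 2 γ
  integral'' : ∫ x, σ'' x ^ 2 ∂γ ≤ B

namespace Activation

variable {σ σ' σ'' : ℝ → ℝ} {B : ℝ}

theorem continuous (h : Activation σ σ' σ'' B) : Continuous σ :=
  continuous_iff_continuousAt.2 fun x => (h.hasDerivAt x).continuousAt

theorem continuous' (h : Activation σ σ' σ'' B) : Continuous σ' :=
  continuous_iff_continuousAt.2 fun x => (h.hasDerivAt' x).continuousAt

theorem memLp_sq (h : Activation σ σ' σ'' B) : MemLp (fun x => σ x ^ 2) 2 γ := by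
  have hm : AEStronglyMeasurable (fun x => σ x ^ 2) γ := (h.continuous.pow 2).aestronglyMeasurable
  rw [memLp_two_iff_integrable_sq hm]
  simpa only [← pow_mul] using h.integrable_four

theorem memLp (h : Activation σ σ' σ'' B) : MemLp σ 2 γ :=
  (memLp_two_iff_integrable_sq h.continuous.aestronglyMeasurable).2
    (h.memLp_sq.integrable one_le_two)

theorem integral_sq (h : Activation σ σ' σ'' B) : ∫ x, σ x ^ 2 ∂γ ≤ B := by
  have h1 : ∫ x, σ x ^ 2 ∂γ ≤ ∫ x, ((1 / 2 : ℝ) + (1 / 2) * σ x ^ 4) ∂γ :=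
    integral_mono h.memLp.integrable_sq ((integrable_const _).add (h.integrable_four.const_mul _))
      fun x => by nlinarith [sq_nonneg (σ x ^ 2 - 1)]
  rw [integral_add (integrable_const _) (h.integrable_four.const_mul _), integral_const_mul] at h1
  have := h.integral_four
  have := h.one_le
  simp at h1
  linarith

theorem abs_pow_three_le (x : ℝ) : |x| ^ 3 ≤ (1 / 2) * x ^ 2 + (1 / 2) * x ^ 4 := by
  have h1 : x ^ 2 = |x| ^ 2 := (sq_abs x).symm
  have h2 : x ^ 4 = |x| ^ 4 := by rw [← abs_pow, abs_of_nonneg (by positivity)]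
  rw [h1, h2]
  nlinarith [mul_nonneg (sq_nonneg |x|) (sq_nonneg (|x| - 1))]

theorem integrable_cube (h : Activation σ σ' σ'' B) : Integrable (fun x => |σ x| ^ 3) γ :=
  ((h.memLp.integrable_sq.const_mul (1 / 2)).add (h.integrable_four.const_mul (1 / 2))).mono'
    ((h.continuous.abs.pow 3).aestronglyMeasurable) (ae_of_all _ fun x => by
      simpa using abs_pow_three_le (σ x))

theorem integral_cube (h : Activation σ σ' σ'' B) : ∫ x, |σ x| ^ 3 ∂γ ≤ B := by
  have h1 := integral_mono h.integrable_cube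
    ((h.memLp.integrable_sq.const_mul (1 / 2)).add (h.integrable_four.const_mul (1 / 2)))
    fun x => abs_pow_three_le (σ x)
  simp only [Pi.add_apply] at h1
  rw [integral_add (h.memLp.integrable_sq.const_mul (1 / 2)) (h.integrable_four.const_mul (1 / 2)),
    integral_const_mul, integral_const_mul] at h1
  have := h.integral_four
  have := h.integral_sq
  linarith

end Activation

/-! ### The model and its directional derivatives -/

section Model

variable {E : Type*} [NormedAddCommGroup E] [InnerProductSpace ℝ E] {ι : Type*}

/-- `∑ i ∈ I, v_i σ(a_iᵀ c) + bᵀ c`. -/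
def model (σ : ℝ → ℝ) (a : ι → E) (v : ι → ℝ) (b : E) (I : Finset ι) (c : E) : ℝ :=
  ∑ i ∈ I, v i * σ ⟪a i, c⟫ + ⟪b, c⟫

/-- The derivative of `model` in the direction `e`. -/
def modelDeriv (σ' : ℝ → ℝ) (a : ι → E) (v : ι → ℝ) (b : E) (I : Finset ι) (e c : E) : ℝ :=
  ∑ i ∈ I, v i * ⟪a i, e⟫ * σ' ⟪a i, c⟫ + ⟪b, e⟫

/-- The second derivative of `model` in the direction `e`. -/
def modelDeriv2 (σ'' : ℝ → ℝ) (a : ι → E) (v : ι → ℝ) (I : Finset ι) (e c : E) : ℝ :=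
  ∑ i ∈ I, v i * ⟪a i, e⟫ ^ 2 * σ'' ⟪a i, c⟫

theorem modelDeriv_smul (σ' : ℝ → ℝ) (a : ι → E) (v : ι → ℝ) (b : E) (I : Finset ι) (t : ℝ)
    (e c : E) : modelDeriv σ' a v b I (t • e) c = t * modelDeriv σ' a v b I e c := by
  simp only [modelDeriv, inner_smul_right, mul_add, Finset.mul_sum]
  congr 1
  exact Finset.sum_congr rfl fun i _ => by ring

variable [FiniteDimensional ℝ E] [MeasurableSpace E] [BorelSpace E]

theorem memLp_comp_inner {a : E} (ha : ‖a‖ = 1) {f : ℝ → ℝ} {p : ℝ≥0∞} (hf : MemLp f p γ) :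
    MemLp (fun c => f ⟪a, c⟫) p (stdGaussian E) :=
  hf.comp_measurePreserving (measurePreserving_inner ha)

theorem integrable_comp_inner {a : E} (ha : ‖a‖ = 1) {f : ℝ → ℝ} (hf : Integrable f γ) :
    Integrable (fun c => f ⟪a, c⟫) (stdGaussian E) :=
  (measurePreserving_inner ha).integrable_comp_of_integrable hf

theorem integral_comp_inner {a : E} (ha : ‖a‖ = 1) {f : ℝ → ℝ} (hf : AEStronglyMeasurable f γ) :
    ∫ c, f ⟪a, c⟫ ∂(stdGaussian E) = ∫ x, f x ∂γ := by
  have h := measurePreserving_inner ha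
  rw [← h.map_eq, integral_map h.measurable.aemeasurable (by rwa [h.map_eq])]

theorem memLp_inner (b : E) (p : ℝ≥0∞) (hp : p ≠ ∞) :
    MemLp (fun c : E => ⟪b, c⟫) p (stdGaussian E) :=
  (IsGaussian.memLp_id (stdGaussian E) p hp).const_inner b

variable {σ σ' σ'' : ℝ → ℝ} {B : ℝ} {a : ι → E}

theorem Activation.memLp_model (h : Activation σ σ' σ'' B) (ha : ∀ i, ‖a i‖ = 1) (v : ι → ℝ)
    (b : E) (I : Finset ι) : MemLp (model σ a v b I) 2 (stdGaussian E) :=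
  (memLp_finsetSum I fun i _ => (memLp_comp_inner (ha i) h.memLp).const_mul (v i)).add
    (memLp_inner b 2 (by simp))

theorem Activation.memLp_modelDeriv (h : Activation σ σ' σ'' B) (ha : ∀ i, ‖a i‖ = 1) (v : ι → ℝ)
    (b : E) (I : Finset ι) (e : E) : MemLp (modelDeriv σ' a v b I e) 2 (stdGaussian E) :=
  (memLp_finsetSum I fun i _ => (memLp_comp_inner (ha i) h.memLp').const_mul (v i * ⟪a i, e⟫)).add
    (memLp_const _)

theorem Activation.memLp_modelDeriv2 (h : Activation σ σ' σ'' B) (ha : ∀ i, ‖a i‖ = 1)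
    (v : ι → ℝ) (I : Finset ι) (e : E) : MemLp (modelDeriv2 σ'' a v I e) 2 (stdGaussian E) :=
  memLp_finsetSum I fun i _ => (memLp_comp_inner (ha i) h.memLp'').const_mul (v i * ⟪a i, e⟫ ^ 2)

theorem Activation.directionalC2 (h : Activation σ σ' σ'' B) (ha : ∀ i, ‖a i‖ = 1) (v : ι → ℝ)
    (b : E) (I : Finset ι) (e : E) :
    DirectionalC2 e (model σ a v b I) (modelDeriv σ' a v b I e) (modelDeriv2 σ'' a v I e) where
  hasDerivAt c z := by
    have hlin : ∀ f : E, HasDerivAt (fun z => ⟪f, resample e (c, z)⟫) ⟪f, e⟫ z := by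
      intro f
      simp only [inner_resample]
      simpa using (((hasDerivAt_id z).sub_const ⟪e, c⟫).mul_const ⟪f, e⟫).const_add ⟪f, c⟫
    unfold model modelDeriv
    refine HasDerivAt.add (HasDerivAt.fun_sum fun i _ => ?_) (hlin b)
    have := ((h.hasDerivAt ⟪a i, resample e (c, z)⟫).comp z (hlin (a i))).const_mul (v i)
    exact this.congr_deriv (by ring)
  hasDerivAt' c z := by
    have hlin : ∀ f : E, HasDerivAt (fun z => ⟪f, resample e (c, z)⟫) ⟪f, e⟫ z := by
      intro f
      simp only [inner_resample]
      simpa using (((hasDerivAt_id z).sub_const ⟪e, c⟫).mul_const ⟪f, e⟫).const_add ⟪f, c⟫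
    unfold modelDeriv modelDeriv2
    refine HasDerivAt.add_const _ (HasDerivAt.fun_sum fun i _ => ?_)
    have := ((h.hasDerivAt' ⟪a i, resample e (c, z)⟫).comp z (hlin (a i))).const_mul
      (v i * ⟪a i, e⟫)
    exact this.congr_deriv (by ring)
  continuous c := by
    have := h.continuous''
    unfold modelDeriv2
    simp only [inner_resample]
    fun_prop
  memLp := h.memLp_model ha v b I
  memLp' := h.memLp_modelDeriv ha v b I e
  memLp'' := h.memLp_modelDeriv2 ha v I e

theorem DirectionalC2.integral_inner_mul {e : E} (he : ‖e‖ = 1) {H H' H'' : E → ℝ}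
    (hH : DirectionalC2 e H H' H'') {g g' : ℝ → ℝ} (hg : SteinTest g g') :
    ∫ c, ⟪e, c⟫ * g (H c) ∂(stdGaussian E) = ∫ c, g' (H c) * H' c ∂(stdGaussian E) := by
  have hx : MemLp (fun x : ℝ => x) 2 γ := by simpa using memLp_id_pow 1 2 (by simp)
  have hF1 : Integrable (fun c => ⟪e, c⟫ * g (H c)) (stdGaussian E) :=
    (memLp_inner e 2 (by simp)).integrable_mul (q := 2) (hg.memLp_comp hH.memLp)
  have hF2 : Integrable (fun c => g' (H c) * H' c) (stdGaussian E) :=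
    MemLp.integrable_mul (p := 2) (q := 2) (hg.memLp_comp' hH.memLp.1) hH.memLp'
  rw [integral_resample he hF1, integral_resample he hF2]
  refine integral_congr_ae ?_
  filter_upwards [ae_memLp_resample he hH.memLp, ae_memLp_resample he hH.memLp'] with c h1 h2
  simp only [inner_resample_self he]
  have hgh := hg.memLp_comp h1
  refine gaussian_integral_mul_self (fun z => ?_) (hgh.integrable one_le_two)
    (hx.integrable_mul (q := 2) hgh)
    (MemLp.integrable_mul (p := 2) (q := 2) (hg.memLp_comp' h1.1) h2)
  exact (hg.hasDerivAt _).comp z (hH.hasDerivAt c z)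

/-- Gaussian integration by parts in an arbitrary direction, by homogeneity from the unit one. It
treats the linear term `bᵀ c` of the model without error. -/
theorem Activation.integral_inner_mul (h : Activation σ σ' σ'' B) (ha : ∀ i, ‖a i‖ = 1)
    (v : ι → ℝ) (b : E) (I : Finset ι) (e : E) {g g' : ℝ → ℝ} (hg : SteinTest g g') :
    ∫ c, ⟪e, c⟫ * g (model σ a v b I c) ∂(stdGaussian E) =
      ∫ c, g' (model σ a v b I c) * modelDeriv σ' a v b I e c ∂(stdGaussian E) := by
  rcases eq_or_ne e 0 with rfl | he
  · simp [modelDeriv]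
  have hn : ‖e‖ ≠ 0 := norm_ne_zero_iff.2 he
  have h1 : ‖(‖e‖⁻¹ • e)‖ = 1 := by rw [norm_smul]; simp [hn]
  have h2 := (h.directionalC2 ha v b I (‖e‖⁻¹ • e)).integral_inner_mul h1 hg
  simp only [modelDeriv_smul, inner_smul_left, mul_assoc, mul_left_comm _ ‖e‖⁻¹] at h2
  rw [integral_const_mul, integral_const_mul] at h2
  exact mul_left_cancel₀ (by simpa using hn) h2

end Model

end

section

/-! ### Approximate Stein identity for the model -/

/-- `k` is a weight for which the `|σ|`-weighted Poincaré inequality holds. -/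
structure PoincareWeight (σ k : ℝ → ℝ) : Prop where
  nonneg : ∀ x, 0 ≤ k x
  le : ∀ h h' : ℝ → ℝ, (∀ x, HasDerivAt h (h' x) x) → Continuous h' →
    ∫⁻ p, ENNReal.ofReal (|σ p.1| * (h p.1 - h p.2) ^ 2) ∂((γ).prod γ) ≤
      ∫⁻ z, ENNReal.ofReal (k z * h' z ^ 2) ∂γ

section

variable {E : Type*} [NormedAddCommGroup E] [InnerProductSpace ℝ E] {ι : Type*}
theorem model_eq_erase [Fintype ι] [DecidableEq ι] (σ : ℝ → ℝ) (a : ι → E) (v : ι → ℝ) (b : E) (n : ι) (c : E) :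
    model σ a v b Finset.univ c =
      model σ a v b (Finset.univ.erase n) c + v n * σ ⟪a n, c⟫ := by
  rw [model, model, ← Finset.add_sum_erase _ _ (Finset.mem_univ n)]
  ring

variable [FiniteDimensional ℝ E] [MeasurableSpace E] [BorelSpace E]
variable {σ σ' σ'' : ℝ → ℝ} {B : ℝ} {a : ι → E} {g g' : ℝ → ℝ}

theorem sqrt_integral_sq_nonneg_mul {α : Type*} [MeasurableSpace α] {ν : Measure α}
    {f : α → ℝ} (t : ℝ) : √(∫ x, (t * f x) ^ 2 ∂ν) = |t| * √(∫ x, f x ^ 2 ∂ν) := by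
  simp only [mul_pow]
  rw [integral_const_mul, Real.sqrt_mul (sq_nonneg t), Real.sqrt_sq_eq_abs]

theorem abs_integral_mul_mul_le {α : Type*} [MeasurableSpace α] {ν : Measure α} {f p q : α → ℝ}
    (hf : AEStronglyMeasurable f ν) (hfp : ∀ x, |f x| ≤ |p x|)
    (hp : MemLp p 2 ν) (hq : MemLp q 2 ν) :
    |∫ x, f x * q x ∂ν| ≤ √(∫ x, p x ^ 2 ∂ν) * √(∫ x, q x ^ 2 ∂ν) := by
  have hf2 : MemLp f 2 ν := hp.mono hf (ae_of_all _ hfp)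
  refine (abs_integral_mul_le hf2 hq).trans ?_
  refine mul_le_mul_of_nonneg_right (Real.sqrt_le_sqrt ?_) (Real.sqrt_nonneg _)
  exact integral_mono hf2.integrable_sq hp.integrable_sq fun x => sq_le_sq.2 (hfp x)

theorem Activation.sqrt_integral_sq (h : Activation σ σ' σ'' B) : √(∫ x, σ x ^ 2 ∂γ) ≤ √B :=
  Real.sqrt_le_sqrt h.integral_sq

theorem Activation.abs_coeff_le (h : Activation σ σ' σ'' B) : |∫ x, σ x * x ∂γ| ≤ √B := by
  have hx : MemLp (fun x : ℝ => x) 2 γ := by simpa using memLp_id_pow 1 2 (by simp)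
  have := abs_integral_mul_le h.memLp hx
  rw [integral_id_sq, Real.sqrt_one, mul_one] at this
  exact this.trans h.sqrt_integral_sq

variable [Fintype ι] [DecidableEq ι]

/-- Write `S = H + v_n σ(a_nᵀ c)`. Passing from `g(S)` to `g(H)` costs `v_n² E|σ|³`, beyond the term
`v_n E[g'(S) σ²]`; expanding around `S` rather than `H` makes `g'(S)` a factor common to all `n`.
Then `E[σ g(H)]` is handled in the direction `a_n`, and `g'(H)` is changed back to `g'(S)`. -/
theorem Activation.leave_one_out (h : Activation σ σ' σ'' B) (ha : ∀ i, ‖a i‖ = 1) (v : ι → ℝ)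
    (b : E) (n : ι) {k : ℝ → ℝ} (hk : PoincareWeight σ k)
    (hki : Integrable (fun c => k ⟪a n, c⟫ *
      modelDeriv σ' a v b (Finset.univ.erase n) (a n) c ^ 2) (stdGaussian E))
    (hg : SteinTest g g') :
    |(∫ c, σ ⟪a n, c⟫ * g (model σ a v b Finset.univ c) ∂(stdGaussian E)) -
      (v n * (∫ c, g' (model σ a v b Finset.univ c) * σ ⟪a n, c⟫ ^ 2 ∂(stdGaussian E)) +
        (∫ x, σ x * x ∂γ) * ∫ c, g' (model σ a v b Finset.univ c) *
          modelDeriv σ' a v b (Finset.univ.erase n) (a n) c ∂(stdGaussian E))| ≤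
      v n ^ 2 * B +
      2 * B * √(∫ c, modelDeriv2 σ'' a v (Finset.univ.erase n) (a n) c ^ 2 ∂(stdGaussian E)) +
      2 * B * (∫ c, modelDeriv σ' a v b (Finset.univ.erase n) (a n) c ^ 2 ∂(stdGaussian E)) +
      (∫ c, k ⟪a n, c⟫ * modelDeriv σ' a v b (Finset.univ.erase n) (a n) c ^ 2 ∂(stdGaussian E)) +
      B * |v n| *
        √(∫ c, modelDeriv σ' a v b (Finset.univ.erase n) (a n) c ^ 2 ∂(stdGaussian E)) := by
  set H := model σ a v b (Finset.univ.erase n) with hH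
  set D := modelDeriv σ' a v b (Finset.univ.erase n) (a n) with hD
  set s := ∫ x, σ x * x ∂γ with hs
  have hB0 : 0 ≤ B := zero_le_one.trans h.one_le
  have hC2 := h.directionalC2 ha v b (Finset.univ.erase n) (a n)
  have T2 := hC2.abs_integral_mul_comp_sub_le (ha n) hB0 h.memLp h.mean
    (h.integral_sq.trans (by nlinarith [h.one_le])) hk.nonneg hk.le hki hg
  rw [← hs] at T2
  have hS : ∀ c, model σ a v b Finset.univ c = H c + v n * σ ⟪a n, c⟫ :=
    model_eq_erase σ a v b n
  have hX : MemLp (fun c => σ ⟪a n, c⟫) 2 (stdGaussian E) := memLp_comp_inner (ha n) h.memLp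
  have hX2 : MemLp (fun c => σ ⟪a n, c⟫ ^ 2) 2 (stdGaussian E) :=
    memLp_comp_inner (ha n) h.memLp_sq
  have hSL := h.memLp_model ha v b Finset.univ
  have hHL := h.memLp_model ha v b (Finset.univ.erase n)
  rw [← hH] at hHL
  have hDL := h.memLp_modelDeriv ha v b (Finset.univ.erase n) (a n)
  rw [← hD] at hDL
  have hgS' : MemLp (fun c => g' (model σ a v b Finset.univ c)) 2 (stdGaussian E) :=
    hg.memLp_comp' hSL.1
  have i1 : Integrable (fun c => σ ⟪a n, c⟫ * g (model σ a v b Finset.univ c)) (stdGaussian E) :=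
    hX.integrable_mul (q := 2) (hg.memLp_comp hSL)
  have i2 : Integrable (fun c => σ ⟪a n, c⟫ * g (H c)) (stdGaussian E) :=
    hX.integrable_mul (q := 2) (hg.memLp_comp hHL)
  have i3 : Integrable (fun c => g' (model σ a v b Finset.univ c) * σ ⟪a n, c⟫ ^ 2)
    (stdGaussian E) := hgS'.integrable_mul (q := 2) hX2
  have i4 : Integrable (fun c => g' (model σ a v b Finset.univ c) * D c) (stdGaussian E) :=
    hgS'.integrable_mul (q := 2) hDL
  have hgH' : MemLp (fun c => g' (H c)) 2 (stdGaussian E) := hg.memLp_comp' hHL.1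
  have i5 : Integrable (fun c => g' (H c) * D c) (stdGaussian E) :=
    hgH'.integrable_mul (q := 2) hDL
  have T1 : |(∫ c, σ ⟪a n, c⟫ * g (model σ a v b Finset.univ c) ∂(stdGaussian E)) -
      (∫ c, σ ⟪a n, c⟫ * g (H c) ∂(stdGaussian E)) -
      v n * (∫ c, g' (model σ a v b Finset.univ c) * σ ⟪a n, c⟫ ^ 2 ∂(stdGaussian E))| ≤
      v n ^ 2 * B := by
    have i12 : Integrable (fun c => σ ⟪a n, c⟫ * g (model σ a v b Finset.univ c) -
      σ ⟪a n, c⟫ * g (H c)) (stdGaussian E) := i1.sub i2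
    rw [← integral_sub i1 i2, ← integral_const_mul, ← integral_sub i12 (i3.const_mul _)]
    have hcube := integrable_comp_inner (ha n) h.integrable_cube
    rw [← Real.norm_eq_abs]
    refine (norm_integral_le_of_norm_le (hcube.const_mul (v n ^ 2))
      (ae_of_all _ fun c => ?_)).trans ?_
    · have ht := hg.taylor (model σ a v b Finset.univ c) (H c)
      have e : σ ⟪a n, c⟫ * g (model σ a v b Finset.univ c) - σ ⟪a n, c⟫ * g (H c) -
          v n * (g' (model σ a v b Finset.univ c) * σ ⟪a n, c⟫ ^ 2) =
          -(σ ⟪a n, c⟫ * (g (H c) - g (model σ a v b Finset.univ c) -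
            g' (model σ a v b Finset.univ c) * (H c - model σ a v b Finset.univ c))) := by
        have : H c - model σ a v b Finset.univ c = - (v n * σ ⟪a n, c⟫) := by rw [hS c]; ring
        rw [this]; ring
      rw [e, norm_neg, Real.norm_eq_abs, abs_mul]
      have hdiff : H c - model σ a v b Finset.univ c = - (v n * σ ⟪a n, c⟫) := by rw [hS c]; ring
      calc |σ ⟪a n, c⟫| * _ ≤ |σ ⟪a n, c⟫| * (H c - model σ a v b Finset.univ c) ^ 2 :=
            mul_le_mul_of_nonneg_left ht (abs_nonneg _)
        _ = v n ^ 2 * |σ ⟪a n, c⟫| ^ 3 := by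
            rw [hdiff, neg_sq, mul_pow, ← sq_abs (σ ⟪a n, c⟫)]; ring
    · rw [integral_const_mul]
      refine mul_le_mul_of_nonneg_left ?_ (sq_nonneg _)
      rw [integral_comp_inner (ha n) (f := fun x => |σ x| ^ 3) h.integrable_cube.1]
      exact h.integral_cube
  have T3 : |s * (∫ c, g' (H c) * D c ∂(stdGaussian E)) -
      s * ∫ c, g' (model σ a v b Finset.univ c) * D c ∂(stdGaussian E)| ≤
      B * |v n| * √(∫ c, D c ^ 2 ∂(stdGaussian E)) := by
    rw [← mul_sub, ← integral_sub i5 i4, abs_mul]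
    simp only [← sub_mul]
    have h1 := abs_integral_mul_mul_le (f := fun c => g' (H c) - g' (model σ a v b Finset.univ c))
      (p := fun c => v n * σ ⟪a n, c⟫) (q := D) (hgH'.1.sub hgS'.1) (fun c => by
        refine (hg.lipschitz _ _).trans (le_of_eq ?_)
        rw [hS c, abs_sub_comm]; congr 1; ring) (hX.const_mul _) hDL
    rw [sqrt_integral_sq_nonneg_mul, integral_comp_inner (ha n) (f := fun x => σ x ^ 2)
      h.memLp.integrable_sq.1] at h1
    have h2 : |s| ≤ √B := h.abs_coeff_le
    have h3 := h.sqrt_integral_sq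
    have h4 : √B * √B = B := Real.mul_self_sqrt hB0
    calc |s| * _ ≤ √B * (|v n| * √B * √(∫ c, D c ^ 2 ∂(stdGaussian E))) := by
          refine mul_le_mul h2 (h1.trans ?_) (abs_nonneg _) (Real.sqrt_nonneg _)
          gcongr
      _ = (√B * √B) * |v n| * √(∫ c, D c ^ 2 ∂(stdGaussian E)) := by ring
      _ = _ := by rw [h4]
  set I1 := ∫ c, σ ⟪a n, c⟫ * g (model σ a v b Finset.univ c) ∂(stdGaussian E)
  set I2 := ∫ c, σ ⟪a n, c⟫ * g (H c) ∂(stdGaussian E)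
  set I3 := ∫ c, g' (model σ a v b Finset.univ c) * σ ⟪a n, c⟫ ^ 2 ∂(stdGaussian E)
  set I4 := ∫ c, g' (model σ a v b Finset.univ c) * D c ∂(stdGaussian E)
  set I5 := ∫ c, g' (H c) * D c ∂(stdGaussian E)
  have key : I1 - (v n * I3 + s * I4) =
      (I1 - I2 - v n * I3) + (I2 - s * I5) + (s * I5 - s * I4) := by ring
  rw [key]
  refine (abs_add_three _ _ _).trans ?_
  linarith

/-- Replacing `g'(S)` by the leave-one-out `g'(H)` costs a multiple of `|v_n|`; after that, `H`
depends weakly on the coordinate `a_nᵀ c`, and the centred `ψ` decorrelates. Needed for `ψ = σ²` and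
`ψ = σ'`. -/
theorem Activation.abs_cov_le (h : Activation σ σ' σ'' B) (ha : ∀ i, ‖a i‖ = 1) (v : ι → ℝ)
    (b : E) (n : ι) (hg : SteinTest g g') {ψ : ℝ → ℝ} (hψ : MemLp ψ 2 γ)
    (hψB : ∫ x, ψ x ^ 2 ∂γ ≤ B) :
    |(∫ c, g' (model σ a v b Finset.univ c) * ψ ⟪a n, c⟫ ∂(stdGaussian E)) -
      (∫ c, g' (model σ a v b Finset.univ c) ∂(stdGaussian E)) *
        ∫ c, ψ ⟪a n, c⟫ ∂(stdGaussian E)| ≤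
      B * (|v n| + 2 *
        √(∫ c, modelDeriv σ' a v b (Finset.univ.erase n) (a n) c ^ 2 ∂(stdGaussian E))) := by
  set H := model σ a v b (Finset.univ.erase n) with hH
  set D := modelDeriv σ' a v b (Finset.univ.erase n) (a n) with hD
  have hB0 : 0 ≤ B := zero_le_one.trans h.one_le
  have hC2 := h.directionalC2 ha v b (Finset.univ.erase n) (a n)
  have hS : ∀ c, model σ a v b Finset.univ c = H c + v n * σ ⟪a n, c⟫ :=
    model_eq_erase σ a v b n
  have hX : MemLp (fun c => σ ⟪a n, c⟫) 2 (stdGaussian E) := memLp_comp_inner (ha n) h.memLp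
  have hSL := h.memLp_model ha v b Finset.univ
  have hHL := h.memLp_model ha v b (Finset.univ.erase n)
  rw [← hH] at hHL
  have hgS' : MemLp (fun c => g' (model σ a v b Finset.univ c)) 2 (stdGaussian E) :=
    hg.memLp_comp' hSL.1
  have hgH' : MemLp (fun c => g' (H c)) 2 (stdGaussian E) := hg.memLp_comp' hHL.1
  rw [integral_comp_inner (ha n) hψ.1]
  set m := ∫ x, ψ x ∂γ with hm
  have hψc : MemLp (fun x => ψ x - m) 2 γ := hψ.sub (memLp_const m)
  have hψ0 : ∫ x, (ψ x - m) ∂γ = 0 := by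
    rw [integral_sub (hψ.integrable one_le_two) (integrable_const _)]; simp [hm]
  have hψc2 : √(∫ x, (ψ x - m) ^ 2 ∂γ) ≤ √B :=
    Real.sqrt_le_sqrt ((integral_sub_const_sq_le hψ).trans hψB)
  have hψa := memLp_comp_inner (ha n) hψ
  have hψca := memLp_comp_inner (ha n) hψc
  have i1 : Integrable (fun c => g' (model σ a v b Finset.univ c) * ψ ⟪a n, c⟫) (stdGaussian E) :=
    hgS'.integrable_mul (q := 2) hψa
  have i2 : Integrable (fun c => g' (model σ a v b Finset.univ c) * (ψ ⟪a n, c⟫ - m))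
    (stdGaussian E) := hgS'.integrable_mul (q := 2) hψca
  have i3 : Integrable (fun c => g' (H c) * (ψ ⟪a n, c⟫ - m))
    (stdGaussian E) := hgH'.integrable_mul (q := 2) hψca
  have e1 : (∫ c, g' (model σ a v b Finset.univ c) * ψ ⟪a n, c⟫ ∂(stdGaussian E)) -
      (∫ c, g' (model σ a v b Finset.univ c) ∂(stdGaussian E)) * m =
      (∫ c, (g' (model σ a v b Finset.univ c) - g' (H c)) * (ψ ⟪a n, c⟫ - m) ∂(stdGaussian E)) +
      ∫ c, (ψ ⟪a n, c⟫ - m) * g' (H c) ∂(stdGaussian E) := by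
    have : ∀ c, (ψ ⟪a n, c⟫ - m) * g' (H c) = g' (H c) * (ψ ⟪a n, c⟫ - m) := fun c => mul_comm _ _
    simp only [this, sub_mul]
    rw [integral_sub i2 i3, sub_add_cancel]
    simp only [mul_sub]
    rw [integral_sub i1 ((hgS'.integrable one_le_two).mul_const m), integral_mul_const]
  rw [e1]
  have h1 := abs_integral_mul_mul_le (ν := stdGaussian E)
    (f := fun c => g' (model σ a v b Finset.univ c) - g' (H c))
    (p := fun c => v n * σ ⟪a n, c⟫) (q := fun c => ψ ⟪a n, c⟫ - m) (hgS'.1.sub hgH'.1) (fun c => by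
      refine (hg.lipschitz _ _).trans (le_of_eq ?_)
      rw [hS c]; congr 1; ring) (hX.const_mul _) hψca
  rw [sqrt_integral_sq_nonneg_mul, integral_comp_inner (ha n) (f := fun x => σ x ^ 2)
    h.memLp.integrable_sq.1, integral_comp_inner (ha n) (f := fun x => (ψ x - m) ^ 2)
    hψc.integrable_sq.1] at h1
  have h2 := hC2.abs_integral_mul_comp_le (ha n) hψc hψ0 hg
  have h3 := h.sqrt_integral_sq
  have h4 : √B * √B = B := Real.mul_self_sqrt hB0
  have h5 : √B ≤ B := Real.sqrt_le_iff.2 ⟨hB0, by nlinarith [h.one_le]⟩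
  have h6 : |v n| * √(∫ x, σ x ^ 2 ∂γ) * √(∫ x, (ψ x - m) ^ 2 ∂γ) ≤ |v n| * √B * √B := by gcongr
  have h7 : 2 * √(∫ x, (ψ x - m) ^ 2 ∂γ) * √(∫ c, D c ^ 2 ∂(stdGaussian E)) ≤
      2 * B * √(∫ c, D c ^ 2 ∂(stdGaussian E)) := by
    gcongr; exact hψc2.trans h5
  refine (abs_add_le _ _).trans ((add_le_add h1 h2).trans ((add_le_add h6 h7).trans (le_of_eq ?_)))
  rw [mul_assoc |v n|, h4]; ring

end

end

/-! ### The approximate Stein kernel and the Stein equation -/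

section

section

variable {E : Type*} [NormedAddCommGroup E] [InnerProductSpace ℝ E] {ι : Type*}
  [Fintype ι] [DecidableEq ι]

/-- The coefficient of `σ'(a_nᵀ c)` in the Stein kernel of the model. -/
noncomputable def kernelCoeff (σ : ℝ → ℝ) (a : ι → E) (v : ι → ℝ) (b : E) (n : ι) : ℝ :=
  v n * (⟪b, a n⟫ + (∫ x, σ x * x ∂γ) * ∑ i ∈ Finset.univ.erase n, v i * ⟪a i, a n⟫)

/-- An approximate Stein kernel of the model. -/
noncomputable def steinKernel (σ σ' : ℝ → ℝ) (a : ι → E) (v : ι → ℝ) (b : E) (c : E) : ℝ :=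
  ∑ n, (v n ^ 2 * σ ⟪a n, c⟫ ^ 2 + kernelCoeff σ a v b n * σ' ⟪a n, c⟫) +
    (⟪b, b⟫ + (∫ x, σ x * x ∂γ) * ∑ n, v n * ⟪b, a n⟫)

/-- The right side is what integration by parts produces; the definition groups the same terms by
the coordinate `a_nᵀ c` they depend on, as decorrelation requires. The regrouping exchanges `i` and
`n` in a double sum, by symmetry of the Gram matrix. -/
theorem steinKernel_eq (σ σ' : ℝ → ℝ) (a : ι → E) (v : ι → ℝ) (b : E) (c : E) :
    steinKernel σ σ' a v b c = ∑ n, v n * (v n * σ ⟪a n, c⟫ ^ 2 +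
      (∫ x, σ x * x ∂γ) * modelDeriv σ' a v b (Finset.univ.erase n) (a n) c) +
      modelDeriv σ' a v b Finset.univ b c := by
  set s := ∫ x, σ x * x ∂γ with hs
  have h1 : ∑ n, v n * ∑ i ∈ Finset.univ.erase n, v i * ⟪a i, a n⟫ * σ' ⟪a i, c⟫ =
      ∑ n, (v n * ∑ i ∈ Finset.univ.erase n, v i * ⟪a i, a n⟫) * σ' ⟪a n, c⟫ := by
    have e1 : ∀ n, v n * ∑ i ∈ Finset.univ.erase n, v i * ⟪a i, a n⟫ * σ' ⟪a i, c⟫ =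
        ∑ i, if i ≠ n then v n * (v i * ⟪a i, a n⟫ * σ' ⟪a i, c⟫) else 0 := fun n => by
      rw [Finset.mul_sum, ← Finset.sum_filter, Finset.filter_ne']
    have e2 : ∀ n, (v n * ∑ i ∈ Finset.univ.erase n, v i * ⟪a i, a n⟫) * σ' ⟪a n, c⟫ =
        ∑ i, if i ≠ n then v n * (v i * ⟪a i, a n⟫) * σ' ⟪a n, c⟫ else 0 := fun n => by
      rw [Finset.mul_sum, Finset.sum_mul, ← Finset.sum_filter, Finset.filter_ne']
    simp only [e1, e2]
    rw [Finset.sum_comm]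
    refine Finset.sum_congr rfl fun i _ => Finset.sum_congr rfl fun n _ => ?_
    by_cases hin : i = n
    · simp [hin]
    · rw [if_pos hin, if_pos (Ne.symm hin), real_inner_comm (a n)]; ring
  have h2 : ∑ n, v n * (v n * σ ⟪a n, c⟫ ^ 2 +
      s * modelDeriv σ' a v b (Finset.univ.erase n) (a n) c) =
      ∑ n, v n ^ 2 * σ ⟪a n, c⟫ ^ 2 +
      s * ∑ n, v n * ∑ i ∈ Finset.univ.erase n, v i * ⟪a i, a n⟫ * σ' ⟪a i, c⟫ +
      s * ∑ n, v n * ⟪b, a n⟫ := by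
    simp only [Finset.mul_sum (Finset.univ : Finset ι), ← Finset.sum_add_distrib, modelDeriv]
    exact Finset.sum_congr rfl fun n _ => by ring
  rw [h2, h1, steinKernel, modelDeriv, ← hs, Finset.sum_add_distrib]
  have h3 : ∑ n, kernelCoeff σ a v b n * σ' ⟪a n, c⟫ = ∑ i, v i * ⟪a i, b⟫ * σ' ⟪a i, c⟫ +
      s * ∑ n, (v n * ∑ i ∈ Finset.univ.erase n, v i * ⟪a i, a n⟫) * σ' ⟪a n, c⟫ := by
    rw [Finset.mul_sum, ← Finset.sum_add_distrib]
    refine Finset.sum_congr rfl fun n _ => ?_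
    rw [kernelCoeff, ← hs, real_inner_comm b]; ring
  rw [h3]; ring

variable [FiniteDimensional ℝ E] [MeasurableSpace E] [BorelSpace E]
variable {σ σ' σ'' : ℝ → ℝ} {B : ℝ} {a : ι → E} {g g' : ℝ → ℝ}

/-- The error of the approximate Stein identity contributed by index `n`. -/
noncomputable def steinError (σ' σ'' k : ℝ → ℝ) (B : ℝ) (a : ι → E) (v : ι → ℝ) (b : E)
    (n : ι) : ℝ :=
  v n ^ 2 * B +
  2 * B * √(∫ c, modelDeriv2 σ'' a v (Finset.univ.erase n) (a n) c ^ 2 ∂(stdGaussian E)) +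
  2 * B * (∫ c, modelDeriv σ' a v b (Finset.univ.erase n) (a n) c ^ 2 ∂(stdGaussian E)) +
  (∫ c, k ⟪a n, c⟫ * modelDeriv σ' a v b (Finset.univ.erase n) (a n) c ^ 2 ∂(stdGaussian E)) +
  B * |v n| * √(∫ c, modelDeriv σ' a v b (Finset.univ.erase n) (a n) c ^ 2 ∂(stdGaussian E))

/-- The leave-one-out estimates, weighted by `v n` and summed, plus the exact integration by parts
for `bᵀ c`. -/
theorem Activation.stein_approx (h : Activation σ σ' σ'' B) (ha : ∀ i, ‖a i‖ = 1) (v : ι → ℝ)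
    (b : E) {k : ℝ → ℝ} (hk : PoincareWeight σ k)
    (hki : ∀ n, Integrable (fun c => k ⟪a n, c⟫ *
      modelDeriv σ' a v b (Finset.univ.erase n) (a n) c ^ 2) (stdGaussian E))
    (hg : SteinTest g g') :
    |(∫ c, model σ a v b Finset.univ c * g (model σ a v b Finset.univ c) ∂(stdGaussian E)) -
      ∫ c, g' (model σ a v b Finset.univ c) * steinKernel σ σ' a v b c ∂(stdGaussian E)| ≤
      ∑ n, |v n| * steinError σ' σ'' k B a v b n := by
  set S := model σ a v b Finset.univ with hSdef
  set s := ∫ x, σ x * x ∂γ with hs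
  have hSL : MemLp S 2 (stdGaussian E) := h.memLp_model ha v b Finset.univ
  have hgS : MemLp (fun c => g (S c)) 2 (stdGaussian E) := hg.memLp_comp hSL
  have hgS' : MemLp (fun c => g' (S c)) 2 (stdGaussian E) := hg.memLp_comp' hSL.1
  have hX : ∀ n, MemLp (fun c => σ ⟪a n, c⟫) 2 (stdGaussian E) :=
    fun n => memLp_comp_inner (ha n) h.memLp
  have hX2 : ∀ n, MemLp (fun c => σ ⟪a n, c⟫ ^ 2) 2 (stdGaussian E) :=
    fun n => memLp_comp_inner (ha n) h.memLp_sq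
  have i1 : ∀ n, Integrable (fun c => σ ⟪a n, c⟫ * g (S c)) (stdGaussian E) :=
    fun n => (hX n).integrable_mul (q := 2) hgS
  have i2 : ∀ n, Integrable (fun c => g' (S c) * σ ⟪a n, c⟫ ^ 2) (stdGaussian E) :=
    fun n => hgS'.integrable_mul (q := 2) (hX2 n)
  have i3 : ∀ n, Integrable (fun c => g' (S c) *
      modelDeriv σ' a v b (Finset.univ.erase n) (a n) c) (stdGaussian E) :=
    fun n => hgS'.integrable_mul (q := 2) (h.memLp_modelDeriv ha v b _ _)
  have i4 : Integrable (fun c => ⟪b, c⟫ * g (S c)) (stdGaussian E) :=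
    (memLp_inner b 2 (by simp)).integrable_mul (q := 2) hgS
  have i5 : Integrable (fun c => g' (S c) * modelDeriv σ' a v b Finset.univ b c) (stdGaussian E) :=
    hgS'.integrable_mul (q := 2) (h.memLp_modelDeriv ha v b _ _)
  have e1 : ∫ c, S c * g (S c) ∂(stdGaussian E) =
      ∑ n, v n * (∫ c, σ ⟪a n, c⟫ * g (S c) ∂(stdGaussian E)) +
        ∫ c, ⟪b, c⟫ * g (S c) ∂(stdGaussian E) := by
    have : (fun c => S c * g (S c)) = fun c =>
        ∑ n, v n * (σ ⟪a n, c⟫ * g (S c)) + ⟪b, c⟫ * g (S c) := by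
      ext c
      rw [show S c * g (S c) = (∑ n, v n * σ ⟪a n, c⟫ + ⟪b, c⟫) * g (S c) from rfl, add_mul,
        Finset.sum_mul]
      congr 1
      exact Finset.sum_congr rfl fun n _ => by ring
    rw [this, integral_add (integrable_finsetSum _ fun n _ => (i1 n).const_mul _) i4,
      integral_finsetSum _ fun n _ => (i1 n).const_mul _]
    simp only [integral_const_mul]
  have e2 : ∫ c, g' (S c) * steinKernel σ σ' a v b c ∂(stdGaussian E) =
      ∑ n, v n * (v n * (∫ c, g' (S c) * σ ⟪a n, c⟫ ^ 2 ∂(stdGaussian E)) +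
        s * ∫ c, g' (S c) * modelDeriv σ' a v b (Finset.univ.erase n) (a n) c
          ∂(stdGaussian E)) +
        ∫ c, g' (S c) * modelDeriv σ' a v b Finset.univ b c ∂(stdGaussian E) := by
    have : (fun c => g' (S c) * steinKernel σ σ' a v b c) = fun c =>
        ∑ n, v n * (v n * (g' (S c) * σ ⟪a n, c⟫ ^ 2) +
          s * (g' (S c) * modelDeriv σ' a v b (Finset.univ.erase n) (a n) c)) +
        g' (S c) * modelDeriv σ' a v b Finset.univ b c := by
      ext c
      rw [steinKernel_eq, ← hs, mul_add, Finset.mul_sum]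
      congr 1
      exact Finset.sum_congr rfl fun n _ => by ring
    have i23 : ∀ n, Integrable (fun c => v n * (g' (S c) * σ ⟪a n, c⟫ ^ 2) +
          s * (g' (S c) * modelDeriv σ' a v b (Finset.univ.erase n) (a n) c)) (stdGaussian E) :=
      fun n => ((i2 n).const_mul _).add ((i3 n).const_mul _)
    rw [this, integral_add (integrable_finsetSum _ fun n _ => (i23 n).const_mul _) i5,
      integral_finsetSum _ fun n _ => (i23 n).const_mul _]
    congr 1
    refine Finset.sum_congr rfl fun n _ => ?_
    rw [integral_const_mul, integral_add ((i2 n).const_mul _) ((i3 n).const_mul _),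
      integral_const_mul, integral_const_mul]
  rw [e1, e2, h.integral_inner_mul ha v b Finset.univ b hg, add_sub_add_right_eq_sub,
    ← Finset.sum_sub_distrib]
  refine (Finset.abs_sum_le_sum_abs _ _).trans (Finset.sum_le_sum fun n _ => ?_)
  rw [← mul_sub, abs_mul]
  exact mul_le_mul_of_nonneg_left (h.leave_one_out ha v b n hk (hki n) hg) (abs_nonneg _)

theorem Activation.abs_cov_steinKernel_le (h : Activation σ σ' σ'' B) (ha : ∀ i, ‖a i‖ = 1)
    (v : ι → ℝ) (b : E) (hg : SteinTest g g') :
    |(∫ c, g' (model σ a v b Finset.univ c) * steinKernel σ σ' a v b c ∂(stdGaussian E)) -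
      (∫ c, g' (model σ a v b Finset.univ c) ∂(stdGaussian E)) *
        ∫ c, steinKernel σ σ' a v b c ∂(stdGaussian E)| ≤
      ∑ n, (v n ^ 2 + |kernelCoeff σ a v b n|) * (B * (|v n| + 2 *
        √(∫ c, modelDeriv σ' a v b (Finset.univ.erase n) (a n) c ^ 2 ∂(stdGaussian E)))) := by
  set S := model σ a v b Finset.univ with hSdef
  have hSL : MemLp S 2 (stdGaussian E) := h.memLp_model ha v b Finset.univ
  have hgS' : MemLp (fun c => g' (S c)) 2 (stdGaussian E) := hg.memLp_comp' hSL.1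
  have hX2 : ∀ n, MemLp (fun c => σ ⟪a n, c⟫ ^ 2) 2 (stdGaussian E) :=
    fun n => memLp_comp_inner (ha n) h.memLp_sq
  have hX' : ∀ n, MemLp (fun c => σ' ⟪a n, c⟫) 2 (stdGaussian E) :=
    fun n => memLp_comp_inner (ha n) h.memLp'
  have i2 : ∀ n, Integrable (fun c => g' (S c) * σ ⟪a n, c⟫ ^ 2) (stdGaussian E) :=
    fun n => hgS'.integrable_mul (q := 2) (hX2 n)
  have i3 : ∀ n, Integrable (fun c => g' (S c) * σ' ⟪a n, c⟫) (stdGaussian E) :=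
    fun n => hgS'.integrable_mul (q := 2) (hX' n)
  have j2 := fun n => (hX2 n).integrable one_le_two
  have j3 := fun n => (hX' n).integrable one_le_two
  set K := ⟪b, b⟫ + (∫ x, σ x * x ∂γ) * ∑ n, v n * ⟪b, a n⟫ with hK
  have e1 : ∫ c, g' (S c) * steinKernel σ σ' a v b c ∂(stdGaussian E) =
      ∑ n, (v n ^ 2 * (∫ c, g' (S c) * σ ⟪a n, c⟫ ^ 2 ∂(stdGaussian E)) +
        kernelCoeff σ a v b n * ∫ c, g' (S c) * σ' ⟪a n, c⟫ ∂(stdGaussian E)) +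
      (∫ c, g' (S c) ∂(stdGaussian E)) * K := by
    have : (fun c => g' (S c) * steinKernel σ σ' a v b c) = fun c =>
        ∑ n, (v n ^ 2 * (g' (S c) * σ ⟪a n, c⟫ ^ 2) +
          kernelCoeff σ a v b n * (g' (S c) * σ' ⟪a n, c⟫)) + g' (S c) * K := by
      ext c
      rw [steinKernel, mul_add, Finset.mul_sum]
      congr 1
      exact Finset.sum_congr rfl fun n _ => by ring
    have i23 : ∀ n, Integrable (fun c => v n ^ 2 * (g' (S c) * σ ⟪a n, c⟫ ^ 2) +
          kernelCoeff σ a v b n * (g' (S c) * σ' ⟪a n, c⟫)) (stdGaussian E) :=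
      fun n => ((i2 n).const_mul _).add ((i3 n).const_mul _)
    rw [this, integral_add (integrable_finsetSum _ fun n _ => i23 n)
      ((hgS'.integrable one_le_two).mul_const K), integral_finsetSum _ fun n _ => i23 n,
      integral_mul_const]
    congr 1
    refine Finset.sum_congr rfl fun n _ => ?_
    rw [integral_add ((i2 n).const_mul _) ((i3 n).const_mul _),
      integral_const_mul, integral_const_mul]
  have e2 : ∫ c, steinKernel σ σ' a v b c ∂(stdGaussian E) =
      ∑ n, (v n ^ 2 * (∫ c, σ ⟪a n, c⟫ ^ 2 ∂(stdGaussian E)) +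
        kernelCoeff σ a v b n * ∫ c, σ' ⟪a n, c⟫ ∂(stdGaussian E)) + K := by
    have i23 : ∀ n, Integrable (fun c => v n ^ 2 * σ ⟪a n, c⟫ ^ 2 +
          kernelCoeff σ a v b n * σ' ⟪a n, c⟫) (stdGaussian E) :=
      fun n => ((j2 n).const_mul _).add ((j3 n).const_mul _)
    unfold steinKernel
    rw [integral_add (integrable_finsetSum _ fun n _ => i23 n) (integrable_const _),
      integral_finsetSum _ fun n _ => i23 n]
    simp only [integral_const, probReal_univ, smul_eq_mul, one_mul]
    congr 1
    refine Finset.sum_congr rfl fun n _ => ?_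
    rw [integral_add ((j2 n).const_mul _) ((j3 n).const_mul _),
      integral_const_mul, integral_const_mul]
  clear_value K
  rw [e1, e2, mul_add, add_sub_add_right_eq_sub, Finset.mul_sum, ← Finset.sum_sub_distrib]
  refine (Finset.abs_sum_le_sum_abs _ _).trans (Finset.sum_le_sum fun n _ => ?_)
  have c1 := h.abs_cov_le ha v b n hg h.memLp_sq (by
    simpa only [← pow_mul] using h.integral_four)
  have c2 := h.abs_cov_le ha v b n hg h.memLp' h.integral'
  rw [← hSdef] at c1 c2
  set err := B * (|v n| + 2 *
        √(∫ c, modelDeriv σ' a v b (Finset.univ.erase n) (a n) c ^ 2 ∂(stdGaussian E)))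
  set A1 := ∫ c, g' (S c) * σ ⟪a n, c⟫ ^ 2 ∂(stdGaussian E)
  set A2 := ∫ c, g' (S c) * σ' ⟪a n, c⟫ ∂(stdGaussian E)
  set A3 := ∫ c, g' (S c) ∂(stdGaussian E)
  set A4 := ∫ c, σ ⟪a n, c⟫ ^ 2 ∂(stdGaussian E)
  set A5 := ∫ c, σ' ⟪a n, c⟫ ∂(stdGaussian E)
  have key : v n ^ 2 * A1 + kernelCoeff σ a v b n * A2 -
      A3 * (v n ^ 2 * A4 + kernelCoeff σ a v b n * A5) =
      v n ^ 2 * (A1 - A3 * A4) + kernelCoeff σ a v b n * (A2 - A3 * A5) := by ring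
  rw [key, add_mul]
  refine (abs_add_le _ _).trans (add_le_add ?_ ?_)
  · rw [abs_mul, abs_of_nonneg (sq_nonneg (v n))]
    exact mul_le_mul_of_nonneg_left c1 (sq_nonneg _)
  · rw [abs_mul]
    exact mul_le_mul_of_nonneg_left c2 (abs_nonneg _)

/-- Approximate Stein equation: the law of the model satisfies the Stein equation of the
Gaussian law with the same variance, up to an explicit error. -/
theorem Activation.stein_equation (h : Activation σ σ' σ'' B) (ha : ∀ i, ‖a i‖ = 1) (v : ι → ℝ)
    (b : E) {k : ℝ → ℝ} (hk : PoincareWeight σ k)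
    (hki : ∀ n, Integrable (fun c => k ⟪a n, c⟫ *
      modelDeriv σ' a v b (Finset.univ.erase n) (a n) c ^ 2) (stdGaussian E))
    {κ L : ℝ} (hκ : 0 ≤ κ) (hv : ∀ n, |v n| ≤ κ) (hL : Fintype.card ι * κ ^ 2 ≤ L)
    (hg : SteinTest g g') :
    |(∫ c, model σ a v b Finset.univ c * g (model σ a v b Finset.univ c) ∂(stdGaussian E)) -
      (∫ c, model σ a v b Finset.univ c ^ 2 ∂(stdGaussian E)) *
        ∫ c, g' (model σ a v b Finset.univ c) ∂(stdGaussian E)| ≤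
      20 * B * (κ * (L + ∑ n, ⟪b, a n⟫ ^ 2 +
          (∫ x, σ x * x ∂γ) ^ 2 * ∑ n, (∑ i ∈ Finset.univ.erase n, v i * ⟪a i, a n⟫) ^ 2 +
          ∑ n, (∫ c, modelDeriv σ' a v b (Finset.univ.erase n) (a n) c ^ 2 ∂(stdGaussian E)) +
          ∑ n, ∫ c, k ⟪a n, c⟫ * modelDeriv σ' a v b (Finset.univ.erase n) (a n) c ^ 2
            ∂(stdGaussian E)) +
        √L * √(∑ n, ∫ c, modelDeriv2 σ'' a v (Finset.univ.erase n) (a n) c ^ 2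
          ∂(stdGaussian E))) := by
  set S := model σ a v b Finset.univ with hSdef
  set s := ∫ x, σ x * x ∂γ with hs
  set p : ι → ℝ := fun n => ∑ i ∈ Finset.univ.erase n, v i * ⟪a i, a n⟫ with hp
  set q : ι → ℝ := fun n => ⟪b, a n⟫ with hq
  set Q : ι → ℝ := fun n =>
    ∫ c, modelDeriv σ' a v b (Finset.univ.erase n) (a n) c ^ 2 ∂(stdGaussian E) with hQ
  set R : ι → ℝ := fun n =>
    ∫ c, k ⟪a n, c⟫ * modelDeriv σ' a v b (Finset.univ.erase n) (a n) c ^ 2 ∂(stdGaussian E) with hR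
  set m : ι → ℝ := fun n =>
    ∫ c, modelDeriv2 σ'' a v (Finset.univ.erase n) (a n) c ^ 2 ∂(stdGaussian E) with hm
  have hB := h.one_le
  have hB0 : 0 ≤ B := zero_le_one.trans hB
  have hQ0 : ∀ n, 0 ≤ Q n := fun n => integral_nonneg fun _ => sq_nonneg _
  have hR0 : ∀ n, 0 ≤ R n := fun n => integral_nonneg fun _ => mul_nonneg (hk.nonneg _) (sq_nonneg _)
  have hm0 : ∀ n, 0 ≤ m n := fun n => integral_nonneg fun _ => sq_nonneg _
  -- The test `g = id` compares the mean of the Stein kernel with the second moment of `S`, so no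
  -- separate variance computation is needed.
  have hid : SteinTest (fun x => x) (fun _ => 1) :=
    ⟨fun x => hasDerivAt_id x, fun _ => by simp, fun x y => by simp⟩
  have A := h.stein_approx ha v b hk hki hg
  have A' := h.stein_approx ha v b hk hki hid
  have C := h.abs_cov_steinKernel_le ha v b hg
  rw [← hSdef] at A A' C
  simp only [one_mul] at A'
  simp only [← sq] at A'
  have hG1 : |∫ c, g' (S c) ∂(stdGaussian E)| ≤ 1 := by
    have := norm_integral_le_of_norm_le_const (μ := stdGaussian E) (f := fun x => g' (S x)) (C := 1)
      (ae_of_all _ fun x => hg.abs_le _)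
    simpa using this
  set X1 := ∫ c, S c * g (S c) ∂(stdGaussian E)
  set X2 := ∫ c, g' (S c) * steinKernel σ σ' a v b c ∂(stdGaussian E)
  set X3 := ∫ c, S c ^ 2 ∂(stdGaussian E)
  set X4 := ∫ c, steinKernel σ σ' a v b c ∂(stdGaussian E)
  set G := ∫ c, g' (S c) ∂(stdGaussian E)
  have main : |X1 - X3 * G| ≤ 2 * ∑ n, |v n| * steinError σ' σ'' k B a v b n +
      ∑ n, (v n ^ 2 + |kernelCoeff σ a v b n|) * (B * (|v n| + 2 * √(Q n))) := by
    have key : X1 - X3 * G = (X1 - X2) + (X2 - G * X4) + (-G) * (X3 - X4) := by ring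
    rw [key]
    refine (abs_add_three _ _ _).trans ?_
    rw [abs_mul, abs_neg]
    have : |G| * |X3 - X4| ≤ 1 * ∑ n, |v n| * steinError σ' σ'' k B a v b n :=
      mul_le_mul hG1 A' (abs_nonneg _) zero_le_one
    linarith
  have hκL : ∑ _n : ι, κ ^ 2 ≤ L := by simpa using hL
  -- Cauchy–Schwarz over `n`, with `N κ² ≤ L`. The second-derivative error enters through a square
  -- root, which is why `M₂` appears unsquared in the bound and `M₁` squared.
  have hκm : κ * ∑ n, √(m n) ≤ √L * √(∑ n, m n) := by
    rw [← Real.sqrt_mul' _ (Finset.sum_nonneg fun n _ => hm0 n)]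
    refine Real.le_sqrt_of_sq_le ?_
    rw [Finset.mul_sum]
    refine (Finset.sum_mul_sq_le_sq_mul_sq _ _ _).trans ?_
    simp only [Real.sq_sqrt (hm0 _)]
    exact mul_le_mul_of_nonneg_right hκL (Finset.sum_nonneg fun n _ => hm0 n)
  have hsqrtQ : ∀ n, √(Q n) ^ 2 = Q n := fun n => Real.sq_sqrt (hQ0 n)
  have err1 : ∀ n, |v n| * steinError σ' σ'' k B a v b n ≤
      B * (κ * (2 * κ ^ 2 + 3 * Q n + R n) + 2 * (κ * √(m n))) := by
    intro n
    have hvn := hv n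
    have hv0 := abs_nonneg (v n)
    have hv2 : v n ^ 2 ≤ κ ^ 2 := by rw [← sq_abs]; exact pow_le_pow_left₀ hv0 hvn 2
    have h0 := Real.sqrt_nonneg (Q n)
    have h1 : |v n| * √(Q n) ≤ κ ^ 2 + Q n := by
      nlinarith [hsqrtQ n, mul_le_mul_of_nonneg_right hvn h0, sq_nonneg (κ - √(Q n)), sq_nonneg κ]
    have hse : steinError σ' σ'' k B a v b n ≤ B * (2 * κ ^ 2 + 3 * Q n + R n + 2 * √(m n)) := by
      have : steinError σ' σ'' k B a v b n =
        v n ^ 2 * B + 2 * B * √(m n) + 2 * B * Q n + R n + B * |v n| * √(Q n) := rfl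
      rw [this]
      nlinarith [mul_le_mul_of_nonneg_left h1 hB0, mul_le_mul_of_nonneg_left hv2 hB0,
        mul_le_mul_of_nonneg_right hB (hR0 n)]
    have hrhs : 0 ≤ B * (2 * κ ^ 2 + 3 * Q n + R n + 2 * √(m n)) :=
      mul_nonneg hB0 (by have := hQ0 n; have := hR0 n; positivity)
    calc |v n| * steinError σ' σ'' k B a v b n
        ≤ |v n| * (B * (2 * κ ^ 2 + 3 * Q n + R n + 2 * √(m n))) :=
          mul_le_mul_of_nonneg_left hse hv0
      _ ≤ κ * (B * (2 * κ ^ 2 + 3 * Q n + R n + 2 * √(m n))) :=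
          mul_le_mul_of_nonneg_right hvn hrhs
      _ = _ := by ring
  have err2 : ∀ n, (v n ^ 2 + |kernelCoeff σ a v b n|) * (B * (|v n| + 2 * √(Q n))) ≤
      B * (κ * (4 * κ ^ 2 + 2 * q n ^ 2 + 2 * (s ^ 2 * p n ^ 2) + 4 * Q n)) := by
    intro n
    have hvn := hv n
    have hv0 := abs_nonneg (v n)
    have h0 := Real.sqrt_nonneg (Q n)
    have e1 : v n ^ 2 + |kernelCoeff σ a v b n| ≤ κ * (κ + |q n| + |s * p n|) := by
      have : kernelCoeff σ a v b n = v n * (q n + s * p n) := rfl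
      rw [this, abs_mul, ← sq_abs]
      have h1 := abs_add_le (q n) (s * p n)
      have h2 : |v n| ^ 2 ≤ κ * κ := by nlinarith
      have h3 : |v n| * |q n + s * p n| ≤ κ * (|q n| + |s * p n|) :=
        mul_le_mul hvn h1 (abs_nonneg _) hκ
      linarith
    have h4 : 0 ≤ B * (κ + 2 * √(Q n)) := by positivity
    have e2 : B * (|v n| + 2 * √(Q n)) ≤ B * (κ + 2 * √(Q n)) := by gcongr
    have e3 : 0 ≤ κ * (κ + |q n| + |s * p n|) := by positivity
    refine (mul_le_mul e1 e2 (by positivity) e3).trans ?_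
    have e4 : (κ + |q n| + |s * p n|) * (κ + 2 * √(Q n)) ≤
        4 * κ ^ 2 + 2 * q n ^ 2 + 2 * (s ^ 2 * p n ^ 2) + 4 * Q n := by
      have a1 : q n ^ 2 = |q n| ^ 2 := (sq_abs _).symm
      have a2 : s ^ 2 * p n ^ 2 = |s * p n| ^ 2 := by rw [sq_abs]; ring
      have a3 := hsqrtQ n
      have a4 : ∀ x y z w : ℝ, (x + y + z) * (x + 2 * w) ≤
          4 * x ^ 2 + 2 * y ^ 2 + 2 * z ^ 2 + 4 * w ^ 2 := fun x y z w => by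
        nlinarith [sq_nonneg (x - y), sq_nonneg (x - z), sq_nonneg (x - w), sq_nonneg (y - w),
          sq_nonneg (z - w), sq_nonneg x, sq_nonneg y, sq_nonneg z, sq_nonneg w]
      have a5 := a4 κ |q n| |s * p n| √(Q n)
      rw [a3, ← a2, ← a1] at a5
      exact a5
    calc κ * (κ + |q n| + |s * p n|) * (B * (κ + 2 * √(Q n)))
        = B * (κ * ((κ + |q n| + |s * p n|) * (κ + 2 * √(Q n)))) := by ring
      _ ≤ _ := by gcongr
  have S1 := Finset.sum_le_sum fun n (_ : n ∈ Finset.univ) => err1 n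
  have S2 := Finset.sum_le_sum fun n (_ : n ∈ Finset.univ) => err2 n
  simp only [← Finset.mul_sum, Finset.sum_add_distrib] at S1 S2
  have sq0 : 0 ≤ ∑ n, q n ^ 2 := Finset.sum_nonneg fun n _ => sq_nonneg _
  have sp0 : 0 ≤ s ^ 2 * ∑ n, p n ^ 2 :=
    mul_nonneg (sq_nonneg _) (Finset.sum_nonneg fun n _ => sq_nonneg _)
  have sQ0 : 0 ≤ ∑ n, Q n := Finset.sum_nonneg fun n _ => hQ0 n
  have sR0 : 0 ≤ ∑ n, R n := Finset.sum_nonneg fun n _ => hR0 n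
  have sL0 : 0 ≤ ∑ _n : ι, κ ^ 2 := Finset.sum_nonneg fun n _ => sq_nonneg _
  have sm0 : 0 ≤ κ * ∑ n, √(m n) := mul_nonneg hκ (Finset.sum_nonneg fun n _ => Real.sqrt_nonneg _)
  refine main.trans ((add_le_add (mul_le_mul_of_nonneg_left S1 zero_le_two) S2).trans ?_)
  set SK := ∑ _n : ι, κ ^ 2
  set SQ := ∑ n, Q n
  set SR := ∑ n, R n
  set Sq := ∑ n, q n ^ 2
  set Sp := s ^ 2 * ∑ n, p n ^ 2
  set Sm := κ * ∑ n, √(m n)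
  have f : B * (κ * (8 * SK + 2 * Sq + 2 * Sp + 10 * SQ + 2 * SR) + 4 * Sm) ≤
      B * (20 * (κ * (L + Sq + Sp + SQ + SR)) + 20 * (√L * √(∑ n, m n))) := by
    refine mul_le_mul_of_nonneg_left ?_ hB0
    have : κ * (8 * SK + 2 * Sq + 2 * Sp + 10 * SQ + 2 * SR) ≤
        κ * (20 * (L + Sq + Sp + SQ + SR)) := by
      refine mul_le_mul_of_nonneg_left ?_ hκ
      linarith
    have h0 : 0 ≤ √L * √(∑ n, m n) := by positivity
    linarith
  refine le_trans (le_of_eq ?_) (f.trans (le_of_eq ?_))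
  · ring
  · ring

end

end

section

/-! ### Gaussian averages under a small change of mean and variance -/

/-- The density of `N(s, v)` with respect to `N(0, 1)`. -/
noncomputable def shiftDensity (s v w : ℝ) : ℝ :=
  (√v)⁻¹ * Real.exp (w ^ 2 / 2 - (w - s) ^ 2 / (2 * v))

theorem continuous_shiftDensity (s v : ℝ) : Continuous (shiftDensity s v) := by
  unfold shiftDensity; fun_prop

theorem gaussianPDFReal_mul_shiftDensity (s w : ℝ) {v : NNReal} :
    gaussianPDFReal 0 1 w * shiftDensity s v w = gaussianPDFReal s v w := by
  simp only [gaussianPDFReal, shiftDensity, NNReal.coe_one, mul_one, sub_zero]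
  rw [mul_mul_mul_comm, ← Real.exp_add, ← mul_inv, ← Real.sqrt_mul (by positivity)]
  congr 2
  ring

/-- Completing the square: the squared relative density is again Gaussian up to a factor, so its
integral is explicit. The hypothesis `hu` encodes `u = v / (2 - v)` and forces `v < 2`. -/
theorem gaussianPDFReal_mul_shiftDensity_sq (s w : ℝ) {v u : NNReal} (hv : v ≠ 0)
    (hu : (u : ℝ) * (2 - v) = v) :
    gaussianPDFReal 0 1 w * shiftDensity s v w ^ 2 =
      (√(v * (2 - v)))⁻¹ * Real.exp (s ^ 2 / (2 - v)) *
        gaussianPDFReal (2 * s / (2 - v)) u w := by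
  have hv0 : (0 : ℝ) < v := by positivity
  have h2 : (0 : ℝ) < 2 - v := by
    by_contra h
    have := mul_nonpos_of_nonneg_of_nonpos u.coe_nonneg (not_lt.1 h)
    linarith
  have hue : (u : ℝ) = v / (2 - v) := by field_simp; linarith
  simp only [gaussianPDFReal, shiftDensity, NNReal.coe_one, mul_one, sub_zero]
  rw [mul_pow, ← Real.exp_nat_mul, inv_pow, Real.sq_sqrt hv0.le, mul_mul_mul_comm, ← Real.exp_add,
    mul_mul_mul_comm, ← Real.exp_add]
  congr 1
  · rw [← mul_inv, ← mul_inv]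
    congr 1
    rw [← Real.sqrt_mul (by positivity), hue]
    have : (v : ℝ) * (2 - v) * (2 * Real.pi * (v / (2 - v))) = 2 * Real.pi * (v ^ 2) := by
      field_simp
    rw [this, Real.sqrt_mul (by positivity : 0 ≤ 2 * Real.pi) ((v : ℝ) ^ 2), Real.sqrt_sq hv0.le]
  · rw [hue]
    congr 1
    field_simp
    ring

theorem map_affine (s : ℝ) {v : NNReal} :
    (γ).map (fun z => s + √v * z) = gaussianReal s v := by
  have h : (fun z : ℝ => s + √v * z) = (fun z => s + z) ∘ fun z => √v * z := rfl
  rw [h, ← Measure.map_map (by fun_prop) (by fun_prop), gaussianReal_map_const_mul,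
    gaussianReal_map_const_add]
  congr 1
  · simp
  · ext; simp

theorem integral_affine {h : ℝ → ℝ} (hh : AEStronglyMeasurable h γ) (s : ℝ) {v : NNReal}
    (hv : v ≠ 0) :
    ∫ z, h (s + √v * z) ∂γ = ∫ w, shiftDensity s v w * h w ∂γ := by
  have hac : gaussianReal s v ≪ γ :=
    (gaussianReal_absolutelyContinuous s hv).trans (gaussianReal_absolutelyContinuous' 0 one_ne_zero)
  have h1 : ∫ z, h (s + √v * z) ∂γ = ∫ w, h w ∂(gaussianReal s v) := by
    rw [← map_affine s (v := v), integral_map (by fun_prop)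
      (by rw [map_affine]; exact hh.mono_ac hac)]
  rw [h1, integral_gaussianReal_eq_integral_smul hv, integral_gaussianReal_eq]
  simp only [smul_eq_mul, ← mul_assoc, gaussianPDFReal_mul_shiftDensity]

theorem memLp_shiftDensity {η : ℝ} (h0 : 0 ≤ η) (h1 : η < 1) (s : ℝ) :
    MemLp (shiftDensity s (1 - η)) 2 γ ∧ ∫ w, shiftDensity s (1 - η) w ^ 2 ∂γ =
      (√(1 - η ^ 2))⁻¹ * Real.exp (s ^ 2 / (1 + η)) := by
  obtain ⟨v, hv⟩ : ∃ v : NNReal, (v : ℝ) = 1 - η :=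
    ⟨Real.toNNReal (1 - η), Real.coe_toNNReal _ (by linarith)⟩
  have hv0 : v ≠ 0 := by
    rw [← NNReal.coe_ne_zero, hv]; linarith
  obtain ⟨u, hu⟩ : ∃ u : NNReal, (u : ℝ) = (1 - η) / (1 + η) :=
    ⟨⟨(1 - η) / (1 + η), div_nonneg (by linarith) (by linarith)⟩, rfl⟩
  have hu0 : u ≠ 0 := by
    rw [← NNReal.coe_ne_zero, hu]
    exact (div_pos (by linarith) (by linarith)).ne'
  have huv : (u : ℝ) * (2 - v) = v := by
    rw [hu, hv]; field_simp; ring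
  rw [← hv]
  have key := fun w => gaussianPDFReal_mul_shiftDensity_sq s w hv0 huv
  constructor
  · rw [memLp_two_iff_integrable_sq (continuous_shiftDensity s v).aestronglyMeasurable,
      integrable_gaussianReal_iff]
    simp only [key]
    exact (integrable_gaussianPDFReal _ _).const_mul _
  · rw [integral_gaussianReal_eq]
    simp only [key]
    rw [integral_const_mul, integral_gaussianPDFReal_eq_one _ hu0, hv]
    have e1 : (1 - η) * (2 - (1 - η)) = 1 - η ^ 2 := by ring
    have e2 : 2 - (1 - η) = 1 + η := by ring
    rw [e1, e2, mul_one]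

/-- Let `R` be the density. Both `E[R (1 + s w)]` and `E[(1 + s w)²]` equal `1 + s²`, so the squared
distance is exactly `E[R²] - 1 - s²`, and the explicit value of `E[R²]` has no first-order term
left. -/
theorem integral_shiftDensity_sub_sq_le {η : ℝ} (h0 : 0 ≤ η) (h1 : η ≤ 1 / 2) (s : ℝ) :
    ∫ w, (shiftDensity s (1 - η) w - (1 + s * w)) ^ 2 ∂γ ≤
      ((s ^ 2 + η) * Real.exp (s ^ 2 / 2)) ^ 2 := by
  obtain ⟨hR, hR2⟩ := memLp_shiftDensity h0 (by linarith : η < 1) s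
  have hx : MemLp (fun x : ℝ => x) 2 γ := by simpa using memLp_id_pow 1 2 (by simp)
  have hℓ : MemLp (fun w : ℝ => 1 + s * w) 2 γ := (memLp_const (1 : ℝ)).add (hx.const_mul s)
  have hRℓ : Integrable (fun w => shiftDensity s (1 - η) w * (1 + s * w)) γ :=
    hR.integrable_mul (q := 2) hℓ
  obtain ⟨v, hv⟩ : ∃ v : NNReal, (v : ℝ) = 1 - η :=
    ⟨Real.toNNReal (1 - η), Real.coe_toNNReal _ (by linarith)⟩
  have hv0 : v ≠ 0 := by
    rw [← NNReal.coe_ne_zero, hv]; linarith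
  have eR : ∫ w, shiftDensity s (1 - η) w * (1 + s * w) ∂γ = 1 + s ^ 2 := by
    rw [← hv, ← integral_affine hℓ.1 s hv0]
    have e : (fun z : ℝ => 1 + s * (s + √v * z)) = fun z => (1 + s ^ 2) + s * √v * z := by
      ext z; ring
    rw [e, integral_add (integrable_const _) ((hx.integrable one_le_two).const_mul _),
      integral_const_mul, integral_id_gaussianReal]
    simp
  have eℓ : ∫ w, (1 + s * w) ^ 2 ∂γ = 1 + s ^ 2 := by
    have e : (fun w : ℝ => (1 + s * w) ^ 2) = fun w => (1 + 2 * s * w) + s ^ 2 * w ^ 2 := by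
      ext z; ring
    have i : Integrable (fun w : ℝ => 1 + 2 * s * w) γ :=
      (integrable_const (1 : ℝ)).add ((hx.integrable one_le_two).const_mul (2 * s))
    rw [e, integral_add i (hx.integrable_sq.const_mul _), integral_add (integrable_const _)
      ((hx.integrable one_le_two).const_mul _), integral_const_mul, integral_const_mul,
      integral_id_gaussianReal, integral_id_sq]
    simp
  have e : (fun w => (shiftDensity s (1 - η) w - (1 + s * w)) ^ 2) = fun w =>
      (shiftDensity s (1 - η) w ^ 2 - 2 * (shiftDensity s (1 - η) w * (1 + s * w))) +
        (1 + s * w) ^ 2 := by ext w; ring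
  rw [e, integral_sub_add hR.integrable_sq (hRℓ.const_mul 2)
    hℓ.integrable_sq, integral_const_mul, eR, eℓ, hR2]
  have b1 : (√(1 - η ^ 2))⁻¹ ≤ 1 + η ^ 2 := by
    rw [inv_le_comm₀ (Real.sqrt_pos.2 (by nlinarith)) (by positivity)]
    refine Real.le_sqrt_of_sq_le ?_
    rw [inv_pow, inv_le_iff_one_le_mul₀ (by positivity)]
    have : 0 ≤ η ^ 2 := sq_nonneg η
    have : η ^ 2 ≤ 1 / 4 := by nlinarith
    nlinarith [mul_nonneg (sq_nonneg η) (sub_nonneg.2 this)]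
  have b2 : Real.exp (s ^ 2 / (1 + η)) ≤ Real.exp (s ^ 2) :=
    Real.exp_le_exp.2 (div_le_self (sq_nonneg s) (by linarith))
  -- Iterate `e^x ≤ 1 + x e^x` once, with `x = s²`.
  have b3 : Real.exp (s ^ 2) ≤ 1 + s ^ 2 + s ^ 4 * Real.exp (s ^ 2) := by
    have h := Real.add_one_le_exp (-s ^ 2)
    have h2 := Real.add_one_le_exp (s ^ 2)
    have h3 : Real.exp (-s ^ 2) * Real.exp (s ^ 2) = 1 := by rw [← Real.exp_add]; simp
    have h4 : (-s ^ 2 + 1) * Real.exp (s ^ 2) ≤ 1 := by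
      have := mul_le_mul_of_nonneg_right h (Real.exp_pos (s ^ 2)).le
      rwa [h3] at this
    nlinarith [mul_le_mul_of_nonneg_left h4 (sq_nonneg s)]
  have b4 : Real.exp (s ^ 2 / 2) ^ 2 = Real.exp (s ^ 2) := by
    rw [← Real.exp_nat_mul]; congr 1; push_cast; ring
  have b5 : (√(1 - η ^ 2))⁻¹ * Real.exp (s ^ 2 / (1 + η)) ≤ (1 + η ^ 2) * Real.exp (s ^ 2) :=
    mul_le_mul b1 b2 (Real.exp_pos _).le (by positivity)
  rw [mul_pow, b4]
  have h5 : 0 ≤ s ^ 2 * η * Real.exp (s ^ 2) := by positivity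
  nlinarith

/-- First-order expansion of a Gaussian average in the mean and the variance. -/
theorem abs_integral_affine_sub_le {h : ℝ → ℝ} (hh : MemLp h 2 γ) {η : ℝ} (h0 : 0 ≤ η)
    (h1 : η ≤ 1 / 2) (s : ℝ) :
    |∫ z, h (s + √(1 - η) * z) ∂γ - ((∫ z, h z ∂γ) + s * ∫ z, z * h z ∂γ)| ≤
      (s ^ 2 + η) * Real.exp (s ^ 2 / 2) * √(∫ z, h z ^ 2 ∂γ) := by
  obtain ⟨hR, -⟩ := memLp_shiftDensity h0 (by linarith : η < 1) s
  have hx : MemLp (fun x : ℝ => x) 2 γ := by simpa using memLp_id_pow 1 2 (by simp)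
  have hℓ : MemLp (fun w : ℝ => 1 + s * w) 2 γ := (memLp_const (1 : ℝ)).add (hx.const_mul s)
  have i1 : Integrable (fun w => shiftDensity s (1 - η) w * h w) γ :=
    hR.integrable_mul (q := 2) hh
  have i2 : Integrable (fun w => (1 + s * w) * h w) γ := hℓ.integrable_mul (q := 2) hh
  have i3 : Integrable (fun w => w * h w) γ := hx.integrable_mul (q := 2) hh
  obtain ⟨v, hv⟩ : ∃ v : NNReal, (v : ℝ) = 1 - η :=
    ⟨Real.toNNReal (1 - η), Real.coe_toNNReal _ (by linarith)⟩
  have hv0 : v ≠ 0 := by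
    rw [← NNReal.coe_ne_zero, hv]; linarith
  have e1 := integral_affine hh.1 s hv0
  have e2 : (∫ z, h z ∂γ) + s * ∫ z, z * h z ∂γ = ∫ w, (1 + s * w) * h w ∂γ := by
    rw [← integral_const_mul, ← integral_add (hh.integrable one_le_two) (i3.const_mul s)]
    congr 1; ext w; ring
  rw [← hv, e1, e2, hv, ← integral_sub i1 i2]
  simp only [← sub_mul]
  refine (abs_integral_mul_le (hR.sub hℓ) hh).trans ?_
  refine mul_le_mul_of_nonneg_right ?_ (Real.sqrt_nonneg _)
  refine Real.sqrt_le_iff.2 ⟨by positivity, ?_⟩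
  exact integral_shiftDensity_sub_sq_le h0 h1 s

/-- The exact value is `√3`. This exponential moment pays for all the factors `exp (s² / 2)` that
the expansions produce. -/
theorem integrable_exp_sq_div_three :
    Integrable (fun x : ℝ => Real.exp (x ^ 2 / 3)) γ ∧ ∫ x : ℝ, Real.exp (x ^ 2 / 3) ∂γ ≤ 2 := by
  have e : ∀ x : ℝ, gaussianPDFReal 0 1 x * Real.exp (x ^ 2 / 3) =
      (√(2 * Real.pi))⁻¹ * Real.exp (-(1 / 6) * x ^ 2) := by
    intro x
    simp only [gaussianPDFReal, NNReal.coe_one, mul_one, sub_zero]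
    rw [mul_assoc, ← Real.exp_add]
    congr 2; ring
  constructor
  · rw [integrable_gaussianReal_iff]
    simp only [e]
    exact (integrable_exp_neg_mul_sq (by norm_num)).const_mul _
  · rw [integral_gaussianReal_eq]
    simp only [e]
    rw [integral_const_mul, integral_gaussian, ← Real.sqrt_inv, ← Real.sqrt_mul (by positivity)]
    refine Real.sqrt_le_iff.2 ⟨by norm_num, ?_⟩
    have := Real.pi_pos
    field_simp
    norm_num

theorem one_add_sq_le (x : ℝ) : 1 + x ^ 2 ≤ 64 * Real.exp (x ^ 2 / 64) := by
  have := Real.add_one_le_exp (x ^ 2 / 64)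
  linarith

end

section

/-! ### Correlations of functions of weakly dependent Gaussian coordinates -/

section

variable {E : Type*} [NormedAddCommGroup E] [InnerProductSpace ℝ E]
variable [FiniteDimensional ℝ E] [MeasurableSpace E] [BorelSpace E]

/-- Averaging over the component `b - p` of `b`, on which `G` does not depend. -/
theorem abs_integral_mul_comp_inner_sub_le {b p : E} {η : ℝ} (h0 : 0 ≤ η) (h1 : η ≤ 1 / 2)
    (hbp : ‖b - p‖ ^ 2 = 1 - η) (hp : ⟪p, b - p⟫ = 0) {G W : E → ℝ} {h : ℝ → ℝ}
    (hG : ∀ (c : E) (t : ℝ), G (c + t • (b - p)) = G c) (hh : MemLp h 2 γ)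
    (hi : Integrable (fun c => G c * h ⟪b, c⟫) (stdGaussian E))
    (hGi : Integrable G (stdGaussian E))
    (hGp : Integrable (fun c => G c * ⟪p, c⟫) (stdGaussian E))
    (hW : Integrable W (stdGaussian E))
    (hGW : ∀ c, |G c| * ((⟪p, c⟫ ^ 2 + η) * Real.exp (⟪p, c⟫ ^ 2 / 2)) ≤ W c) :
    |∫ c, G c * h ⟪b, c⟫ ∂(stdGaussian E) - ((∫ c, G c ∂(stdGaussian E)) * (∫ z, h z ∂γ) +
      (∫ c, G c * ⟪p, c⟫ ∂(stdGaussian E)) * ∫ z, z * h z ∂γ)| ≤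
      (∫ c, W c ∂(stdGaussian E)) * √(∫ z, h z ^ 2 ∂γ) := by
  have ht : 0 < √(1 - η) := Real.sqrt_pos.2 (by linarith)
  have hn : ‖b - p‖ = √(1 - η) := by rw [← hbp, Real.sqrt_sq (norm_nonneg _)]
  obtain ⟨e, he, hbe⟩ : ∃ e : E, ‖e‖ = 1 ∧ b - p = √(1 - η) • e :=
    ⟨(√(1 - η))⁻¹ • (b - p), by rw [norm_smul, hn]; simp [ht.ne', abs_of_pos ht],
      by rw [smul_inv_smul₀ ht.ne']⟩
  have hpe : ⟪p, e⟫ = 0 := by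
    rw [hbe, inner_smul_right] at hp
    exact (mul_eq_zero.1 hp).resolve_left ht.ne'
  have hb : b = p + √(1 - η) • e := by rw [← hbe]; abel
  have r1 : ∀ c z, G (resample e (c, z)) = G c := fun c z => by
    have := hG c ((z - ⟪e, c⟫) * (√(1 - η))⁻¹)
    rw [hbe, mul_smul, inv_smul_smul₀ ht.ne'] at this
    exact this
  have r2 : ∀ c z, ⟪b, resample e (c, z)⟫ = ⟪p, c⟫ + √(1 - η) * z := fun c z => by
    rw [hb, inner_add_left, inner_smul_left, inner_resample_self he, inner_resample, hpe]
    simp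
  have e1 := integral_resample he hi
  have i1 := (integrable_resample he hi).integral_prod_left
  simp only [r1, r2, integral_const_mul] at e1 i1
  have i2 : Integrable (fun c => G c * ((∫ z, h z ∂γ) + ⟪p, c⟫ * ∫ z, z * h z ∂γ))
      (stdGaussian E) := by
    refine ((hGi.mul_const (∫ z, h z ∂γ)).add (hGp.mul_const (∫ z, z * h z ∂γ))).congr
      (ae_of_all _ fun c => ?_)
    simp only [Pi.add_apply]; ring
  have e2 : (∫ c, G c ∂(stdGaussian E)) * (∫ z, h z ∂γ) +
      (∫ c, G c * ⟪p, c⟫ ∂(stdGaussian E)) * ∫ z, z * h z ∂γ =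
      ∫ c, G c * ((∫ z, h z ∂γ) + ⟪p, c⟫ * ∫ z, z * h z ∂γ) ∂(stdGaussian E) := by
    rw [← integral_mul_const, ← integral_mul_const, ← integral_add (hGi.mul_const _)
      (hGp.mul_const _)]
    congr 1; ext c; ring
  rw [e1, e2, ← integral_sub i1 i2, ← Real.norm_eq_abs, ← integral_mul_const]
  refine norm_integral_le_of_norm_le (hW.mul_const _) (ae_of_all _ fun c => ?_)
  rw [← mul_sub, Real.norm_eq_abs, abs_mul]
  refine (mul_le_mul_of_nonneg_left (abs_integral_affine_sub_le hh h0 h1 _) (abs_nonneg _)).trans ?_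
  rw [← mul_assoc]
  exact mul_le_mul_of_nonneg_right (hGW c) (Real.sqrt_nonneg _)

theorem memLp_exp_sq_div_six : MemLp (fun x : ℝ => Real.exp (x ^ 2 / 6)) 2 γ ∧
    √(∫ x : ℝ, Real.exp (x ^ 2 / 6) ^ 2 ∂γ) ≤ 2 := by
  have e : ∀ x : ℝ, Real.exp (x ^ 2 / 6) ^ 2 = Real.exp (x ^ 2 / 3) := fun x => by
    rw [← Real.exp_nat_mul]; congr 1; push_cast; ring
  obtain ⟨h1, h2⟩ := integrable_exp_sq_div_three
  constructor
  · rw [memLp_two_iff_integrable_sq (by fun_prop)]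
    simpa only [e] using h1
  · simp only [e]
    exact Real.sqrt_le_iff.2 ⟨by norm_num, by linarith⟩

/-- Expansion of the correlation of functions of two weakly correlated Gaussian variables. -/
theorem abs_integral_pair_sub_le {a b : E} (ha : ‖a‖ = 1) (hb : ‖b‖ = 1) (hr : |⟪a, b⟫| ≤ 1 / 8)
    {ψ φ : ℝ → ℝ} (hψ : MemLp ψ 2 γ) (hφ : MemLp φ 2 γ) (hφ0 : ∫ x, φ x ∂γ = 0) :
    |∫ c, ψ ⟪a, c⟫ * φ ⟪b, c⟫ ∂(stdGaussian E) -
      ⟪a, b⟫ * ((∫ x, x * ψ x ∂γ) * ∫ x, x * φ x ∂γ)| ≤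
      128 * ⟪a, b⟫ ^ 2 * (√(∫ x, ψ x ^ 2 ∂γ) * √(∫ x, φ x ^ 2 ∂γ)) := by
  set r := ⟪a, b⟫ with hrdef
  have hr2 : r ^ 2 ≤ 1 / 64 := by
    rw [← sq_abs]; nlinarith [abs_nonneg r]
  have haa : ⟪a, a⟫ = 1 := by rw [real_inner_self_eq_norm_sq, ha]; norm_num
  have hbb : ⟪b, b⟫ = 1 := by rw [real_inner_self_eq_norm_sq, hb]; norm_num
  have hba : ⟪b, a⟫ = r := by rw [hrdef, real_inner_comm]
  have hx : MemLp (fun x : ℝ => x) 2 γ := by simpa using memLp_id_pow 1 2 (by simp)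
  have hLψ := memLp_comp_inner ha hψ
  have hLφ := memLp_comp_inner hb hφ
  have hxψ : Integrable (fun x => x * ψ x) γ := hx.integrable_mul (q := 2) hψ
  obtain ⟨hexp, hexp2⟩ := memLp_exp_sq_div_six
  have hψe : Integrable (fun x => |ψ x| * Real.exp (x ^ 2 / 6)) γ :=
    MemLp.integrable_mul (p := 2) (q := 2) hψ.abs hexp
  have ein : ∀ c, ⟪r • a, c⟫ = r * ⟪a, c⟫ := fun c => by rw [inner_smul_left]; rfl
  -- The regression of `b` on `a` is `r • a`, with residual variance `1 - r²`.
  have key := abs_integral_mul_comp_inner_sub_le (b := b) (p := r • a) (η := r ^ 2)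
    (G := fun c => ψ ⟪a, c⟫) (h := φ)
    (W := fun c => 64 * r ^ 2 * (|ψ ⟪a, c⟫| * Real.exp (⟪a, c⟫ ^ 2 / 6)))
    (sq_nonneg r) (by linarith)
    (by
      rw [← real_inner_self_eq_norm_sq]
      simp only [inner_sub_left, inner_sub_right, inner_smul_left, inner_smul_right, haa, hbb, hba,
        ← hrdef, conj_trivial]
      ring)
    (by
      simp only [inner_sub_right, inner_smul_left, inner_smul_right, haa, ← hrdef, conj_trivial]
      ring)
    (fun c t => by
      congr 1
      simp only [inner_add_right, inner_sub_right, inner_smul_right, haa, ← hrdef]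
      ring)
    hφ (hLψ.integrable_mul (q := 2) hLφ) (hLψ.integrable one_le_two)
    (by
      simp only [ein]
      refine ((integrable_comp_inner ha hxψ).const_mul r).congr (ae_of_all _ fun c => ?_)
      simp only; ring)
    ((integrable_comp_inner ha hψe).const_mul _)
    (fun c => by
      rw [ein]
      set x := ⟪a, c⟫
      have e1 : (r * x) ^ 2 + r ^ 2 = r ^ 2 * (1 + x ^ 2) := by ring
      have e2 : Real.exp ((r * x) ^ 2 / 2) ≤ Real.exp (x ^ 2 / 128) :=
        Real.exp_le_exp.2 (by nlinarith [sq_nonneg x])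
      have e3 := one_add_sq_le x
      have e4 : Real.exp (x ^ 2 / 64) * Real.exp (x ^ 2 / 128) ≤ Real.exp (x ^ 2 / 6) := by
        rw [← Real.exp_add]; exact Real.exp_le_exp.2 (by nlinarith [sq_nonneg x])
      rw [e1]
      calc |ψ x| * (r ^ 2 * (1 + x ^ 2) * Real.exp ((r * x) ^ 2 / 2))
          ≤ |ψ x| * (r ^ 2 * (64 * Real.exp (x ^ 2 / 64)) * Real.exp (x ^ 2 / 128)) := by gcongr
        _ = |ψ x| * r ^ 2 * 64 * (Real.exp (x ^ 2 / 64) * Real.exp (x ^ 2 / 128)) := by ring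
        _ ≤ |ψ x| * r ^ 2 * 64 * Real.exp (x ^ 2 / 6) := by gcongr
        _ = _ := by ring)
  rw [hφ0, mul_zero, zero_add] at key
  simp only [ein] at key
  have e5 : ∫ c, ψ ⟪a, c⟫ * (r * ⟪a, c⟫) ∂(stdGaussian E) = r * ∫ x, x * ψ x ∂γ := by
    rw [← integral_comp_inner ha hxψ.1, ← integral_const_mul]
    congr 1; ext c; ring
  have e6 : ∫ c, |ψ ⟪a, c⟫| * Real.exp (⟪a, c⟫ ^ 2 / 6) ∂(stdGaussian E) =
      ∫ x, |ψ x| * Real.exp (x ^ 2 / 6) ∂γ := integral_comp_inner ha hψe.1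
  have e7 : ∫ x, |ψ x| * Real.exp (x ^ 2 / 6) ∂γ ≤ √(∫ x, ψ x ^ 2 ∂γ) * 2 := by
    refine (le_abs_self _).trans ((abs_integral_mul_le (f := fun x => |ψ x|) hψ.abs hexp).trans ?_)
    simp only [sq_abs]
    exact mul_le_mul_of_nonneg_left hexp2 (Real.sqrt_nonneg _)
  rw [e5, integral_const_mul, e6, mul_assoc] at key
  refine key.trans ?_
  calc 64 * r ^ 2 * (∫ x, |ψ x| * Real.exp (x ^ 2 / 6) ∂γ) * √(∫ x, φ x ^ 2 ∂γ)
      ≤ 64 * r ^ 2 * (√(∫ x, ψ x ^ 2 ∂γ) * 2) * √(∫ x, φ x ^ 2 ∂γ) := by gcongr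
    _ = _ := by ring

theorem abs_integral_comp_inner_mul_le {a b : E} (ha : ‖a‖ = 1) (hb : ‖b‖ = 1) {ψ φ : ℝ → ℝ}
    (hψ : MemLp ψ 2 γ) (hφ : MemLp φ 2 γ) :
    |∫ c, ψ ⟪a, c⟫ * φ ⟪b, c⟫ ∂(stdGaussian E)| ≤ √(∫ x, ψ x ^ 2 ∂γ) * √(∫ x, φ x ^ 2 ∂γ) := by
  refine (abs_integral_mul_le (memLp_comp_inner ha hψ) (memLp_comp_inner hb hφ)).trans
    (le_of_eq ?_)
  congr 2
  · exact integral_comp_inner ha hψ.integrable_sq.1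
  · exact integral_comp_inner hb hφ.integrable_sq.1

theorem abs_integral_id_mul_le {φ : ℝ → ℝ} (hφ : MemLp φ 2 γ) :
    |∫ x, x * φ x ∂γ| ≤ √(∫ x, φ x ^ 2 ∂γ) := by
  have hx : MemLp (fun x : ℝ => x) 2 γ := by simpa using memLp_id_pow 1 2 (by simp)
  simpa [integral_id_sq] using abs_integral_mul_le hx hφ

/-- The covariance of a function of two correlated Gaussian variables, up to second order in the
correlation. -/
theorem abs_integral_comp_inner_mul_sub_le {a b : E} (ha : ‖a‖ = 1) (hb : ‖b‖ = 1) {φ : ℝ → ℝ}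
    (hφ : MemLp φ 2 γ) (hφ0 : ∫ x, φ x ∂γ = 0) :
    |∫ c, φ ⟪a, c⟫ * φ ⟪b, c⟫ ∂(stdGaussian E) - ⟪a, b⟫ * (∫ x, x * φ x ∂γ) ^ 2| ≤
      128 * ⟪a, b⟫ ^ 2 * ∫ x, φ x ^ 2 ∂γ := by
  have hV : 0 ≤ ∫ x, φ x ^ 2 ∂γ := integral_nonneg fun _ => sq_nonneg _
  rcases le_total |⟪a, b⟫| (1 / 8) with hr | hr
  · have := abs_integral_pair_sub_le ha hb hr hφ hφ hφ0
    rwa [Real.mul_self_sqrt hV, ← sq] at this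
  -- For `|r| ≥ 1/8` the factor `128 r²` is at least `2`, and Cauchy–Schwarz on each of the two
  -- terms suffices.
  · have h1 := abs_integral_comp_inner_mul_le ha hb hφ hφ
    rw [Real.mul_self_sqrt hV] at h1
    have h2 : (∫ x, x * φ x ∂γ) ^ 2 ≤ ∫ x, φ x ^ 2 ∂γ := by
      rw [← sq_abs, ← Real.sq_sqrt hV]
      exact pow_le_pow_left₀ (abs_nonneg _) (abs_integral_id_mul_le hφ) 2
    have h3 : |⟪a, b⟫| ≤ 1 := by
      have := abs_real_inner_le_norm a b
      rwa [ha, hb, one_mul] at this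
    have h4 : (1 / 8 : ℝ) ^ 2 ≤ ⟪a, b⟫ ^ 2 := by
      rw [← sq_abs ⟪a, b⟫]; exact pow_le_pow_left₀ (by norm_num) hr 2
    have h5 : |⟪a, b⟫ * (∫ x, x * φ x ∂γ) ^ 2| ≤ ∫ x, φ x ^ 2 ∂γ := by
      rw [abs_mul, abs_of_nonneg (sq_nonneg (∫ x, x * φ x ∂γ))]
      nlinarith [sq_nonneg (∫ x, x * φ x ∂γ)]
    refine (abs_sub _ _).trans ?_
    nlinarith

end

end

/-! ### Moment bounds and correlations of three functions -/

section

/-- Young's inequality with exponents `4` and `4/3`; the difference of the two sides is a quarter of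
the product shown nonnegative in the proof. -/
theorem mul_pow_three_le {t w : ℝ} (ht : 0 ≤ t) (hw : 0 ≤ w) :
    t * w ^ 3 ≤ t ^ 4 / 4 + 3 * w ^ 4 / 4 := by
  have : 0 ≤ (t - w) ^ 2 * (t ^ 2 + 2 * (t * w) + 3 * w ^ 2) := by positivity
  nlinarith

/-- A crude bound (the true value is `105`), from `x² ≤ 12 exp (x² / 12)`: `12⁴ · 2 = 41472`. -/
theorem integral_id_pow_eight_le : ∫ x : ℝ, x ^ 8 ∂γ ≤ 41472 := by
  have h2 : ∫ x : ℝ, x ^ 8 ∂γ ≤ ∫ x : ℝ, 12 ^ 4 * Real.exp (x ^ 2 / 3) ∂γ := by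
    refine integral_mono (integrable_id_pow 8) (integrable_exp_sq_div_three.1.const_mul _)
      fun x => ?_
    have h3 := Real.add_one_le_exp (x ^ 2 / 12)
    have h4 : x ^ 2 ≤ 12 * Real.exp (x ^ 2 / 12) := by linarith
    have h5 : Real.exp (x ^ 2 / 12) ^ 4 = Real.exp (x ^ 2 / 3) := by
      rw [← Real.exp_nat_mul]; congr 1; push_cast; ring
    have h6 := pow_le_pow_left₀ (sq_nonneg x) h4 4
    rw [mul_pow, h5, ← pow_mul] at h6
    exact h6
  rw [integral_const_mul] at h2
  have := integrable_exp_sq_div_three.2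
  linarith

/-- A centered function `φ` whose power `8/3` is integrable, as witnessed by `w`, and a function
`k` with integrable fourth power. -/
structure MomentPair (φ w k : ℝ → ℝ) (Λ : ℝ) : Prop where
  one_le : 1 ≤ Λ
  measurable : Measurable φ
  mean : ∫ x, φ x ∂γ = 0
  nonneg : ∀ x, 0 ≤ w x
  sq_le : ∀ x, φ x ^ 2 ≤ w x ^ 3
  integrable_four : Integrable (fun x => w x ^ 4) γ
  integral_four : ∫ x, w x ^ 4 ∂γ ≤ Λ
  measurable_weight : Measurable k
  integrable_weight : Integrable (fun x => k x ^ 4) γ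
  integral_weight : ∫ x, k x ^ 4 ∂γ ≤ Λ

namespace MomentPair

variable {φ w k : ℝ → ℝ} {Λ : ℝ}

/-- The margin between `L²` and `L^{8/3}` is spent on a multiplier: `q² φ² ≤ q² w³ ≤ q⁸ + w⁴`. It is
used for `q = 1`, `q = x` and a Gaussian exponential. -/
theorem integral_sq_mul_le (h : MomentPair φ w k Λ) {q : ℝ → ℝ} (hq : Measurable q)
    (hqi : Integrable (fun x => q x ^ 8) γ) : Integrable (fun x => (q x * φ x) ^ 2) γ ∧
    ∫ x, (q x * φ x) ^ 2 ∂γ ≤ (∫ x, q x ^ 8 ∂γ) + Λ := by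
  have hb : ∀ x, (q x * φ x) ^ 2 ≤ q x ^ 8 + w x ^ 4 := fun x => by
    have h1 := mul_le_mul_of_nonneg_left (h.sq_le x) (sq_nonneg (q x))
    have h2 := mul_pow_three_le (sq_nonneg (q x)) (h.nonneg x)
    rw [← pow_mul] at h2
    have h3 : 0 ≤ q x ^ 8 := by positivity
    have h4 : 0 ≤ w x ^ 4 := by positivity
    rw [mul_pow]
    norm_num at h2
    linarith
  have hi : Integrable (fun x => (q x * φ x) ^ 2) γ :=
    (hqi.add h.integrable_four).mono' ((hq.mul h.measurable).pow_const 2).aestronglyMeasurable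
      (ae_of_all _ fun x => by
        rw [Real.norm_eq_abs, abs_of_nonneg (sq_nonneg _)]; exact hb x)
  refine ⟨hi, (integral_mono hi (hqi.add h.integrable_four) hb).trans ?_⟩
  simp only [Pi.add_apply]
  rw [integral_add hqi h.integrable_four]
  linarith [h.integral_four]

theorem memLp_weight (h : MomentPair φ w k Λ) : MemLp k 2 γ ∧ ∫ x, k x ^ 2 ∂γ ≤ Λ := by
  have hb : ∀ x, k x ^ 2 ≤ 1 / 2 + 1 / 2 * k x ^ 4 := fun x => by
    nlinarith [sq_nonneg (k x ^ 2 - 1)]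
  have hi : Integrable (fun x => 1 / 2 + 1 / 2 * k x ^ 4) γ :=
    (integrable_const _).add (h.integrable_weight.const_mul _)
  have hi2 : Integrable (fun x => k x ^ 2) γ :=
    hi.mono' (h.measurable_weight.pow_const 2).aestronglyMeasurable (ae_of_all _ fun x => by
      rw [Real.norm_eq_abs, abs_of_nonneg (sq_nonneg _)]; exact hb x)
  refine ⟨(memLp_two_iff_integrable_sq h.measurable_weight.aestronglyMeasurable).2 hi2,
    (integral_mono hi2 hi hb).trans ?_⟩
  rw [integral_add (integrable_const _) (h.integrable_weight.const_mul _), integral_const_mul]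
  have := h.integral_weight
  have := h.one_le
  simp
  linarith

theorem memLp (h : MomentPair φ w k Λ) : MemLp φ 2 γ ∧ ∫ x, φ x ^ 2 ∂γ ≤ 2 * Λ := by
  have := h.integral_sq_mul_le (q := fun _ => 1) measurable_const (by simp)
  simp only [one_mul, one_pow, integral_const, probReal_univ, smul_eq_mul] at this
  exact ⟨(memLp_two_iff_integrable_sq h.measurable.aestronglyMeasurable).2 this.1, by
    linarith [this.2, h.one_le]⟩

theorem memLp_id_mul (h : MomentPair φ w k Λ) : MemLp (fun x => x * φ x) 2 γ ∧
    ∫ x, (x * φ x) ^ 2 ∂γ ≤ 42000 * Λ := by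
  have h1 := h.integral_sq_mul_le (q := fun x => x) measurable_id (integrable_id_pow 8)
  refine ⟨(memLp_two_iff_integrable_sq (measurable_id.mul h.measurable).aestronglyMeasurable).2
    h1.1, h1.2.trans ?_⟩
  have := integral_id_pow_eight_le
  have := h.one_le
  linarith

theorem memLp_exp_mul (h : MomentPair φ w k Λ) :
    MemLp (fun x => Real.exp (x ^ 2 / 24) * φ x) 2 γ ∧
    ∫ x, (Real.exp (x ^ 2 / 24) * φ x) ^ 2 ∂γ ≤ 3 * Λ := by
  have h5 : ∀ x : ℝ, Real.exp (x ^ 2 / 24) ^ 8 = Real.exp (x ^ 2 / 3) := fun x => by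
    rw [← Real.exp_nat_mul]; congr 1; push_cast; ring
  have hm : Measurable fun x : ℝ => Real.exp (x ^ 2 / 24) := by fun_prop
  have h1 := h.integral_sq_mul_le hm (by simpa only [h5] using integrable_exp_sq_div_three.1)
  refine ⟨(memLp_two_iff_integrable_sq (hm.mul h.measurable).aestronglyMeasurable).2
    h1.1, h1.2.trans ?_⟩
  simp only [h5]
  linarith [integrable_exp_sq_div_three.2, h.one_le]

variable {E : Type*} [NormedAddCommGroup E] [InnerProductSpace ℝ E]
variable [FiniteDimensional ℝ E] [MeasurableSpace E] [BorelSpace E]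

/-- Pointwise Hölder with weights `1/4 + 3/8 + 3/8 = 1`, the reason why `φ` is asked to have power
`8/3` integrable. -/
theorem abs_mul_mul_le (h : MomentPair φ w k Λ) (x y z : ℝ) :
    |k z * φ x * φ y| ≤ k z ^ 4 / 4 + 3 * w x ^ 4 / 8 + 3 * w y ^ 4 / 8 := by
  have h1 := h.sq_le x
  have h2 := h.sq_le y
  have h3 := mul_pow_three_le (abs_nonneg (k z)) (h.nonneg x)
  have h4 := mul_pow_three_le (abs_nonneg (k z)) (h.nonneg y)
  have h5 : |k z| ^ 4 = k z ^ 4 := by rw [← abs_pow, abs_of_nonneg (by positivity)]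
  rw [h5] at h3 h4
  have h6 : |φ x * φ y| ≤ (w x ^ 3 + w y ^ 3) / 2 := by
    rw [abs_mul]
    nlinarith [sq_nonneg (|φ x| - |φ y|), sq_abs (φ x), sq_abs (φ y)]
  rw [mul_assoc, abs_mul]
  have h7 := mul_le_mul_of_nonneg_left h6 (abs_nonneg (k z))
  linarith

theorem integrable_triple (h : MomentPair φ w k Λ) {a b e : E} (ha : ‖a‖ = 1) (hb : ‖b‖ = 1)
    (he : ‖e‖ = 1) :
    Integrable (fun c => k ⟪e, c⟫ * φ ⟪a, c⟫ * φ ⟪b, c⟫) (stdGaussian E) ∧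
    |∫ c, k ⟪e, c⟫ * φ ⟪a, c⟫ * φ ⟪b, c⟫ ∂(stdGaussian E)| ≤ Λ := by
  have i1 := (integrable_comp_inner he h.integrable_weight).div_const 4
  have i2 := ((integrable_comp_inner ha h.integrable_four).const_mul 3).div_const 8
  have i3 := ((integrable_comp_inner hb h.integrable_four).const_mul 3).div_const 8
  have i12 : Integrable (fun c => k ⟪e, c⟫ ^ 4 / 4 + 3 * w ⟪a, c⟫ ^ 4 / 8) (stdGaussian E) :=
    i1.add i2
  have i123 : Integrable (fun c => k ⟪e, c⟫ ^ 4 / 4 + 3 * w ⟪a, c⟫ ^ 4 / 8 +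
    3 * w ⟪b, c⟫ ^ 4 / 8) (stdGaussian E) := i12.add i3
  have hm : Measurable (fun c => k ⟪e, c⟫ * φ ⟪a, c⟫ * φ ⟪b, c⟫) := by
    have := h.measurable
    have := h.measurable_weight
    fun_prop
  have hb' : ∀ c : E, ‖k ⟪e, c⟫ * φ ⟪a, c⟫ * φ ⟪b, c⟫‖ ≤ k ⟪e, c⟫ ^ 4 / 4 +
      3 * w ⟪a, c⟫ ^ 4 / 8 + 3 * w ⟪b, c⟫ ^ 4 / 8 := fun c => by
    rw [Real.norm_eq_abs]; exact h.abs_mul_mul_le _ _ _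
  refine ⟨i123.mono' hm.aestronglyMeasurable (ae_of_all _ hb'), ?_⟩
  rw [← Real.norm_eq_abs]
  refine (norm_integral_le_of_norm_le i123 (ae_of_all _ hb')).trans ?_
  rw [integral_add i12 i3, integral_add i1 i2, integral_div, integral_div, integral_div,
    integral_const_mul, integral_const_mul,
    integral_comp_inner he h.integrable_weight.1 (f := fun x => k x ^ 4),
    integral_comp_inner ha h.integrable_four.1 (f := fun x => w x ^ 4),
    integral_comp_inner hb h.integrable_four.1 (f := fun x => w x ^ 4)]
  linarith [h.integral_four, h.integral_weight]

theorem abs_integral_weight_le (h : MomentPair φ w k Λ) : |∫ x, k x ∂γ| ≤ Λ := by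
  have h1 := abs_integral_mul_le h.memLp_weight.1 (memLp_const (1 : ℝ))
  simp only [mul_one, one_pow, integral_const, probReal_univ, smul_eq_mul, Real.sqrt_one] at h1
  refine h1.trans (Real.sqrt_le_iff.2 ⟨by linarith [h.one_le], ?_⟩)
  nlinarith [h.memLp_weight.2, h.one_le]

/-- The factor `φ ⟪b, c⟫` is centred, so the zeroth-order term vanishes and the pair expansion
starts at first order in the correlation. -/
theorem abs_pair_le (h : MomentPair φ w k Λ) {a b : E} (ha : ‖a‖ = 1) (hb : ‖b‖ = 1)
    (hr : |⟪a, b⟫| ≤ 1 / 8) :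
    |∫ c, ⟪a, c⟫ * φ ⟪a, c⟫ * φ ⟪b, c⟫ ∂(stdGaussian E)| ≤ 7000 * Λ ^ 2 * |⟪a, b⟫| := by
  have h1 := abs_integral_pair_sub_le ha hb hr h.memLp_id_mul.1 h.memLp.1 h.mean
  have h2 := abs_integral_id_mul_le h.memLp_id_mul.1
  have h3 := abs_integral_id_mul_le h.memLp.1
  have hΛ := h.one_le
  have h4 : √(∫ x, (x * φ x) ^ 2 ∂γ) ≤ 205 * Λ :=
    Real.sqrt_le_iff.2 ⟨by linarith, by nlinarith [h.memLp_id_mul.2]⟩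
  have h5 : √(∫ x, φ x ^ 2 ∂γ) ≤ 2 * Λ :=
    Real.sqrt_le_iff.2 ⟨by linarith, by nlinarith [h.memLp.2]⟩
  have h6 : √(∫ x, (x * φ x) ^ 2 ∂γ) * √(∫ x, φ x ^ 2 ∂γ) ≤ 205 * Λ * (2 * Λ) :=
    mul_le_mul h4 h5 (Real.sqrt_nonneg _) (by linarith)
  have h7 : |(∫ x, x * (x * φ x) ∂γ) * ∫ x, x * φ x ∂γ| ≤ 205 * Λ * (2 * Λ) := by
    rw [abs_mul]
    exact mul_le_mul (h2.trans h4) (h3.trans h5) (abs_nonneg _) (by linarith)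
  set r := ⟪a, b⟫
  set X := ∫ c, ⟪a, c⟫ * φ ⟪a, c⟫ * φ ⟪b, c⟫ ∂(stdGaussian E)
  set Y := (∫ x, x * (x * φ x) ∂γ) * ∫ x, x * φ x ∂γ
  have h8 : |X| ≤ |r * Y| + |X - r * Y| := by
    have := abs_add_le (r * Y) (X - r * Y); simpa using this
  rw [abs_mul] at h8
  have h9 : r ^ 2 ≤ |r| / 8 := by rw [← sq_abs]; nlinarith [abs_nonneg r]
  have h10 : 128 * r ^ 2 * (√(∫ x, (x * φ x) ^ 2 ∂γ) * √(∫ x, φ x ^ 2 ∂γ)) ≤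
      128 * (|r| / 8) * (205 * Λ * (2 * Λ)) := by gcongr
  have h11 : |r| * |Y| ≤ |r| * (205 * Λ * (2 * Λ)) := by gcongr
  have : 0 ≤ |r| * Λ ^ 2 := by positivity
  nlinarith

/-- The quantity is `‖m • a + l • b‖²` for unit `a, b` with inner product `r`: the variance
explained by regressing a third direction on `a` and `b`. -/
theorem regression_variance_bounds {m l r : ℝ} (hr : |r| ≤ 1 / 8) :
    0 ≤ m ^ 2 + l ^ 2 + 2 * (m * l) * r ∧
      m ^ 2 + l ^ 2 + 2 * (m * l) * r ≤ 2 * (m ^ 2 + l ^ 2) := by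
  have habs : |m * l * r| ≤ (m ^ 2 + l ^ 2) / 16 := by
    rw [abs_mul, abs_mul]
    nlinarith [sq_nonneg (|m| - |l|), sq_abs m, sq_abs l, mul_nonneg (abs_nonneg m) (abs_nonneg l)]
  constructor
  · linarith [neg_abs_le (m * l * r), sq_nonneg m, sq_nonneg l]
  · linarith [le_abs_self (m * l * r), sq_nonneg m, sq_nonneg l]

theorem regression_sq_add_le {m l x y η A : ℝ} (hm : m ^ 2 ≤ 2 * A) (hl : l ^ 2 ≤ 2 * A)
    (hη : η ≤ 2 * (m ^ 2 + l ^ 2)) :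
    (m * x + l * y) ^ 2 + η ≤ 8 * A * ((1 + x ^ 2) * (1 + y ^ 2)) := by
  have s2 : (m * x + l * y) ^ 2 ≤ 2 * (m ^ 2 * x ^ 2 + l ^ 2 * y ^ 2) := by
    linarith [sq_nonneg (m * x - l * y)]
  have t1 : (m * x + l * y) ^ 2 + η ≤ 2 * (m ^ 2 * (1 + x ^ 2)) + 2 * (l ^ 2 * (1 + y ^ 2)) := by
    linarith
  have hx := sq_nonneg x
  have hy := sq_nonneg y
  have hxy := mul_nonneg hx hy
  have t2 : 1 + x ^ 2 ≤ (1 + x ^ 2) * (1 + y ^ 2) := by linarith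
  have t3 : 1 + y ^ 2 ≤ (1 + x ^ 2) * (1 + y ^ 2) := by linarith
  have hA : 0 ≤ 2 * A := (sq_nonneg m).trans hm
  have t4 := mul_le_mul hm t2 (by positivity) hA
  have t5 := mul_le_mul hl t3 (by positivity) hA
  linarith

theorem regression_sq_le {m l : ℝ} (hm : m ^ 2 ≤ 1 / 49) (hl : l ^ 2 ≤ 1 / 49) (x y : ℝ) :
    (m * x + l * y) ^ 2 / 2 ≤ x ^ 2 / 49 + y ^ 2 / 49 := by
  linarith [sq_nonneg (m * x - l * y), mul_le_mul_of_nonneg_right hm (sq_nonneg x),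
    mul_le_mul_of_nonneg_right hl (sq_nonneg y)]

/-- The fraction is a regression coefficient, the solution of the two-by-two normal equations. The
`1/49` comes from `(64/63)(1/8 + 1/64) = 1/7`. -/
theorem regression_coeff_bounds {r x y : ℝ} (hr : |r| ≤ 1 / 8) (hx : |x| ≤ 1 / 8)
    (hy : |y| ≤ 1 / 8) : ((x - r * y) / (1 - r ^ 2)) ^ 2 ≤ 1 / 49 ∧
      ((x - r * y) / (1 - r ^ 2)) ^ 2 ≤ 2 * (x ^ 2 + y ^ 2) := by
  have hr2 : r ^ 2 ≤ 1 / 64 := by rw [← sq_abs]; nlinarith [abs_nonneg r]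
  have h1 : |x - r * y| ≤ |x| + |y| / 8 := by
    refine (abs_sub _ _).trans ?_
    rw [abs_mul]
    linarith [mul_le_mul_of_nonneg_right hr (abs_nonneg y)]
  have h2 : |(x - r * y) / (1 - r ^ 2)| ≤ (64 / 63) * (|x| + |y| / 8) := by
    rw [abs_div, abs_of_pos (by linarith : 0 < 1 - r ^ 2), div_le_iff₀ (by linarith)]
    have : 0 ≤ |x| + |y| / 8 := by positivity
    nlinarith
  have h3 := pow_le_pow_left₀ (abs_nonneg _) h2 2
  rw [sq_abs] at h3
  constructor
  · refine h3.trans ?_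
    have h4 : (64 / 63) * (|x| + |y| / 8) ≤ 1 / 7 := by linarith
    have h5 := pow_le_pow_left₀ (by positivity) h4 2
    linarith
  · refine h3.trans ?_
    rw [← sq_abs x, ← sq_abs y]
    linarith [sq_nonneg (|x| - |y|), sq_nonneg |x|, sq_nonneg |y|]

/-- Split `e` into its projection `m • a + l • b` and a residual independent of the two `φ` factors,
and average `k` over the residual. The hypotheses `hml`, `hml'` are the normal equations; expanding
`k` to first order leaves an error quadratic in the correlations with `e`. -/
theorem abs_integral_triple_sub_linear_le (h : MomentPair φ w k Λ) {a b e : E} (ha : ‖a‖ = 1)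
    (hb : ‖b‖ = 1) (he : ‖e‖ = 1) (hab : |⟪a, b⟫| ≤ 1 / 8) {m l : ℝ}
    (hml : m + l * ⟪a, b⟫ = ⟪a, e⟫) (hml' : m * ⟪a, b⟫ + l = ⟪b, e⟫)
    (hm49 : m ^ 2 ≤ 1 / 49) (hl49 : l ^ 2 ≤ 1 / 49)
    (hm2 : m ^ 2 ≤ 2 * (⟪a, e⟫ ^ 2 + ⟪b, e⟫ ^ 2)) (hl2 : l ^ 2 ≤ 2 * (⟪b, e⟫ ^ 2 + ⟪a, e⟫ ^ 2)) :
    |∫ c, k ⟪e, c⟫ * φ ⟪a, c⟫ * φ ⟪b, c⟫ ∂(stdGaussian E) -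
      ((∫ c, φ ⟪a, c⟫ * φ ⟪b, c⟫ ∂(stdGaussian E)) * (∫ x, k x ∂γ) +
        (m * (∫ c, ⟪a, c⟫ * φ ⟪a, c⟫ * φ ⟪b, c⟫ ∂(stdGaussian E)) +
          l * ∫ c, ⟪b, c⟫ * φ ⟪b, c⟫ * φ ⟪a, c⟫ ∂(stdGaussian E)) * ∫ x, x * k x ∂γ)| ≤
      98304 * Λ ^ 2 * (⟪a, e⟫ ^ 2 + ⟪b, e⟫ ^ 2) := by
  set r := ⟪a, b⟫ with hr
  set α := ⟪a, e⟫ with hα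
  set β := ⟪b, e⟫ with hβ
  have hΛ := h.one_le
  have haa : ⟪a, a⟫ = 1 := by rw [real_inner_self_eq_norm_sq, ha]; norm_num
  have hbb : ⟪b, b⟫ = 1 := by rw [real_inner_self_eq_norm_sq, hb]; norm_num
  have hee : ⟪e, e⟫ = 1 := by rw [real_inner_self_eq_norm_sq, he]; norm_num
  have hba : ⟪b, a⟫ = r := by rw [hr, real_inner_comm]
  have hea : ⟪e, a⟫ = α := by rw [hα, real_inner_comm]
  have heb : ⟪e, b⟫ = β := by rw [hβ, real_inner_comm]
  have hpc : ∀ c, ⟪m • a + l • b, c⟫ = m * ⟪a, c⟫ + l * ⟪b, c⟫ := fun c => by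
    simp [inner_add_left, inner_smul_left]
  obtain ⟨η, hη⟩ : ∃ η, η = m * α + l * β := ⟨_, rfl⟩
  have hη1 : η = m ^ 2 + l ^ 2 + 2 * (m * l) * r := by rw [hη, ← hml, ← hml']; ring
  obtain ⟨hη0, hη2⟩ := regression_variance_bounds (m := m) (l := l) hab
  rw [← hη1] at hη0 hη2
  have hLa := memLp_comp_inner ha h.memLp.1
  have hLb := memLp_comp_inner hb h.memLp.1
  have hLa' := memLp_comp_inner ha h.memLp_id_mul.1
  have hLb' := memLp_comp_inner hb h.memLp_id_mul.1
  have hEa := memLp_comp_inner ha h.memLp_exp_mul.1.abs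
  have hEb := memLp_comp_inner hb h.memLp_exp_mul.1.abs
  have iG : Integrable (fun c => φ ⟪a, c⟫ * φ ⟪b, c⟫) (stdGaussian E) :=
    hLa.integrable_mul (q := 2) hLb
  have iGa : Integrable (fun c => ⟪a, c⟫ * φ ⟪a, c⟫ * φ ⟪b, c⟫) (stdGaussian E) :=
    hLa'.integrable_mul (q := 2) hLb
  have iGb : Integrable (fun c => ⟪b, c⟫ * φ ⟪b, c⟫ * φ ⟪a, c⟫) (stdGaussian E) :=
    hLb'.integrable_mul (q := 2) hLa
  have iW : Integrable (fun c => |Real.exp (⟪a, c⟫ ^ 2 / 24) * φ ⟪a, c⟫| *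
      |Real.exp (⟪b, c⟫ ^ 2 / 24) * φ ⟪b, c⟫|) (stdGaussian E) :=
    MemLp.integrable_mul (p := 2) (q := 2) hEa hEb
  have ek : (fun c => φ ⟪a, c⟫ * φ ⟪b, c⟫ * k ⟪e, c⟫) =
      fun c => k ⟪e, c⟫ * φ ⟪a, c⟫ * φ ⟪b, c⟫ := by ext c; ring
  have ep : (fun c => φ ⟪a, c⟫ * φ ⟪b, c⟫ * ⟪m • a + l • b, c⟫) = fun c =>
      m * (⟪a, c⟫ * φ ⟪a, c⟫ * φ ⟪b, c⟫) + l * (⟪b, c⟫ * φ ⟪b, c⟫ * φ ⟪a, c⟫) := by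
    ext c; rw [hpc]; ring
  have key := abs_integral_mul_comp_inner_sub_le (b := e) (p := m • a + l • b) (η := η)
    (G := fun c => φ ⟪a, c⟫ * φ ⟪b, c⟫) (h := k)
    (W := fun c => 8 * 64 ^ 2 * (α ^ 2 + β ^ 2) * (|Real.exp (⟪a, c⟫ ^ 2 / 24) * φ ⟪a, c⟫| *
      |Real.exp (⟪b, c⟫ ^ 2 / 24) * φ ⟪b, c⟫|)) hη0 (by linarith)
    (by
      rw [← real_inner_self_eq_norm_sq]
      simp only [inner_sub_left, inner_sub_right, inner_add_left, inner_add_right,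
        inner_smul_left, inner_smul_right, haa, hbb, hba, hee, hea, heb, ← hα, ← hβ,
        ← hr, conj_trivial]
      rw [hη]
      linear_combination m * hml + l * hml')
    (by
      simp only [inner_sub_right, inner_add_left, inner_add_right,
        inner_smul_left, inner_smul_right, haa, hbb, hba, ← hα, ← hβ,
        ← hr, conj_trivial]
      linear_combination - m * hml - l * hml')
    (fun c t => by
      have e1 : ⟪a, c + t • (e - (m • a + l • b))⟫ = ⟪a, c⟫ := by
        simp only [inner_sub_right, inner_add_right, inner_smul_right, haa, ← hα, ← hr]
        linear_combination - t * hml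
      have e2 : ⟪b, c + t • (e - (m • a + l • b))⟫ = ⟪b, c⟫ := by
        simp only [inner_sub_right, inner_add_right, inner_smul_right, hbb, hba, ← hβ]
        linear_combination - t * hml'
      simp only [e1, e2])
    h.memLp_weight.1
    (by rw [ek]; exact (h.integrable_triple ha hb he).1)
    iG
    (by rw [ep]; exact (iGa.const_mul m).add (iGb.const_mul l))
    (iW.const_mul _)
    (fun c => by
      rw [hpc]
      set x := ⟪a, c⟫
      set y := ⟪b, c⟫
      have s3 : (m * x + l * y) ^ 2 + η ≤ 8 * (α ^ 2 + β ^ 2) * ((1 + x ^ 2) * (1 + y ^ 2)) :=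
        regression_sq_add_le hm2 (by rwa [add_comm] at hl2) hη2
      have e1 : Real.exp ((m * x + l * y) ^ 2 / 2) ≤
          Real.exp (x ^ 2 / 49) * Real.exp (y ^ 2 / 49) := by
        rw [← Real.exp_add]
        exact Real.exp_le_exp.2 (regression_sq_le hm49 hl49 x y)
      -- The exponents fit because `1/64 + 1/49 ≤ 1/24`, the exponent available in `memLp_exp_mul`.
      have e2 : ∀ x : ℝ, (1 + x ^ 2) * Real.exp (x ^ 2 / 49) ≤ 64 * Real.exp (x ^ 2 / 24) := by
        intro x
        calc (1 + x ^ 2) * Real.exp (x ^ 2 / 49)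
            ≤ 64 * Real.exp (x ^ 2 / 64) * Real.exp (x ^ 2 / 49) := by
              gcongr; exact one_add_sq_le x
          _ = 64 * Real.exp (x ^ 2 / 64 + x ^ 2 / 49) := by rw [Real.exp_add]; ring
          _ ≤ 64 * Real.exp (x ^ 2 / 24) := by
              gcongr; linarith [sq_nonneg x]
      have e3 := mul_le_mul (e2 x) (e2 y) (by positivity) (by positivity)
      rw [abs_mul, abs_mul, abs_mul, abs_of_pos (Real.exp_pos _), abs_of_pos (Real.exp_pos _)]
      calc |φ x| * |φ y| * (((m * x + l * y) ^ 2 + η) * Real.exp ((m * x + l * y) ^ 2 / 2))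
          ≤ |φ x| * |φ y| * (8 * (α ^ 2 + β ^ 2) * ((1 + x ^ 2) * (1 + y ^ 2)) *
            (Real.exp (x ^ 2 / 49) * Real.exp (y ^ 2 / 49))) := by gcongr
        _ = |φ x| * |φ y| * (8 * (α ^ 2 + β ^ 2)) * ((1 + x ^ 2) * Real.exp (x ^ 2 / 49) *
            ((1 + y ^ 2) * Real.exp (y ^ 2 / 49))) := by ring
        _ ≤ |φ x| * |φ y| * (8 * (α ^ 2 + β ^ 2)) * (64 * Real.exp (x ^ 2 / 24) *
            (64 * Real.exp (y ^ 2 / 24))) := by gcongr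
        _ = _ := by ring)
  rw [ek, ep, integral_add (iGa.const_mul m) (iGb.const_mul l), integral_const_mul,
    integral_const_mul, integral_const_mul] at key
  have hk2 : √(∫ x, k x ^ 2 ∂γ) ≤ Λ :=
    Real.sqrt_le_iff.2 ⟨by linarith, by nlinarith [h.memLp_weight.2]⟩
  have hW : ∫ c, |Real.exp (⟪a, c⟫ ^ 2 / 24) * φ ⟪a, c⟫| *
      |Real.exp (⟪b, c⟫ ^ 2 / 24) * φ ⟪b, c⟫| ∂(stdGaussian E) ≤ 3 * Λ := by
    have := (le_abs_self _).trans (abs_integral_comp_inner_mul_le ha hb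
      (ψ := fun x => |Real.exp (x ^ 2 / 24) * φ x|) (φ := fun x => |Real.exp (x ^ 2 / 24) * φ x|)
      h.memLp_exp_mul.1.abs h.memLp_exp_mul.1.abs)
    simp only [sq_abs] at this
    rw [Real.mul_self_sqrt (integral_nonneg fun _ => sq_nonneg _)] at this
    exact this.trans h.memLp_exp_mul.2
  refine key.trans ?_
  calc _ ≤ 8 * 64 ^ 2 * (α ^ 2 + β ^ 2) * (3 * Λ) * Λ := by gcongr
    _ = _ := by ring

/-- The correlation of three functions of weakly correlated Gaussian variables. -/
theorem abs_integral_triple_sub_le_of_small (h : MomentPair φ w k Λ) {a b e : E} (ha : ‖a‖ = 1)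
    (hb : ‖b‖ = 1) (he : ‖e‖ = 1) (hab : |⟪a, b⟫| ≤ 1 / 8) (hae : |⟪a, e⟫| ≤ 1 / 8)
    (hbe : |⟪b, e⟫| ≤ 1 / 8) :
    |∫ c, k ⟪e, c⟫ * φ ⟪a, c⟫ * φ ⟪b, c⟫ ∂(stdGaussian E) -
      ⟪a, b⟫ * (∫ x, x * φ x ∂γ) ^ 2 * ∫ x, k x ∂γ| ≤
      120000 * Λ ^ 3 * (⟪a, e⟫ ^ 2 + ⟪b, e⟫ ^ 2 + ⟪a, b⟫ ^ 2) := by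
  set r := ⟪a, b⟫ with hr
  set α := ⟪a, e⟫ with hα
  set β := ⟪b, e⟫ with hβ
  have hΛ := h.one_le
  have hr2 : r ^ 2 ≤ 1 / 64 := by rw [← sq_abs]; nlinarith [abs_nonneg r]
  have hd : 63 / 64 ≤ 1 - r ^ 2 := by linarith
  have hd0 : 1 - r ^ 2 ≠ 0 := by linarith
  obtain ⟨m, hm⟩ : ∃ m, m = (α - r * β) / (1 - r ^ 2) := ⟨_, rfl⟩
  obtain ⟨l, hl⟩ : ∃ l, l = (β - r * α) / (1 - r ^ 2) := ⟨_, rfl⟩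
  have hml : m + l * r = α := by rw [hm, hl]; field_simp; ring
  have hml' : m * r + l = β := by rw [hm, hl]; field_simp; ring
  obtain ⟨hm49, hm2⟩ := regression_coeff_bounds hab hae hbe
  obtain ⟨hl49, hl2⟩ := regression_coeff_bounds hab hbe hae
  rw [← hm] at hm49 hm2
  rw [← hl] at hl49 hl2
  have key := h.abs_integral_triple_sub_linear_le ha hb he hab hml hml' hm49 hl49 hm2 hl2
  have hba : ⟪b, a⟫ = r := by rw [hr, real_inner_comm]
  have hab' : |⟪b, a⟫| ≤ 1 / 8 := by rwa [hba]
  have p1 := h.abs_pair_le ha hb hab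
  have p2 := h.abs_pair_le hb ha hab'
  rw [hba] at p2
  rw [← hr] at p1
  have q0 := abs_integral_comp_inner_mul_sub_le ha hb h.memLp.1 h.mean
  rw [← hr] at q0
  have hk0 := h.abs_integral_weight_le
  have hk2 : √(∫ x, k x ^ 2 ∂γ) ≤ Λ :=
    Real.sqrt_le_iff.2 ⟨by linarith, by nlinarith [h.memLp_weight.2]⟩
  have hk1 := (abs_integral_id_mul_le h.memLp_weight.1).trans hk2
  have hφ2 := h.memLp.2
  set T := ∫ c, k ⟪e, c⟫ * φ ⟪a, c⟫ * φ ⟪b, c⟫ ∂(stdGaussian E)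
  set P := ∫ c, φ ⟪a, c⟫ * φ ⟪b, c⟫ ∂(stdGaussian E)
  set P1 := ∫ c, ⟪a, c⟫ * φ ⟪a, c⟫ * φ ⟪b, c⟫ ∂(stdGaussian E)
  set P2 := ∫ c, ⟪b, c⟫ * φ ⟪b, c⟫ * φ ⟪a, c⟫ ∂(stdGaussian E)
  set K0 := ∫ x, k x ∂γ
  set K1 := ∫ x, x * k x ∂γ
  set c1 := ∫ x, x * φ x ∂γ
  set V := ∫ x, φ x ^ 2 ∂γ
  set D := α ^ 2 + β ^ 2 + r ^ 2 with hD
  have hD0 : 0 ≤ D := by positivity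
  have f1 : 98304 * Λ ^ 2 * (α ^ 2 + β ^ 2) ≤ 98304 * Λ ^ 2 * D := by
    have : α ^ 2 + β ^ 2 ≤ D := by linarith [sq_nonneg r]
    gcongr
  -- The coefficient `m` and the correlation `P1` are each of first order, so the linear terms are
  -- in fact of second order.
  have f2 : |m * P1 * K1| ≤ 7000 * Λ ^ 3 * D := by
    have : |m| * |r| ≤ D := by
      linarith [sq_nonneg (|m| - |r|), sq_abs m, sq_abs r, sq_nonneg r]
    rw [abs_mul, abs_mul]
    calc |m| * |P1| * |K1| ≤ |m| * (7000 * Λ ^ 2 * |r|) * Λ := by gcongr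
      _ = 7000 * Λ ^ 3 * (|m| * |r|) := by ring
      _ ≤ _ := by gcongr
  have f3 : |l * P2 * K1| ≤ 7000 * Λ ^ 3 * D := by
    have : |l| * |r| ≤ D := by
      linarith [sq_nonneg (|l| - |r|), sq_abs l, sq_abs r, sq_nonneg r]
    rw [abs_mul, abs_mul]
    calc |l| * |P2| * |K1| ≤ |l| * (7000 * Λ ^ 2 * |r|) * Λ := by gcongr
      _ = 7000 * Λ ^ 3 * (|l| * |r|) := by ring
      _ ≤ _ := by gcongr
  have f4 : |(P - r * c1 ^ 2) * K0| ≤ 128 * D * (2 * Λ) * Λ := by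
    rw [abs_mul]
    have : r ^ 2 ≤ D := by linarith [sq_nonneg α, sq_nonneg β]
    calc |P - r * c1 ^ 2| * |K0| ≤ 128 * r ^ 2 * V * Λ := by gcongr
      _ ≤ _ := by gcongr
  have dec : T - r * c1 ^ 2 * K0 = (T - (P * K0 + (m * P1 + l * P2) * K1)) +
      (P - r * c1 ^ 2) * K0 + (m * P1 * K1 + l * P2 * K1) := by ring
  have f5 := abs_add_three (T - (P * K0 + (m * P1 + l * P2) * K1))
      ((P - r * c1 ^ 2) * K0) (m * P1 * K1 + l * P2 * K1)
  have f6 := abs_add_le (m * P1 * K1) (l * P2 * K1)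
  rw [dec]
  have f7 : Λ ^ 2 * D ≤ Λ ^ 3 * D :=
    mul_le_mul_of_nonneg_right (pow_le_pow_right₀ hΛ (by norm_num)) hD0
  have f8 : 0 ≤ Λ ^ 3 * D := by positivity
  linarith

/-- If some correlation exceeds `1/8`, the right side is at least `1875 Λ³`, which dominates both
terms on the left outright. -/
theorem abs_integral_triple_sub_le (h : MomentPair φ w k Λ) {a b e : E} (ha : ‖a‖ = 1)
    (hb : ‖b‖ = 1) (he : ‖e‖ = 1) :
    |∫ c, k ⟪e, c⟫ * φ ⟪a, c⟫ * φ ⟪b, c⟫ ∂(stdGaussian E) -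
      ⟪a, b⟫ * (∫ x, x * φ x ∂γ) ^ 2 * ∫ x, k x ∂γ| ≤
      120000 * Λ ^ 3 * (⟪a, e⟫ ^ 2 + ⟪b, e⟫ ^ 2 + ⟪a, b⟫ ^ 2) := by
  by_cases hs : |⟪a, b⟫| ≤ 1 / 8 ∧ |⟪a, e⟫| ≤ 1 / 8 ∧ |⟪b, e⟫| ≤ 1 / 8
  · exact h.abs_integral_triple_sub_le_of_small ha hb he hs.1 hs.2.1 hs.2.2
  have hΛ := h.one_le
  have hD : 1 / 64 ≤ ⟪a, e⟫ ^ 2 + ⟪b, e⟫ ^ 2 + ⟪a, b⟫ ^ 2 := by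
    have aux : ∀ x : ℝ, ¬ |x| ≤ 1 / 8 → 1 / 64 ≤ x ^ 2 := fun x hx => by
      rw [← sq_abs]; nlinarith [not_le.1 hx]
    have := sq_nonneg ⟪a, e⟫
    have := sq_nonneg ⟪b, e⟫
    have := sq_nonneg ⟪a, b⟫
    rcases not_and_or.1 hs with h1 | h1
    · linarith [aux _ h1]
    rcases not_and_or.1 h1 with h1 | h1 <;> linarith [aux _ h1]
  have h1 := (h.integrable_triple ha hb he).2
  have h2 : (∫ x, x * φ x ∂γ) ^ 2 ≤ 2 * Λ := by
    have hV : 0 ≤ ∫ x, φ x ^ 2 ∂γ := integral_nonneg fun _ => sq_nonneg _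
    refine le_trans ?_ h.memLp.2
    rw [← sq_abs, ← Real.sq_sqrt hV]
    exact pow_le_pow_left₀ (abs_nonneg _) (abs_integral_id_mul_le h.memLp.1) 2
  have h3 : |⟪a, b⟫| ≤ 1 := by
    have := abs_real_inner_le_norm a b
    rwa [ha, hb, one_mul] at this
  have h4 : |⟪a, b⟫ * (∫ x, x * φ x ∂γ) ^ 2 * ∫ x, k x ∂γ| ≤ 1 * (2 * Λ) * Λ := by
    rw [abs_mul, abs_mul, abs_of_nonneg (sq_nonneg (∫ x, x * φ x ∂γ))]
    have := h.abs_integral_weight_le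
    gcongr
  refine (abs_sub _ _).trans ?_
  have h5 : Λ ≤ Λ ^ 3 := le_self_pow₀ hΛ (by norm_num)
  have h6 : Λ ^ 2 ≤ Λ ^ 3 := pow_le_pow_right₀ hΛ (by norm_num)
  have h7 : 120000 * Λ ^ 3 * (1 / 64) ≤
      120000 * Λ ^ 3 * (⟪a, e⟫ ^ 2 + ⟪b, e⟫ ^ 2 + ⟪a, b⟫ ^ 2) := by gcongr
  nlinarith

end MomentPair

end

section

/-! ### Gaussian Gagliardo–Nirenberg inequality -/

/-- A bounded approximation (for `δ > 0`) of `(1 + t²)^{1/3}`. -/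
noncomputable def cubeRootWeight (δ t : ℝ) : ℝ := ((1 + t ^ 2) / (1 + δ * t ^ 2)) ^ (1 / 3 : ℝ)

section

variable {δ : ℝ}

theorem measurable_cubeRootWeight (δ : ℝ) : Measurable (cubeRootWeight δ) := by
  unfold cubeRootWeight; fun_prop

theorem one_le_cubeRootWeight (h0 : 0 ≤ δ) (h1 : δ ≤ 1) (t : ℝ) : 1 ≤ cubeRootWeight δ t := by
  refine Real.one_le_rpow ?_ (by norm_num)
  rw [one_le_div (by positivity)]
  nlinarith [sq_nonneg t]

theorem cubeRootWeight_pow_three (h0 : 0 ≤ δ) (t : ℝ) :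
    cubeRootWeight δ t ^ 3 = (1 + t ^ 2) / (1 + δ * t ^ 2) := by
  rw [cubeRootWeight, ← Real.rpow_mul_natCast (by positivity)]
  norm_num

theorem cubeRootWeight_pow_three_le (h0 : 0 ≤ δ) (t : ℝ) :
    cubeRootWeight δ t ^ 3 ≤ 1 + t ^ 2 := by
  rw [cubeRootWeight_pow_three h0]
  exact div_le_self (by positivity) (by nlinarith [mul_nonneg h0 (sq_nonneg t)])

theorem cubeRootWeight_le (h0 : 0 < δ) (h1 : δ ≤ 1) (t : ℝ) : cubeRootWeight δ t ≤ δ⁻¹ := by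
  have h2 := one_le_cubeRootWeight h0.le h1 t
  refine (le_self_pow₀ h2 (by norm_num : 3 ≠ 0)).trans ?_
  rw [cubeRootWeight_pow_three h0.le, div_le_iff₀ (by positivity)]
  field_simp
  nlinarith

theorem cubeRootWeight_pow_four_le (h0 : 0 ≤ δ) (h1 : δ ≤ 1) (t : ℝ) :
    cubeRootWeight δ t ^ 4 ≤ 2 + 2 * (t ^ 2 * cubeRootWeight δ t) := by
  have h2 := one_le_cubeRootWeight h0 h1 t
  have h3 := cubeRootWeight_pow_three_le h0 t
  set s := cubeRootWeight δ t
  have h4 : s ^ 4 ≤ s * (1 + t ^ 2) := by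
    have := mul_le_mul_of_nonneg_left h3 (by linarith : 0 ≤ s)
    linarith
  rcases le_total (t ^ 2) 1 with h | h
  · have h5 : s ≤ s ^ 3 := le_self_pow₀ h2 (by norm_num)
    nlinarith [sq_nonneg t]
  · nlinarith

theorem hasDerivAt_mul_cubeRootWeight (h0 : 0 ≤ δ) (t : ℝ) :
    HasDerivAt (fun t => t * cubeRootWeight δ t)
      (cubeRootWeight δ t *
        (1 + 2 / 3 * (t ^ 2 * (1 - δ) / ((1 + δ * t ^ 2) * (1 + t ^ 2))))) t := by
  have hd : 0 < 1 + δ * t ^ 2 := by positivity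
  have hn : 0 < 1 + t ^ 2 := by positivity
  have hu : HasDerivAt (fun t : ℝ => (1 + t ^ 2) / (1 + δ * t ^ 2))
      (2 * t * (1 - δ) / (1 + δ * t ^ 2) ^ 2) t := by
    have e1 : HasDerivAt (fun t : ℝ => 1 + t ^ 2) (2 * t) t := by
      simpa using ((hasDerivAt_id t).pow 2).const_add 1
    have e2 : HasDerivAt (fun t : ℝ => 1 + δ * t ^ 2) (δ * (2 * t)) t := by
      simpa using (((hasDerivAt_id t).pow 2).const_mul δ).const_add 1
    refine (e1.div e2 hd.ne').congr_deriv ?_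
    congr 1; ring
  have hs := hu.rpow_const (p := (1 / 3 : ℝ)) (Or.inl (div_pos hn hd).ne')
  refine ((hasDerivAt_id t).mul hs).congr_deriv ?_
  have e3 : ((1 + t ^ 2) / (1 + δ * t ^ 2)) ^ ((1 / 3 : ℝ) - 1) =
      cubeRootWeight δ t * ((1 + δ * t ^ 2) / (1 + t ^ 2)) := by
    rw [Real.rpow_sub_one (div_pos hn hd).ne', cubeRootWeight]
    field_simp
  rw [e3]
  simp only [id, one_mul]
  rw [show ((1 + t ^ 2) / (1 + δ * t ^ 2)) ^ (1 / 3 : ℝ) = cubeRootWeight δ t from rfl]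
  field_simp

theorem derivative_factor_bounds (h0 : 0 ≤ δ) (h1 : δ ≤ 1) (t : ℝ) :
    0 ≤ t ^ 2 * (1 - δ) / ((1 + δ * t ^ 2) * (1 + t ^ 2)) ∧
      t ^ 2 * (1 - δ) / ((1 + δ * t ^ 2) * (1 + t ^ 2)) ≤ 1 := by
  have := sub_nonneg.2 h1
  refine ⟨by positivity, ?_⟩
  rw [div_le_one (by positivity)]
  nlinarith [mul_nonneg h0 (sq_nonneg t), mul_nonneg (mul_nonneg h0 (sq_nonneg t)) (sq_nonneg t)]

end

section

variable {σ σ' σ'' : ℝ → ℝ} {B : ℝ}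

theorem abs_mul_mul_mul_le {x s₀ t s : ℝ} (hs : 1 ≤ s) (h4 : s ^ 4 ≤ 2 + 2 * (t ^ 2 * s)) :
    |x * (s₀ * (t * s))| ≤ 3 / 8 * (t ^ 2 * s) + 2 * s₀ ^ 4 + x ^ 8 / 16 + 1 / 8 := by
  have h1 : |x * (s₀ * (t * s))| ≤ 1 / 4 * (t ^ 2 * s) + x ^ 2 * s₀ ^ 2 * s := by
    rw [abs_le]
    constructor <;> nlinarith [mul_nonneg (by linarith : 0 ≤ s) (sq_nonneg (t / 2 - x * s₀)),
      mul_nonneg (by linarith : 0 ≤ s) (sq_nonneg (t / 2 + x * s₀))]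
  have h2 : x ^ 2 * s₀ ^ 2 * s ≤ 2 * s₀ ^ 4 + x ^ 4 * s ^ 2 / 8 := by
    linarith [sq_nonneg (2 * s₀ ^ 2 - x ^ 2 * s / 2)]
  have h3 : x ^ 4 * s ^ 2 ≤ x ^ 8 / 2 + s ^ 4 / 2 := by
    linarith [sq_nonneg (x ^ 4 - s ^ 2)]
  linarith

theorem abs_mul_weight_mul_le {s₀ s₂ t s q : ℝ} (h4 : s ^ 4 ≤ 2 + 2 * (t ^ 2 * s))
    (hq0 : 0 ≤ q) (hq : q ≤ 1) :
    |s₀ * (s * (1 + 2 / 3 * q)) * s₂| ≤ 1 / 4 * (t ^ 2 * s) + 2 * s₀ ^ 4 + s₂ ^ 2 + 1 / 4 := by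
  have h1 : |s₀ * (s * (1 + 2 / 3 * q)) * s₂| ≤ 2 * (|s₀ * s| * |s₂|) := by
    have : s₀ * (s * (1 + 2 / 3 * q)) * s₂ = (s₀ * s) * s₂ * (1 + 2 / 3 * q) := by ring
    rw [this, abs_mul, abs_mul, abs_of_nonneg (by linarith : 0 ≤ 1 + 2 / 3 * q)]
    nlinarith [mul_nonneg (abs_nonneg (s₀ * s)) (abs_nonneg s₂)]
  have h2 : 2 * (|s₀ * s| * |s₂|) ≤ s₀ ^ 2 * s ^ 2 + s₂ ^ 2 := by
    have e : s₀ ^ 2 * s ^ 2 = |s₀ * s| ^ 2 := by rw [sq_abs]; ring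
    rw [e, ← sq_abs s₂]
    linarith [sq_nonneg (|s₀ * s| - |s₂|)]
  have h3 : s₀ ^ 2 * s ^ 2 ≤ 2 * s₀ ^ 4 + s ^ 4 / 8 := by
    linarith [sq_nonneg (4 * s₀ ^ 2 - s ^ 2)]
  linarith

/-- Let `τ(t) = t s(t)`, with `s` the weight. Integration by parts gives `E[σ'² s(σ')] = E[x σ
τ(σ')] - E[σ τ'(σ') σ'']`. By Young's inequality the two terms on the right are at most `3/8` and
`1/4` of the left side, plus moments of `σ`, `σ''` and `x`; since `5/8 < 1`, the left side absorbs
them, with a bound independent of `δ`. -/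
theorem Activation.integral_sq_mul_cubeRootWeight_le (h : Activation σ σ' σ'' B) {δ : ℝ}
    (h0 : 0 < δ) (h1 : δ ≤ 1) :
    Integrable (fun x => σ' x ^ 2 * cubeRootWeight δ (σ' x)) γ ∧
      ∫ x, σ' x ^ 2 * cubeRootWeight δ (σ' x) ∂γ ≤ 7000 * B := by
  have hB := h.one_le
  set q : ℝ → ℝ := fun t => t ^ 2 * (1 - δ) / ((1 + δ * t ^ 2) * (1 + t ^ 2)) with hq
  have hq0 : ∀ t, 0 ≤ q t := fun t => (derivative_factor_bounds h0.le h1 t).1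
  have hq1 : ∀ t, q t ≤ 1 := fun t => (derivative_factor_bounds h0.le h1 t).2
  have hqm : Measurable q := by rw [hq]; fun_prop
  have hm := measurable_cubeRootWeight δ
  have hσm := h.continuous.measurable
  have hσm' := h.continuous'.measurable
  have hσm'' := h.continuous''.measurable
  have hs1 := one_le_cubeRootWeight h0.le h1
  have hs2 := cubeRootWeight_le h0 h1
  set s := cubeRootWeight δ with hs
  have hδ : 0 < δ⁻¹ := inv_pos.2 h0
  -- Boundedness of the weight for `δ > 0` makes every integral below finite, so the absorption at
  -- the end is legitimate.
  have hτL : MemLp (fun x => σ' x * s (σ' x)) 2 γ := by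
    refine (h.memLp'.const_mul δ⁻¹).mono (by fun_prop) (ae_of_all _ fun x => ?_)
    rw [norm_mul, norm_mul, mul_comm, Real.norm_of_nonneg hδ.le,
      Real.norm_of_nonneg (zero_le_one.trans (hs1 _))]
    exact mul_le_mul_of_nonneg_right (hs2 _) (norm_nonneg _)
  have hσqL : MemLp (fun x => σ x * (s (σ' x) * (1 + 2 / 3 * q (σ' x)))) 2 γ := by
    refine (h.memLp.const_mul (2 * δ⁻¹)).mono (by fun_prop) (ae_of_all _ fun x => ?_)
    have e1 : 0 ≤ s (σ' x) := zero_le_one.trans (hs1 _)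
    have e2 := hq0 (σ' x)
    rw [norm_mul (σ x), norm_mul (2 * δ⁻¹), mul_comm,
      Real.norm_of_nonneg (by positivity : 0 ≤ 2 * δ⁻¹), Real.norm_of_nonneg (by positivity)]
    refine mul_le_mul_of_nonneg_right ?_ (norm_nonneg _)
    nlinarith [hs2 (σ' x), hq1 (σ' x)]
  have hxσ : MemLp (fun x => x * σ x) 2 γ := by
    rw [memLp_two_iff_integrable_sq (by fun_prop)]
    refine ((integrable_id_pow 4).add h.integrable_four).mono' (by fun_prop)
      (ae_of_all _ fun x => ?_)
    rw [Real.norm_of_nonneg (sq_nonneg _)]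
    simp only [Pi.add_apply]
    nlinarith [sq_nonneg (x ^ 2 - σ x ^ 2), sq_nonneg (x ^ 2), sq_nonneg (σ x ^ 2)]
  have i1 : Integrable (fun x => σ x * (σ' x * s (σ' x))) γ := h.memLp.integrable_mul (q := 2) hτL
  have i2 : Integrable (fun x => x * (σ x * (σ' x * s (σ' x)))) γ := by
    have : Integrable (fun x => x * σ x * (σ' x * s (σ' x))) γ := hxσ.integrable_mul (q := 2) hτL
    simpa only [mul_assoc] using this
  have i3 : Integrable (fun x => σ' x ^ 2 * s (σ' x)) γ := by
    have : Integrable (fun x => σ' x * (σ' x * s (σ' x))) γ := h.memLp'.integrable_mul (q := 2) hτL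
    simpa only [← mul_assoc, ← sq] using this
  have i4 : Integrable (fun x => σ x * (s (σ' x) * (1 + 2 / 3 * q (σ' x))) * σ'' x) γ :=
    hσqL.integrable_mul (q := 2) h.memLp''
  have ibp := gaussian_integral_mul_self (h := fun x => σ x * (σ' x * s (σ' x)))
    (h' := fun x => σ' x ^ 2 * s (σ' x) + σ x * (s (σ' x) * (1 + 2 / 3 * q (σ' x))) * σ'' x)
    (fun x => by
      have d := (hasDerivAt_mul_cubeRootWeight h0.le (σ' x)).comp x (h.hasDerivAt' x)
      refine ((h.hasDerivAt x).mul d).congr_deriv ?_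
      simp only [Function.comp_apply, ← hs]
      ring) i1 i2 (i3.add i4)
  rw [integral_add i3 i4] at ibp
  have b4 := fun x => cubeRootWeight_pow_four_le h0.le h1 (σ' x)
  rw [← hs] at b4
  have j1 : Integrable (fun x => 3 / 8 * (σ' x ^ 2 * s (σ' x)) + 2 * σ x ^ 4) γ :=
    (i3.const_mul _).add (h.integrable_four.const_mul _)
  have j2 : Integrable (fun x => 3 / 8 * (σ' x ^ 2 * s (σ' x)) + 2 * σ x ^ 4 + x ^ 8 / 16) γ :=
    j1.add ((integrable_id_pow 8).div_const _)
  have j3 : Integrable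
      (fun x => 3 / 8 * (σ' x ^ 2 * s (σ' x)) + 2 * σ x ^ 4 + x ^ 8 / 16 + 1 / 8) γ :=
    j2.add (integrable_const _)
  have k1 : Integrable (fun x => 1 / 4 * (σ' x ^ 2 * s (σ' x)) + 2 * σ x ^ 4) γ :=
    (i3.const_mul _).add (h.integrable_four.const_mul _)
  have k2 : Integrable (fun x => 1 / 4 * (σ' x ^ 2 * s (σ' x)) + 2 * σ x ^ 4 + σ'' x ^ 2) γ :=
    k1.add h.memLp''.integrable_sq
  have k3 : Integrable
      (fun x => 1 / 4 * (σ' x ^ 2 * s (σ' x)) + 2 * σ x ^ 4 + σ'' x ^ 2 + 1 / 4) γ :=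
    k2.add (integrable_const _)
  have A1 := norm_integral_le_of_norm_le (f := fun x => x * (σ x * (σ' x * s (σ' x)))) j3
    (ae_of_all _ fun x => by
      rw [Real.norm_eq_abs]
      exact abs_mul_mul_mul_le (hs1 _) (b4 x))
  have A2 := norm_integral_le_of_norm_le
    (f := fun x => σ x * (s (σ' x) * (1 + 2 / 3 * q (σ' x))) * σ'' x) k3
    (ae_of_all _ fun x => by
      rw [Real.norm_eq_abs]
      exact abs_mul_weight_mul_le (b4 x) (hq0 _) (hq1 _))
  rw [Real.norm_eq_abs] at A1 A2
  rw [integral_add j2 (integrable_const _), integral_add j1 ((integrable_id_pow 8).div_const _),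
    integral_add (i3.const_mul _) (h.integrable_four.const_mul _), integral_div,
    integral_const_mul, integral_const_mul] at A1
  rw [integral_add k2 (integrable_const _), integral_add k1 h.memLp''.integrable_sq,
    integral_add (i3.const_mul _) (h.integrable_four.const_mul _),
    integral_const_mul, integral_const_mul] at A2
  simp only [integral_const, probReal_univ, smul_eq_mul, one_mul] at A1 A2
  refine ⟨i3, ?_⟩
  have := integral_id_pow_eight_le
  have := h.integral_four
  have := h.integral''
  have := le_abs_self (∫ x, x * (σ x * (σ' x * s (σ' x))) ∂γ)
  have := neg_abs_le (∫ x, σ x * (s (σ' x) * (1 + 2 / 3 * q (σ' x))) * σ'' x ∂γ)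
  linarith

theorem tendsto_cubeRootWeight (t : ℝ) :
    Filter.Tendsto (fun n : ℕ => cubeRootWeight (1 / ((n : ℝ) + 1)) t) Filter.atTop
      (nhds (cubeRootWeight 0 t)) := by
  have hc : ContinuousAt (fun δ => cubeRootWeight δ t) 0 := by
    unfold cubeRootWeight
    refine ContinuousAt.rpow_const (ContinuousAt.div (by fun_prop) (by fun_prop) (by simp)) ?_
    right; norm_num
  exact hc.tendsto.comp tendsto_one_div_add_atTop_nhds_zero_nat

/-- Fatou along `δ = 1/(n+1)`. At `δ = 0` the integrand grows like `|σ'|^{8/3}`. -/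
theorem Activation.integral_sq_mul_cubeRootWeight_zero_le (h : Activation σ σ' σ'' B) :
    Integrable (fun x => σ' x ^ 2 * cubeRootWeight 0 (σ' x)) γ ∧
      ∫ x, σ' x ^ 2 * cubeRootWeight 0 (σ' x) ∂γ ≤ 7000 * B := by
  have hB := h.one_le
  have hm' := h.continuous'.measurable
  have hm : ∀ δ, Measurable fun x => σ' x ^ 2 * cubeRootWeight δ (σ' x) := fun δ => by
    have := measurable_cubeRootWeight δ
    fun_prop
  have h0 : ∀ n : ℕ, 0 < 1 / ((n : ℝ) + 1) := fun n => by positivity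
  have h1 : ∀ n : ℕ, 1 / ((n : ℝ) + 1) ≤ 1 := fun n => by
    rw [div_le_one (by positivity)]; linarith [n.cast_nonneg (α := ℝ)]
  have hnn : ∀ δ, 0 ≤ δ → δ ≤ 1 → ∀ x, 0 ≤ σ' x ^ 2 * cubeRootWeight δ (σ' x) :=
    fun δ hδ hδ1 x => mul_nonneg (sq_nonneg _) (zero_le_one.trans (one_le_cubeRootWeight hδ hδ1 _))
  have hF : ∫⁻ x, ENNReal.ofReal (σ' x ^ 2 * cubeRootWeight 0 (σ' x)) ∂γ ≤
      ENNReal.ofReal (7000 * B) := by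
    have hlim : ∀ x, Filter.liminf (fun n : ℕ =>
        ENNReal.ofReal (σ' x ^ 2 * cubeRootWeight (1 / ((n : ℝ) + 1)) (σ' x))) Filter.atTop =
        ENNReal.ofReal (σ' x ^ 2 * cubeRootWeight 0 (σ' x)) := fun x =>
      ((ENNReal.continuous_ofReal.tendsto _).comp
        ((tendsto_cubeRootWeight (σ' x)).const_mul (σ' x ^ 2))).liminf_eq
    calc ∫⁻ x, ENNReal.ofReal (σ' x ^ 2 * cubeRootWeight 0 (σ' x)) ∂γ
        = ∫⁻ x, Filter.liminf (fun n : ℕ =>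
          ENNReal.ofReal (σ' x ^ 2 * cubeRootWeight (1 / ((n : ℝ) + 1)) (σ' x))) Filter.atTop ∂γ := by
          simp only [hlim]
      _ ≤ Filter.liminf (fun n : ℕ => ∫⁻ x,
          ENNReal.ofReal (σ' x ^ 2 * cubeRootWeight (1 / ((n : ℝ) + 1)) (σ' x)) ∂γ)
          Filter.atTop := lintegral_liminf_le fun n => (hm _).ennreal_ofReal
      _ ≤ ENNReal.ofReal (7000 * B) := by
          refine Filter.liminf_le_of_le (by isBoundedDefault) fun c hc => ?_
          obtain ⟨n, hn⟩ := hc.exists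
          refine hn.trans ?_
          obtain ⟨i, hi⟩ := h.integral_sq_mul_cubeRootWeight_le (h0 n) (h1 n)
          rw [← ofReal_integral_eq_lintegral_ofReal i (ae_of_all _ (hnn _ (h0 n).le (h1 n)))]
          exact ENNReal.ofReal_le_ofReal hi
  have hnn0 := hnn 0 le_rfl zero_le_one
  have hi : Integrable (fun x => σ' x ^ 2 * cubeRootWeight 0 (σ' x)) γ :=
    (lintegral_ofReal_ne_top_iff_integrable (hm 0).aestronglyMeasurable
      (ae_of_all _ hnn0)).1 (hF.trans_lt ENNReal.ofReal_lt_top).ne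
  refine ⟨hi, ?_⟩
  rw [← ofReal_integral_eq_lintegral_ofReal hi (ae_of_all _ hnn0)] at hF
  exact (ENNReal.ofReal_le_ofReal_iff (by linarith)).1 hF

/-- The cube of the chosen witness is `8 B³ (1 + σ'²)`, which dominates the square of the centred
`σ'` because the squared mean of `σ'` is at most `B`. The constant covers `16 B⁴ · 14002 B`. -/
theorem Activation.momentPair (h : Activation σ σ' σ'' B) {k : ℝ → ℝ} (hk : Measurable k)
    (hki : Integrable (fun x => k x ^ 4) γ) (hk4 : ∫ x, k x ^ 4 ∂γ ≤ 600 * B) :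
    MomentPair (fun x => σ' x - ∫ y, σ' y ∂γ) (fun x => 2 * B * cubeRootWeight 0 (σ' x)) k
      (300000 * B ^ 5) := by
  have hB := h.one_le
  have hB5 : B ≤ B ^ 5 := le_self_pow₀ hB (by norm_num)
  have hB4 : B ^ 4 ≤ B ^ 5 := pow_le_pow_right₀ hB (by norm_num)
  have hs1 := fun x => one_le_cubeRootWeight le_rfl zero_le_one (σ' x)
  have b4 := fun x => cubeRootWeight_pow_four_le le_rfl zero_le_one (σ' x)
  obtain ⟨i, hi⟩ := h.integral_sq_mul_cubeRootWeight_zero_le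
  have hm := measurable_cubeRootWeight 0
  have hm' := h.continuous'.measurable
  have ib : Integrable (fun x => 2 + 2 * (σ' x ^ 2 * cubeRootWeight 0 (σ' x))) γ :=
    (integrable_const _).add (i.const_mul _)
  have i4 : Integrable (fun x => cubeRootWeight 0 (σ' x) ^ 4) γ :=
    ib.mono' ((hm.comp hm').pow_const 4).aestronglyMeasurable (ae_of_all _ fun x => by
      rw [Real.norm_of_nonneg (by positivity)]; exact b4 x)
  have hi4 := integral_mono i4 ib b4
  rw [integral_add (integrable_const _) (i.const_mul _), integral_const_mul] at hi4
  simp only [integral_const, probReal_univ, smul_eq_mul, one_mul] at hi4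
  have hmean : (∫ y, σ' y ∂γ) ^ 2 ≤ B := by
    have h1 := integral_mul_sq_le h.memLp' (memLp_const (1 : ℝ))
    simp only [mul_one, one_pow, integral_const, probReal_univ, smul_eq_mul] at h1
    exact h1.trans h.integral'
  refine ⟨by nlinarith, by fun_prop, ?_, fun x => ?_, fun x => ?_, ?_, ?_, hk, hki, by linarith⟩
  · rw [integral_sub (h.memLp'.integrable one_le_two) (integrable_const _)]
    simp
  · have := hs1 x
    positivity
  · have e := cubeRootWeight_pow_three le_rfl (σ' x)
    rw [zero_mul, add_zero, div_one] at e
    rw [mul_pow, e]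
    have e2 : 2 * B ≤ (2 * B) ^ 3 := le_self_pow₀ (by linarith) (by norm_num)
    have e3 : (σ' x - ∫ y, σ' y ∂γ) ^ 2 ≤ 2 * B * (1 + σ' x ^ 2) := by
      nlinarith [sq_nonneg (σ' x + ∫ y, σ' y ∂γ), sq_nonneg (σ' x)]
    exact e3.trans (mul_le_mul_of_nonneg_right e2 (by positivity))
  · simp only [mul_pow]
    exact i4.const_mul _
  · simp only [mul_pow]
    rw [integral_const_mul]
    have : (2 : ℝ) ^ 4 * B ^ 4 * ∫ x, cubeRootWeight 0 (σ' x) ^ 4 ∂γ ≤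
        2 ^ 4 * B ^ 4 * (14002 * B) := by
      gcongr
      linarith
    nlinarith

end

end

section

/-! ### Quadratic forms in functions of Gaussian coordinates -/

section

variable {E : Type*} [NormedAddCommGroup E] [InnerProductSpace ℝ E] {ι : Type*} [Fintype ι]

/-- Expanding the square, correlations of the form `⟪a i, a j⟫ g` assemble into `g ‖∑ θ_i a_i‖²`,
while their errors are summed in absolute value. This is the origin of the Hadamard products with
`ρ` in `M₁` and `M₂`. -/
theorem integral_mul_add_sum_sq_le {α : Type*} [MeasurableSpace α] {ν : Measure α} {k : α → ℝ}
    {Z : ι → α → ℝ} (hk : Measurable k) (hk0 : ∀ x, 0 ≤ k x) (hki : Integrable k ν)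
    (hZ : ∀ i, Measurable (Z i)) (hZi : ∀ i j, Integrable (fun x => k x * Z i x * Z j x) ν)
    {g : ℝ} {ε : ι → ι → ℝ} {a : ι → E}
    (hε : ∀ i j, |∫ x, k x * Z i x * Z j x ∂ν - ⟪a i, a j⟫ * g| ≤ ε i j) (d : ℝ) (θ : ι → ℝ) :
    Integrable (fun x => k x * (d + ∑ i, θ i * Z i x) ^ 2) ν ∧
    ∫ x, k x * (d + ∑ i, θ i * Z i x) ^ 2 ∂ν ≤
      2 * d ^ 2 * (∫ x, k x ∂ν) +
        2 * (g * ‖∑ i, θ i • a i‖ ^ 2 + ∑ i, ∑ j, |θ i| * |θ j| * ε i j) := by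
  have e1 : ∀ x, k x * (∑ i, θ i * Z i x) ^ 2 =
      ∑ i, ∑ j, θ i * θ j * (k x * Z i x * Z j x) := fun x => by
    rw [sq, Finset.sum_mul_sum, Finset.mul_sum]
    refine Finset.sum_congr rfl fun i _ => ?_
    rw [Finset.mul_sum]
    exact Finset.sum_congr rfl fun j _ => by ring
  have i1 : Integrable (fun x => k x * (∑ i, θ i * Z i x) ^ 2) ν := by
    simp only [e1]
    exact integrable_finsetSum _ fun i _ => integrable_finsetSum _ fun j _ => (hZi i j).const_mul _
  have hb : ∀ x, k x * (d + ∑ i, θ i * Z i x) ^ 2 ≤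
      2 * d ^ 2 * k x + 2 * (k x * (∑ i, θ i * Z i x) ^ 2) := fun x => by
    nlinarith [mul_nonneg (hk0 x) (sq_nonneg (d - ∑ i, θ i * Z i x))]
  have i2 : Integrable (fun x => 2 * d ^ 2 * k x + 2 * (k x * (∑ i, θ i * Z i x) ^ 2)) ν :=
    (hki.const_mul _).add (i1.const_mul _)
  have i3 : Integrable (fun x => k x * (d + ∑ i, θ i * Z i x) ^ 2) ν :=
    i2.mono' (by fun_prop) (ae_of_all _ fun x => by
      rw [Real.norm_of_nonneg (mul_nonneg (hk0 x) (sq_nonneg _))]; exact hb x)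
  refine ⟨i3, (integral_mono i3 i2 hb).trans ?_⟩
  rw [integral_add (hki.const_mul _) (i1.const_mul _), integral_const_mul, integral_const_mul]
  refine add_le_add_right (mul_le_mul_of_nonneg_left ?_ zero_le_two) _
  simp only [e1]
  rw [integral_finsetSum _ fun i _ => integrable_finsetSum _ fun j _ => (hZi i j).const_mul _]
  have e2 : g * ‖∑ i, θ i • a i‖ ^ 2 = ∑ i, ∑ j, θ i * θ j * (⟪a i, a j⟫ * g) := by
    rw [← real_inner_self_eq_norm_sq, sum_inner, Finset.mul_sum]
    refine Finset.sum_congr rfl fun i _ => ?_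
    rw [inner_sum, Finset.mul_sum]
    refine Finset.sum_congr rfl fun j _ => ?_
    rw [inner_smul_left, inner_smul_right]
    simp only [conj_trivial]; ring
  rw [e2, ← Finset.sum_add_distrib]
  refine Finset.sum_le_sum fun i _ => ?_
  rw [integral_finsetSum _ fun j _ => (hZi i j).const_mul _, ← Finset.sum_add_distrib]
  refine Finset.sum_le_sum fun j _ => ?_
  rw [integral_const_mul]
  have h1 : θ i * θ j * (∫ x, k x * Z i x * Z j x ∂ν - ⟪a i, a j⟫ * g) ≤
      |θ i| * |θ j| * ε i j := by
    refine (le_abs_self _).trans ?_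
    rw [abs_mul, abs_mul]
    exact mul_le_mul_of_nonneg_left (hε i j) (by positivity)
  linarith

variable [FiniteDimensional ℝ E] [MeasurableSpace E] [BorelSpace E]

theorem MomentPair.integral_mul_add_sum_sq_le {φ w k : ℝ → ℝ} {Λ : ℝ} (h : MomentPair φ w k Λ)
    (hk0 : ∀ x, 0 ≤ k x) {a : ι → E} (ha : ∀ i, ‖a i‖ = 1) {e : E} (he : ‖e‖ = 1) (d : ℝ)
    (θ : ι → ℝ) :
    Integrable (fun c => k ⟪e, c⟫ * (d + ∑ i, θ i * φ ⟪a i, c⟫) ^ 2) (stdGaussian E) ∧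
    ∫ c, k ⟪e, c⟫ * (d + ∑ i, θ i * φ ⟪a i, c⟫) ^ 2 ∂(stdGaussian E) ≤
      Λ * (2 * d ^ 2 + 2 * ((∫ x, x * φ x ∂γ) ^ 2 * ‖∑ i, θ i • a i‖ ^ 2)) +
        240000 * Λ ^ 3 * ∑ i, ∑ j, |θ i| * |θ j| *
          (⟪a i, e⟫ ^ 2 + ⟪a j, e⟫ ^ 2 + ⟪a i, a j⟫ ^ 2) := by
  have hkm := h.measurable_weight
  have hφm := h.measurable
  have hki := integrable_comp_inner he (h.memLp_weight.1.integrable one_le_two)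
  obtain ⟨h1, h2⟩ := GaussianEquivalence.integral_mul_add_sum_sq_le (ν := stdGaussian E)
    (k := fun c => k ⟪e, c⟫) (Z := fun i c => φ ⟪a i, c⟫)
    (g := (∫ x, x * φ x ∂γ) ^ 2 * ∫ x, k x ∂γ) (a := a)
    (ε := fun i j => 120000 * Λ ^ 3 * (⟪a i, e⟫ ^ 2 + ⟪a j, e⟫ ^ 2 + ⟪a i, a j⟫ ^ 2))
    (by fun_prop) (fun c => hk0 _) hki (fun i => by fun_prop)
    (fun i j => (h.integrable_triple (ha i) (ha j) he).1)
    (fun i j => by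
      rw [← mul_assoc]
      exact h.abs_integral_triple_sub_le (ha i) (ha j) he) d θ
  refine ⟨h1, h2.trans ?_⟩
  have e1 : ∫ c, k ⟪e, c⟫ ∂(stdGaussian E) = ∫ x, k x ∂γ := integral_comp_inner he hkm.aestronglyMeasurable
  have hk1 := (le_abs_self _).trans h.abs_integral_weight_le
  have e2 : ∑ i, ∑ j, |θ i| * |θ j| *
      (120000 * Λ ^ 3 * (⟪a i, e⟫ ^ 2 + ⟪a j, e⟫ ^ 2 + ⟪a i, a j⟫ ^ 2)) =
      120000 * Λ ^ 3 * ∑ i, ∑ j, |θ i| * |θ j| *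
          (⟪a i, e⟫ ^ 2 + ⟪a j, e⟫ ^ 2 + ⟪a i, a j⟫ ^ 2) := by
    simp only [Finset.mul_sum]
    exact Finset.sum_congr rfl fun i _ => Finset.sum_congr rfl fun j _ => by ring
  rw [e1, e2]
  have f1 := mul_le_mul_of_nonneg_left hk1 (by positivity : 0 ≤ 2 * d ^ 2)
  have f2 := mul_le_mul_of_nonneg_left hk1
    (by positivity : 0 ≤ 2 * ((∫ x, x * φ x ∂γ) ^ 2 * ‖∑ i, θ i • a i‖ ^ 2))
  linarith

theorem integral_add_sum_sq_le {φ : ℝ → ℝ} (hφm : Measurable φ) (hφ : MemLp φ 2 γ)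
    (hφ0 : ∫ x, φ x ∂γ = 0) {a : ι → E} (ha : ∀ i, ‖a i‖ = 1) (d : ℝ) (θ : ι → ℝ) :
    ∫ c, (d + ∑ i, θ i * φ ⟪a i, c⟫) ^ 2 ∂(stdGaussian E) ≤
      2 * d ^ 2 + 2 * ((∫ x, x * φ x ∂γ) ^ 2 * ‖∑ i, θ i • a i‖ ^ 2) +
        256 * (∫ x, φ x ^ 2 ∂γ) * ∑ i, ∑ j, |θ i| * |θ j| * ⟪a i, a j⟫ ^ 2 := by
  obtain ⟨-, h2⟩ := GaussianEquivalence.integral_mul_add_sum_sq_le (ν := stdGaussian E)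
    (k := fun c => 1) (Z := fun i c => φ ⟪a i, c⟫)
    (g := (∫ x, x * φ x ∂γ) ^ 2) (a := a)
    (ε := fun i j => 128 * ⟪a i, a j⟫ ^ 2 * ∫ x, φ x ^ 2 ∂γ)
    measurable_const (fun c => zero_le_one) (integrable_const _) (fun i => by fun_prop)
    (fun i j => by
      simp only [one_mul]
      exact (memLp_comp_inner (ha i) hφ).integrable_mul (q := 2) (memLp_comp_inner (ha j) hφ))
    (fun i j => by
      simp only [one_mul]
      exact abs_integral_comp_inner_mul_sub_le (ha i) (ha j) hφ hφ0) d θ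
  simp only [one_mul, integral_const, probReal_univ, smul_eq_mul, mul_one] at h2
  refine h2.trans (le_of_eq ?_)
  have e2 : ∑ i, ∑ j, |θ i| * |θ j| * (128 * ⟪a i, a j⟫ ^ 2 * ∫ x, φ x ^ 2 ∂γ) =
      128 * (∫ x, φ x ^ 2 ∂γ) * ∑ i, ∑ j, |θ i| * |θ j| * ⟪a i, a j⟫ ^ 2 := by
    simp only [Finset.mul_sum]
    exact Finset.sum_congr rfl fun i _ => Finset.sum_congr rfl fun j _ => by ring
  rw [e2]; ring

end

/-! ### Sums of products of matrix entries -/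

section

variable {ι : Type*} [Fintype ι] (t : ι → ι → ℝ)

theorem sum_abs_mul_abs_mul_sq_le : ∑ n, ∑ i, ∑ j, |t i n| * |t j n| * t i j ^ 2 ≤
    Fintype.card ι * ∑ i, ∑ j, t i j ^ 4 := by
  have hb : ∀ n i j, |t i n| * |t j n| * t i j ^ 2 ≤
      1 / 4 * t i n ^ 4 + 1 / 4 * t j n ^ 4 + 1 / 2 * t i j ^ 4 := fun n i j => by
    have h1 : t i n ^ 4 = (|t i n| ^ 2) ^ 2 := by rw [sq_abs]; ring
    have h2 : t j n ^ 4 = (|t j n| ^ 2) ^ 2 := by rw [sq_abs]; ring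
    have h3 : (|t i n| * |t j n|) ^ 2 ≤ 1 / 2 * (|t i n| ^ 2) ^ 2 + 1 / 2 * (|t j n| ^ 2) ^ 2 := by
      linarith [sq_nonneg (|t i n| ^ 2 - |t j n| ^ 2)]
    rw [h1, h2]
    linarith [sq_nonneg (|t i n| * |t j n| - t i j ^ 2)]
  refine (Finset.sum_le_sum fun n _ => Finset.sum_le_sum fun i _ => Finset.sum_le_sum fun j _ =>
    hb n i j).trans (le_of_eq ?_)
  simp only [Finset.sum_add_distrib, ← Finset.mul_sum, Finset.sum_const, Finset.card_univ,
    nsmul_eq_mul]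
  rw [Finset.sum_comm (f := fun n i => t i n ^ 4)]
  ring

/-- Apply `t² ≤ N t⁴ + 1/N` to each of the `N²` entries. -/
theorem sum_sq_le_card_mul : ∑ n, ∑ i, t i n ^ 2 ≤
    Fintype.card ι * (1 + ∑ i, ∑ j, t i j ^ 4) := by
  rcases isEmpty_or_nonempty ι with he | he
  · simp
  have hN : (0 : ℝ) < Fintype.card ι := by exact_mod_cast Fintype.card_pos
  have hb : ∀ n i, t i n ^ 2 ≤ Fintype.card ι * t i n ^ 4 + (Fintype.card ι : ℝ)⁻¹ := fun n i => by
    set N : ℝ := (Fintype.card ι : ℝ)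
    have h1 : 0 ≤ N⁻¹ * (N * t i n ^ 2 - 1) ^ 2 := by positivity
    have h2 : N⁻¹ * (N * t i n ^ 2 - 1) ^ 2 = N * t i n ^ 4 - 2 * t i n ^ 2 + N⁻¹ := by
      field_simp; ring
    linarith [sq_nonneg (t i n)]
  refine (Finset.sum_le_sum fun n _ => Finset.sum_le_sum fun i _ => hb n i).trans (le_of_eq ?_)
  simp only [Finset.sum_add_distrib, ← Finset.mul_sum, Finset.sum_const, Finset.card_univ,
    nsmul_eq_mul]
  rw [Finset.sum_comm (f := fun n i => t i n ^ 4)]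
  field_simp
  ring

theorem sum_abs_mul_abs_mul_sq_left_le : ∑ n, ∑ i, ∑ j, |t i n| * |t j n| * t i n ^ 2 ≤
    Fintype.card ι * ∑ i, ∑ j, t i j ^ 4 := by
  have hb : ∀ n i j, |t i n| * |t j n| * t i n ^ 2 ≤
      1 / 4 * t j n ^ 4 + 3 / 4 * t i n ^ 4 := fun n i j => by
    have h := mul_pow_three_le (abs_nonneg (t j n)) (abs_nonneg (t i n))
    have h1 : ∀ x : ℝ, |x| ^ 4 = x ^ 4 := fun x => by rw [← abs_pow, abs_of_nonneg (by positivity)]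
    rw [h1, h1] at h
    rw [← sq_abs (t i n)]
    linarith
  refine (Finset.sum_le_sum fun n _ => Finset.sum_le_sum fun i _ => Finset.sum_le_sum fun j _ =>
    hb n i j).trans (le_of_eq ?_)
  simp only [Finset.sum_add_distrib, ← Finset.mul_sum, Finset.sum_const, Finset.card_univ,
    nsmul_eq_mul]
  rw [Finset.sum_comm (f := fun n i => t i n ^ 4)]
  ring

/-- Cauchy–Schwarz in `n` for fixed `i, j`. The bound is free of the number of indices, which the
`M₂` remainder requires. -/
theorem sum_sq_mul_sq_mul_sq_le : ∑ n, ∑ i, ∑ j, t i n ^ 2 * t j n ^ 2 * t i j ^ 2 ≤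
    (∑ i, ∑ j, t i j ^ 4) + (∑ i, ∑ j, t i j ^ 4) ^ 2 := by
  have e1 : ∑ n, ∑ i, ∑ j, t i n ^ 2 * t j n ^ 2 * t i j ^ 2 =
      ∑ i, ∑ j, t i j ^ 2 * ∑ n, t i n ^ 2 * t j n ^ 2 := by
    rw [Finset.sum_comm]
    refine Finset.sum_congr rfl fun i _ => ?_
    rw [Finset.sum_comm]
    refine Finset.sum_congr rfl fun j _ => ?_
    rw [Finset.mul_sum]
    exact Finset.sum_congr rfl fun n _ => by ring
  have hb : ∀ i j, t i j ^ 2 * ∑ n, t i n ^ 2 * t j n ^ 2 ≤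
      t i j ^ 4 + (∑ n, t i n ^ 4) * ∑ n, t j n ^ 4 := fun i j => by
    have h := Finset.sum_mul_sq_le_sq_mul_sq Finset.univ (fun n => t i n ^ 2) fun n => t j n ^ 2
    simp only [← pow_mul] at h
    norm_num at h
    set X := ∑ n, t i n ^ 2 * t j n ^ 2
    linarith [sq_nonneg (t i j ^ 2 - X), sq_nonneg (t i j ^ 2), sq_nonneg X]
  rw [e1]
  refine (Finset.sum_le_sum fun i _ => Finset.sum_le_sum fun j _ => hb i j).trans (le_of_eq ?_)
  simp only [Finset.sum_add_distrib]
  rw [← Finset.sum_mul_sum, sq]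

end

end

/-! ### The Stein error in terms of the Gram matrix -/

section

section

variable {E : Type*} [NormedAddCommGroup E] [InnerProductSpace ℝ E] {ι : Type*} [Fintype ι]
  [DecidableEq ι]

/-- The Gram matrix with its diagonal replaced by `0`. -/
def offDiagGram (a : ι → E) (i n : ι) : ℝ := if i = n then 0 else ⟪a i, a n⟫

theorem sum_erase_offDiagGram (a : ι → E) (n : ι) (f : ι → ℝ) :
    ∑ i ∈ Finset.univ.erase n, f i * ⟪a i, a n⟫ = ∑ i, f i * offDiagGram a i n := by
  rw [← Finset.sum_erase Finset.univ (a := n) (by simp [offDiagGram])]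
  refine Finset.sum_congr rfl fun i hi => ?_
  rw [offDiagGram, if_neg (Finset.ne_of_mem_erase hi)]

/-- Splits `σ'` into a constant and a remainder. With `s` the mean of `σ'`, the constant part is
deterministic and the rest is a combination of centred functions, as the quadratic-form estimates
require. -/
theorem modelDeriv_erase_eq (σ' : ℝ → ℝ) (a : ι → E) (v : ι → ℝ) (b : E) (n : ι) (s : ℝ) (c : E) :
    modelDeriv σ' a v b (Finset.univ.erase n) (a n) c =
      (s * (∑ i, v i * offDiagGram a i n) + ⟪b, a n⟫) +
        ∑ i, v i * offDiagGram a i n * (σ' ⟪a i, c⟫ - s) := by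
  have h : ∑ i ∈ Finset.univ.erase n, v i * ⟪a i, a n⟫ * σ' ⟪a i, c⟫ =
      ∑ i, v i * offDiagGram a i n * σ' ⟪a i, c⟫ := by
    have := sum_erase_offDiagGram a n fun i => v i * σ' ⟪a i, c⟫
    simpa only [mul_right_comm] using this
  rw [modelDeriv, h]
  simp only [mul_sub, Finset.sum_sub_distrib, ← Finset.sum_mul]
  ring

theorem modelDeriv2_erase_eq (σ'' : ℝ → ℝ) (a : ι → E) (v : ι → ℝ) (n : ι) (s : ℝ) (c : E) :
    modelDeriv2 σ'' a v (Finset.univ.erase n) (a n) c =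
      s * (∑ i, v i * offDiagGram a i n ^ 2) +
        ∑ i, v i * offDiagGram a i n ^ 2 * (σ'' ⟪a i, c⟫ - s) := by
  have h : ∑ i ∈ Finset.univ.erase n, v i * ⟪a i, a n⟫ ^ 2 * σ'' ⟪a i, c⟫ =
      ∑ i, v i * offDiagGram a i n ^ 2 * σ'' ⟪a i, c⟫ := by
    rw [← Finset.sum_erase Finset.univ (a := n) (by simp [offDiagGram])]
    refine Finset.sum_congr rfl fun i hi => ?_
    rw [offDiagGram, if_neg (Finset.ne_of_mem_erase hi)]
  rw [modelDeriv2, h]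
  simp only [mul_sub, Finset.sum_sub_distrib, ← Finset.sum_mul]
  ring

theorem inner_sq_eq_offDiagGram {ι : Type*} [DecidableEq ι] {a : ι → E} (ha : ∀ i, ‖a i‖ = 1) (i j : ι) :
    ⟪a i, a j⟫ ^ 2 = offDiagGram a i j ^ 2 + if i = j then 1 else 0 := by
  by_cases h : i = j
  · subst h; simp [offDiagGram, ha]
  · simp [offDiagGram, h]

variable {v : ι → ℝ} {κ : ℝ}

/-- The diagonal `i = j`, where the correlation is `1`, must be separated: it contributes `∑ t_in²`,
the source of the `1` in `1 + ∑ t⁴`. -/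
theorem sum_error_weighted_le {a : ι → E} (ha : ∀ i, ‖a i‖ = 1) (hκ : 0 ≤ κ)
    (hv : ∀ n, |v n| ≤ κ) :
    ∑ n, ∑ i, ∑ j, |v i * offDiagGram a i n| * |v j * offDiagGram a j n| *
      (⟪a i, a n⟫ ^ 2 + ⟪a j, a n⟫ ^ 2 + ⟪a i, a j⟫ ^ 2) ≤
      4 * (Fintype.card ι * κ ^ 2 * (1 + ∑ i, ∑ j, offDiagGram a i j ^ 4)) := by
  set t := offDiagGram a with ht
  have hb : ∀ n i j, |v i * t i n| * |v j * t j n| *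
      (⟪a i, a n⟫ ^ 2 + ⟪a j, a n⟫ ^ 2 + ⟪a i, a j⟫ ^ 2) ≤
      κ ^ 2 * (|t i n| * |t j n| * t i n ^ 2 + |t i n| * |t j n| * t j n ^ 2 +
        |t i n| * |t j n| * t i j ^ 2 + if i = j then t i n ^ 2 else 0) := by
    intro n i j
    have h1 : |v i * t i n| * |v j * t j n| ≤ κ ^ 2 * (|t i n| * |t j n|) := by
      rw [abs_mul, abs_mul]
      have := mul_le_mul (hv i) (hv j) (abs_nonneg _) hκ
      nlinarith [mul_nonneg (abs_nonneg (t i n)) (abs_nonneg (t j n))]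
    have h2 : |t i n| * |t j n| * (⟪a i, a n⟫ ^ 2 + ⟪a j, a n⟫ ^ 2 + ⟪a i, a j⟫ ^ 2) =
        |t i n| * |t j n| * t i n ^ 2 + |t i n| * |t j n| * t j n ^ 2 +
        |t i n| * |t j n| * t i j ^ 2 + if i = j then t i n ^ 2 else 0 := by
      rw [inner_sq_eq_offDiagGram ha i j, ← ht]
      by_cases hi : i = n
      · have : t i n = 0 := by simp [ht, offDiagGram, hi]
        simp [this]
      by_cases hj : j = n
      · have : t j n = 0 := by simp [ht, offDiagGram, hj]
        have h3 : i ≠ j := fun h => hi (h.trans hj)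
        simp [this, h3]
      rw [inner_sq_eq_offDiagGram ha i n, inner_sq_eq_offDiagGram ha j n, if_neg hi, if_neg hj, ← ht]
      by_cases hij : i = j
      · subst hij
        simp only [if_true]
        have : |t i n| * |t i n| = t i n ^ 2 := by rw [← sq, sq_abs]
        rw [this]; ring
      · simp only [if_neg hij]; ring
    rw [← h2]
    refine (mul_le_mul_of_nonneg_right h1 (by positivity)).trans (le_of_eq (by ring))
  refine (Finset.sum_le_sum fun n _ => Finset.sum_le_sum fun i _ => Finset.sum_le_sum fun j _ =>
    hb n i j).trans ?_
  simp only [← Finset.mul_sum, Finset.sum_add_distrib, Finset.sum_ite_eq, Finset.mem_univ, if_true]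
  have e1 : ∑ n, ∑ i, ∑ j, |t i n| * |t j n| * t j n ^ 2 =
      ∑ n, ∑ i, ∑ j, |t i n| * |t j n| * t i n ^ 2 := by
    refine Finset.sum_congr rfl fun n _ => ?_
    rw [Finset.sum_comm]
    exact Finset.sum_congr rfl fun i _ => Finset.sum_congr rfl fun j _ => by ring
  have s1 := sum_abs_mul_abs_mul_sq_left_le t
  have s2 := sum_abs_mul_abs_mul_sq_le t
  have s3 := sum_sq_le_card_mul t
  rw [e1]
  set T := ∑ i, ∑ j, t i j ^ 4
  have hN : (0 : ℝ) ≤ Fintype.card ι := Nat.cast_nonneg _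
  have h5 : ∑ n, ∑ i, ∑ j, |t i n| * |t j n| * t i n ^ 2 +
      ∑ n, ∑ i, ∑ j, |t i n| * |t j n| * t i n ^ 2 +
      ∑ n, ∑ i, ∑ j, |t i n| * |t j n| * t i j ^ 2 + ∑ n, ∑ i, t i n ^ 2 ≤
      4 * (Fintype.card ι * (1 + T)) := by linarith
  refine (mul_le_mul_of_nonneg_left h5 (sq_nonneg κ)).trans (le_of_eq (by ring))

theorem sum_error_sq_le {a : ι → E} (ha : ∀ i, ‖a i‖ = 1) (hκ : 0 ≤ κ) (hv : ∀ n, |v n| ≤ κ) :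
    ∑ n, ∑ i, ∑ j, |v i * offDiagGram a i n ^ 2| * |v j * offDiagGram a j n ^ 2| *
      ⟪a i, a j⟫ ^ 2 ≤ κ ^ 2 * (1 + ∑ i, ∑ j, offDiagGram a i j ^ 4) ^ 2 := by
  set t := offDiagGram a with ht
  have hb : ∀ n i j, |v i * t i n ^ 2| * |v j * t j n ^ 2| * ⟪a i, a j⟫ ^ 2 ≤
      κ ^ 2 * (t i n ^ 2 * t j n ^ 2 * t i j ^ 2 + if i = j then t i n ^ 4 else 0) := by
    intro n i j
    have h1 : |v i * t i n ^ 2| * |v j * t j n ^ 2| ≤ κ ^ 2 * (t i n ^ 2 * t j n ^ 2) := by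
      rw [abs_mul, abs_mul, abs_of_nonneg (sq_nonneg (t i n)), abs_of_nonneg (sq_nonneg (t j n))]
      have := mul_le_mul (hv i) (hv j) (abs_nonneg _) hκ
      nlinarith [mul_nonneg (sq_nonneg (t i n)) (sq_nonneg (t j n))]
    refine (mul_le_mul_of_nonneg_right h1 (sq_nonneg _)).trans (le_of_eq ?_)
    rw [inner_sq_eq_offDiagGram ha i j, ← ht]
    by_cases hij : i = j
    · subst hij; simp only [if_true]; ring
    · simp only [if_neg hij]; ring
  refine (Finset.sum_le_sum fun n _ => Finset.sum_le_sum fun i _ => Finset.sum_le_sum fun j _ =>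
    hb n i j).trans ?_
  simp only [← Finset.mul_sum, Finset.sum_add_distrib, Finset.sum_ite_eq, Finset.mem_univ, if_true]
  have s1 := sum_sq_mul_sq_mul_sq_le t
  rw [Finset.sum_comm (f := fun n i => t i n ^ 4)]
  set T := ∑ i, ∑ j, t i j ^ 4
  refine mul_le_mul_of_nonneg_left ?_ (sq_nonneg κ)
  linarith

variable [FiniteDimensional ℝ E] [MeasurableSpace E] [BorelSpace E]
variable {σ σ' σ'' : ℝ → ℝ} {B : ℝ} {a : ι → E} {g g' : ℝ → ℝ}

theorem Activation.integral_mul_id_eq (h : Activation σ σ' σ'' B) :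
    ∫ x, σ x * x ∂γ = ∫ x, σ' x ∂γ := by
  have hx : MemLp (fun x : ℝ => x) 2 γ := by simpa using memLp_id_pow 1 2 (by simp)
  simp only [mul_comm (σ _)]
  exact gaussian_integral_mul_self h.hasDerivAt (h.memLp.integrable one_le_two)
    (hx.integrable_mul (q := 2) h.memLp) (h.memLp'.integrable one_le_two)

/-- The mean of `σ'` produces the `ρ̃²` part of `M₁`, its linear Hermite coefficient the `ρ̃² ∘ ρ`
part, and the quadratic remainders of the triple correlations the fourth powers. -/
theorem Activation.sum_integral_mul_modelDeriv_sq_le (h : Activation σ σ' σ'' B)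
    (ha : ∀ i, ‖a i‖ = 1) (b : E) {w k : ℝ → ℝ} {Λ : ℝ}
    (hm : MomentPair (fun x => σ' x - ∫ y, σ' y ∂γ) w k Λ) (hk0 : ∀ x, 0 ≤ k x)
    {L : ℝ} (hκ : 0 ≤ κ) (hv : ∀ n, |v n| ≤ κ) (hL : Fintype.card ι * κ ^ 2 ≤ L) :
    (∀ n, Integrable (fun c => k ⟪a n, c⟫ *
      modelDeriv σ' a v b (Finset.univ.erase n) (a n) c ^ 2) (stdGaussian E)) ∧
    ∑ n, ∫ c, k ⟪a n, c⟫ * modelDeriv σ' a v b (Finset.univ.erase n) (a n) c ^ 2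
      ∂(stdGaussian E) ≤ 960000 * Λ ^ 3 * (L * (1 + ∑ i, ∑ j, offDiagGram a i j ^ 4) +
        ∑ n, ⟪b, a n⟫ ^ 2 +
        (∫ x, σ x * x ∂γ) ^ 2 * ∑ n, (∑ i, v i * offDiagGram a i n) ^ 2 +
        (∫ x, x * σ' x ∂γ) ^ 2 * ∑ n, ‖∑ i, (v i * offDiagGram a i n) • a i‖ ^ 2) := by
  have hΛ := hm.one_le
  have hx : MemLp (fun x : ℝ => x) 2 γ := by simpa using memLp_id_pow 1 2 (by simp)
  have hxσ' : Integrable (fun x => x * σ' x) γ := hx.integrable_mul (q := 2) h.memLp'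
  have ec : ∫ x, x * (σ' x - ∫ y, σ' y ∂γ) ∂γ = ∫ x, x * σ' x ∂γ := by
    simp only [mul_sub]
    rw [integral_sub hxσ' ((hx.integrable one_le_two).mul_const _), integral_mul_const,
      integral_id_gaussianReal]
    simp
  rw [h.integral_mul_id_eq]
  set s := ∫ x, σ' x ∂γ with hs
  have key := fun n => hm.integral_mul_add_sum_sq_le hk0 ha (ha n)
    (s * (∑ i, v i * offDiagGram a i n) + ⟪b, a n⟫) (fun i => v i * offDiagGram a i n)
  simp only [← modelDeriv_erase_eq, ec] at key
  refine ⟨fun n => (key n).1, ?_⟩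
  refine (Finset.sum_le_sum fun n _ => (key n).2).trans ?_
  have herr := sum_error_weighted_le ha hκ hv
  simp only [Finset.sum_add_distrib, ← Finset.mul_sum]
  set c1 := ∫ x, x * σ' x ∂γ
  set X2 := ∑ n, ‖∑ i, (v i * offDiagGram a i n) • a i‖ ^ 2
  set T := ∑ i, ∑ j, offDiagGram a i j ^ 4 with hT
  have hT0 : 0 ≤ T := Finset.sum_nonneg fun i _ => Finset.sum_nonneg fun j _ => by positivity
  have hX2 : 0 ≤ X2 := Finset.sum_nonneg fun i _ => sq_nonneg _
  have hd : ∑ n, (s * (∑ i, v i * offDiagGram a i n) + ⟪b, a n⟫) ^ 2 ≤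
      2 * (s ^ 2 * ∑ n, (∑ i, v i * offDiagGram a i n) ^ 2 + ∑ n, ⟪b, a n⟫ ^ 2) := by
    rw [Finset.mul_sum, ← Finset.sum_add_distrib, Finset.mul_sum]
    refine Finset.sum_le_sum fun n _ => ?_
    linarith [sq_nonneg (s * (∑ i, v i * offDiagGram a i n) - ⟪b, a n⟫)]
  have hX1 : 0 ≤ ∑ n, (∑ i, v i * offDiagGram a i n) ^ 2 :=
    Finset.sum_nonneg fun i _ => sq_nonneg _
  have hq : 0 ≤ ∑ n, ⟪b, a n⟫ ^ 2 := Finset.sum_nonneg fun i _ => sq_nonneg _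
  set X1 := ∑ n, (∑ i, v i * offDiagGram a i n) ^ 2
  set q := ∑ n, ⟪b, a n⟫ ^ 2
  have herr2 := herr.trans (mul_le_mul_of_nonneg_left
    (mul_le_mul_of_nonneg_right hL (by linarith : 0 ≤ 1 + T)) (by norm_num : (0:ℝ) ≤ 4))
  have hΛ3 : Λ ≤ Λ ^ 3 := le_self_pow₀ hΛ (by norm_num)
  have hL0 : 0 ≤ L := le_trans (by positivity) hL
  have f1 := mul_le_mul_of_nonneg_left herr2 (by positivity : 0 ≤ 240000 * Λ ^ 3)
  have f2 : Λ * (2 * (2 * (s ^ 2 * X1 + q)) + 2 * (c1 ^ 2 * X2)) ≤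
      Λ ^ 3 * (960000 * (q + s ^ 2 * X1 + c1 ^ 2 * X2)) := by
    have g1 : 0 ≤ s ^ 2 * X1 := by positivity
    have g2 : 0 ≤ c1 ^ 2 * X2 := by positivity
    refine mul_le_mul hΛ3 (by linarith) (by positivity) (by positivity)
  have f3 : Λ * (2 * ∑ n, (s * (∑ i, v i * offDiagGram a i n) + ⟪b, a n⟫) ^ 2 +
      2 * (c1 ^ 2 * X2)) ≤ Λ * (2 * (2 * (s ^ 2 * X1 + q)) + 2 * (c1 ^ 2 * X2)) := by
    gcongr
  linarith

/-- The analogue for `M₂`: the entries of `ρ̃` are squared because of the second derivative, and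
without a weight, pair correlations and `σ'' ∈ L²` suffice. -/
theorem Activation.sum_integral_modelDeriv2_sq_le (h : Activation σ σ' σ'' B)
    (ha : ∀ i, ‖a i‖ = 1) (hκ : 0 ≤ κ) (hv : ∀ n, |v n| ≤ κ) :
    ∑ n, ∫ c, modelDeriv2 σ'' a v (Finset.univ.erase n) (a n) c ^ 2 ∂(stdGaussian E) ≤
      256 * B * ((∫ x, σ'' x ∂γ) ^ 2 * ∑ n, (∑ i, v i * offDiagGram a i n ^ 2) ^ 2 +
        (∫ x, x * σ'' x ∂γ) ^ 2 * ∑ n, ‖∑ i, (v i * offDiagGram a i n ^ 2) • a i‖ ^ 2 +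
        κ ^ 2 * (1 + ∑ i, ∑ j, offDiagGram a i j ^ 4) ^ 2) := by
  have hB := h.one_le
  have hx : MemLp (fun x : ℝ => x) 2 γ := by simpa using memLp_id_pow 1 2 (by simp)
  have hxσ'' : Integrable (fun x => x * σ'' x) γ := hx.integrable_mul (q := 2) h.memLp''
  have ec : ∫ x, x * (σ'' x - ∫ y, σ'' y ∂γ) ∂γ = ∫ x, x * σ'' x ∂γ := by
    simp only [mul_sub]
    rw [integral_sub hxσ'' ((hx.integrable one_le_two).mul_const _), integral_mul_const,
      integral_id_gaussianReal]
    simp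
  have hm'' := h.continuous''.measurable
  set s := ∫ x, σ'' x ∂γ with hs
  have hL : MemLp (fun x => σ'' x - s) 2 γ := h.memLp''.sub (memLp_const s)
  have h0 : ∫ x, (σ'' x - s) ∂γ = 0 := by
    rw [integral_sub (h.memLp''.integrable one_le_two) (integrable_const _)]
    simp [hs]
  have hV : ∫ x, (σ'' x - s) ^ 2 ∂γ ≤ B := by
    refine le_trans ?_ h.integral''
    have := integral_sub_const_sq_le h.memLp''
    exact this
  have key := fun n => integral_add_sum_sq_le (by fun_prop) hL h0 ha
    (s * (∑ i, v i * offDiagGram a i n ^ 2)) (fun i => v i * offDiagGram a i n ^ 2)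
  simp only [← modelDeriv2_erase_eq, ec] at key
  refine (Finset.sum_le_sum fun n _ => key n).trans ?_
  have herr := sum_error_sq_le ha hκ hv
  simp only [Finset.sum_add_distrib, ← Finset.mul_sum, mul_pow]
  set c2 := ∫ x, x * σ'' x ∂γ
  set Y2 := ∑ n, ‖∑ i, (v i * offDiagGram a i n ^ 2) • a i‖ ^ 2
  set T := ∑ i, ∑ j, offDiagGram a i j ^ 4 with hT
  have hY2 : 0 ≤ Y2 := Finset.sum_nonneg fun i _ => sq_nonneg _
  have hY1 : 0 ≤ ∑ n, (∑ i, v i * offDiagGram a i n ^ 2) ^ 2 :=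
    Finset.sum_nonneg fun i _ => sq_nonneg _
  set Y1 := ∑ n, (∑ i, v i * offDiagGram a i n ^ 2) ^ 2
  set err := ∑ n, ∑ i, ∑ j, |v i * offDiagGram a i n ^ 2| * |v j * offDiagGram a j n ^ 2| *
      ⟪a i, a j⟫ ^ 2
  have herr0 : 0 ≤ err := Finset.sum_nonneg fun n _ => Finset.sum_nonneg fun i _ =>
    Finset.sum_nonneg fun j _ => by positivity
  have f1 : 256 * (∫ x, (σ'' x - s) ^ 2 ∂γ) * err ≤ 256 * B * (κ ^ 2 * (1 + T) ^ 2) := by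
    gcongr
  have g1 : 0 ≤ s ^ 2 * Y1 := by positivity
  have g2 : 0 ≤ c2 ^ 2 * Y2 := by positivity
  have f2 := mul_le_mul_of_nonneg_right hB g1
  have f3 := mul_le_mul_of_nonneg_right hB g2
  linarith

/-- Quantitative form of the approximate Stein equation for the model. -/
theorem Activation.stein_bound (h : Activation σ σ' σ'' B) (ha : ∀ i, ‖a i‖ = 1) (v : ι → ℝ)
    (b : E) {κ L : ℝ} (hκ : 0 ≤ κ) (hv : ∀ n, |v n| ≤ κ) (hL : Fintype.card ι * κ ^ 2 ≤ L)
    (hg : SteinTest g g') :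
    |(∫ c, model σ a v b Finset.univ c * g (model σ a v b Finset.univ c) ∂(stdGaussian E)) -
      (∫ c, model σ a v b Finset.univ c ^ 2 ∂(stdGaussian E)) *
        ∫ c, g' (model σ a v b Finset.univ c) ∂(stdGaussian E)| ≤
      40000000 * B * (300000 * B ^ 5) ^ 3 *
        (κ * (L * (1 + ∑ i, ∑ j, offDiagGram a i j ^ 4) + ∑ n, ⟪b, a n⟫ ^ 2 +
          (∫ x, σ x * x ∂γ) ^ 2 * ∑ n, (∑ i, v i * offDiagGram a i n) ^ 2 +
          (∫ x, x * σ' x ∂γ) ^ 2 * ∑ n, ‖∑ i, (v i * offDiagGram a i n) • a i‖ ^ 2) +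
        √L * √((∫ x, σ'' x ∂γ) ^ 2 * ∑ n, (∑ i, v i * offDiagGram a i n ^ 2) ^ 2 +
        (∫ x, x * σ'' x ∂γ) ^ 2 * ∑ n, ‖∑ i, (v i * offDiagGram a i n ^ 2) • a i‖ ^ 2 +
        κ ^ 2 * (1 + ∑ i, ∑ j, offDiagGram a i j ^ 4) ^ 2)) := by
  have hB := h.one_le
  have habs : ∀ x : ℝ, |x| ^ 4 = x ^ 4 := fun x => by
    rw [← abs_pow, abs_of_nonneg (by positivity)]
  obtain ⟨k, hkm, hk0, hki, hk4, hk⟩ := exists_poincare_weight (ω := fun x => |σ x|) (B := B)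
    h.continuous.abs.measurable (fun x => abs_nonneg _)
    (by simpa only [habs] using h.integrable_four) (by simpa only [habs] using h.integral_four)
  have hM := h.momentPair hkm hki hk4
  -- The constant weight `1` turns the weighted bound into the unweighted one.
  have hM1 := h.momentPair (k := fun _ => 1) measurable_const (by simp) (by simp; linarith)
  obtain ⟨hint, hR⟩ := h.sum_integral_mul_modelDeriv_sq_le ha b hM hk0 hκ hv hL
  obtain ⟨-, hQ⟩ := h.sum_integral_mul_modelDeriv_sq_le ha b hM1 (fun _ => zero_le_one) hκ hv hL
  simp only [one_mul] at hQ
  have hm := h.sum_integral_modelDeriv2_sq_le ha hκ hv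
  refine (h.stein_equation ha v b ⟨hk0, hk⟩ hint hκ hv hL hg).trans ?_
  simp only [sum_erase_offDiagGram]
  have hΛ := hM.one_le
  set Λ := 300000 * B ^ 5
  set Rs := ∑ n, ∫ c, k ⟪a n, c⟫ * modelDeriv σ' a v b (Finset.univ.erase n) (a n) c ^ 2
      ∂(stdGaussian E)
  set Qs := ∑ n, ∫ c, modelDeriv σ' a v b (Finset.univ.erase n) (a n) c ^ 2
      ∂(stdGaussian E)
  set ms := ∑ n, ∫ c, modelDeriv2 σ'' a v (Finset.univ.erase n) (a n) c ^ 2 ∂(stdGaussian E)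
  set T := ∑ i, ∑ j, offDiagGram a i j ^ 4
  have hT0 : 0 ≤ T := Finset.sum_nonneg fun i _ => Finset.sum_nonneg fun j _ => by positivity
  have hX1 : 0 ≤ (∫ x, σ x * x ∂γ) ^ 2 * ∑ n, (∑ i, v i * offDiagGram a i n) ^ 2 :=
    mul_nonneg (sq_nonneg _) (Finset.sum_nonneg fun i _ => sq_nonneg _)
  have hX2 : 0 ≤ (∫ x, x * σ' x ∂γ) ^ 2 * ∑ n, ‖∑ i, (v i * offDiagGram a i n) • a i‖ ^ 2 :=
    mul_nonneg (sq_nonneg _) (Finset.sum_nonneg fun i _ => sq_nonneg _)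
  have hq : 0 ≤ ∑ n, ⟪b, a n⟫ ^ 2 := Finset.sum_nonneg fun i _ => sq_nonneg _
  set X1 := (∫ x, σ x * x ∂γ) ^ 2 * ∑ n, (∑ i, v i * offDiagGram a i n) ^ 2
  set X2 := (∫ x, x * σ' x ∂γ) ^ 2 * ∑ n, ‖∑ i, (v i * offDiagGram a i n) • a i‖ ^ 2
  set q := ∑ n, ⟪b, a n⟫ ^ 2
  set Y := (∫ x, σ'' x ∂γ) ^ 2 * ∑ n, (∑ i, v i * offDiagGram a i n ^ 2) ^ 2 +
        (∫ x, x * σ'' x ∂γ) ^ 2 * ∑ n, ‖∑ i, (v i * offDiagGram a i n ^ 2) • a i‖ ^ 2 +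
        κ ^ 2 * (1 + T) ^ 2
  have hL0 : 0 ≤ L := le_trans (by positivity) hL
  have hLT : 0 ≤ L * T := mul_nonneg hL0 hT0
  have hB5 : 1 ≤ B ^ 5 := one_le_pow₀ hB
  have hΛ3 : 1 ≤ Λ ^ 3 := one_le_pow₀ hΛ
  have hBΛ : B ≤ Λ ^ 3 := by
    have h1 : B ≤ B ^ 5 := le_self_pow₀ hB (by norm_num)
    have h2 : Λ ≤ Λ ^ 3 := le_self_pow₀ hΛ (by norm_num)
    have h3 : B ^ 5 ≤ Λ := by linarith [show Λ = 300000 * B ^ 5 from rfl]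
    linarith
  clear_value Λ
  set Z := L * (1 + T) + q + X1 + X2 with hZ
  have hZ0 : 0 ≤ Z := by rw [hZ]; positivity
  have f1 : L + q + X1 + Qs + Rs ≤ 2000000 * Λ ^ 3 * Z := by
    have h1 : L + q + X1 ≤ Z := by linarith
    have h2 : Z ≤ Λ ^ 3 * Z := le_mul_of_one_le_left hZ0 hΛ3
    have h3 : 0 ≤ Λ ^ 3 * Z := by positivity
    linarith
  have f2 : √ms ≤ 2000000 * Λ ^ 3 * √Y := by
    have h1 : √ms ≤ √(256 * B) * √Y := by
      rw [← Real.sqrt_mul (by linarith)]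
      exact Real.sqrt_le_sqrt hm
    have h2 : √(256 * B) ≤ 2000000 * Λ ^ 3 :=
      Real.sqrt_le_iff.2 ⟨by linarith, by nlinarith⟩
    exact h1.trans (mul_le_mul_of_nonneg_right h2 (Real.sqrt_nonneg _))
  calc 20 * B * (κ * (L + q + X1 + Qs + Rs) + √L * √ms)
      ≤ 20 * B * (κ * (2000000 * Λ ^ 3 * Z) + √L * (2000000 * Λ ^ 3 * √Y)) := by gcongr
    _ = _ := by ring

end

end

section

/-! ### From the Stein equation to expectations of smooth functions -/

section

variable {f g g' : ℝ → ℝ}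

theorem SteinTest.abs_le_add (hg : SteinTest g g') (x : ℝ) : |g x| ≤ |g 0| + |x| := by
  have h1 := hg.abs_sub_le x 0
  have h2 := abs_add_le (g 0) (g x - g 0)
  rw [sub_zero] at h1
  rw [add_sub_cancel] at h2
  linarith

theorem SteinTest.abs_le_add_sq (hg : SteinTest g g') (hf : ∀ x, HasDerivAt f (g x) x) (x : ℝ) :
    |f x| ≤ |f 0| + |g 0| * |x| + x ^ 2 := by
  have h : ‖f x - f 0‖ ≤ (|g 0| + |x|) * ‖x - 0‖ := by
    refine (convex_uIcc (0 : ℝ) x).norm_image_sub_le_of_norm_hasDerivWithin_le (f := f) (f' := g)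
      (fun y _ => (hf y).hasDerivWithinAt) (fun y hy => ?_) Set.left_mem_uIcc Set.right_mem_uIcc
    have h1 : |y| ≤ |x| := by
      have := Set.abs_sub_left_of_mem_uIcc hy
      simpa using this
    rw [Real.norm_eq_abs]
    exact (hg.abs_le_add y).trans (by linarith)
  rw [Real.norm_eq_abs, sub_zero, Real.norm_eq_abs] at h
  have h2 := abs_add_le (f 0) (f x - f 0)
  rw [add_sub_cancel] at h2
  nlinarith [abs_mul_abs_self x]

/-- An antiderivative of a Stein test grows at most quadratically. -/
theorem SteinTest.integrable_comp (hg : SteinTest g g') (hf : ∀ x, HasDerivAt f (g x) x)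
    {Ω : Type*} [MeasurableSpace Ω] {μ : Measure Ω} [IsFiniteMeasure μ] {X : Ω → ℝ}
    (hX : MemLp X 2 μ) : Integrable (fun ω => f (X ω)) μ := by
  have hfc : Continuous f := continuous_iff_continuousAt.2 fun x => (hf x).continuousAt
  have hb : Integrable (fun ω => |f 0| + |g 0| * |X ω| + X ω ^ 2) μ :=
    ((integrable_const _).add ((hX.integrable one_le_two).abs.const_mul _)).add hX.integrable_sq
  exact hb.mono' (hfc.comp_aestronglyMeasurable hX.1)
    (ae_of_all _ fun ω => hg.abs_le_add_sq hf (X ω))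

/-- Stability under contractions and shifts lets the Stein inequality be applied along the
interpolation with the Gaussian variable frozen. -/
theorem SteinTest.comp_affine (hg : SteinTest g g') {s : ℝ} (hs : |s| ≤ 1) (y : ℝ) :
    SteinTest (fun x => g (s * x + y)) (fun x => s * g' (s * x + y)) where
  hasDerivAt x := by
    have h1 : HasDerivAt (fun x => s * x + y) s x := by
      simpa using ((hasDerivAt_id x).const_mul s).add_const y
    exact ((hg.hasDerivAt _).comp x h1).congr_deriv (mul_comm _ _)
  abs_le x := by
    rw [abs_mul]
    exact mul_le_one₀ hs (abs_nonneg _) (hg.abs_le _)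
  lipschitz x z := by
    rw [← mul_sub, abs_mul]
    have h1 := hg.lipschitz (s * x + y) (s * z + y)
    rw [add_sub_add_right_eq_sub, ← mul_sub, abs_mul] at h1
    have h2 : |s| * |g' (s * x + y) - g' (s * z + y)| ≤ 1 * |g' (s * x + y) - g' (s * z + y)| :=
      mul_le_mul_of_nonneg_right hs (abs_nonneg _)
    have h3 : |s| * |x - z| ≤ 1 * |x - z| := mul_le_mul_of_nonneg_right hs (abs_nonneg _)
    linarith

theorem SteinTest.integral_mul_comp_affine (hg : SteinTest g g') (c q : ℝ) :
    ∫ z, z * g (c + q * z) ∂γ = q * ∫ z, g' (c + q * z) ∂γ := by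
  have hx : MemLp (fun x : ℝ => x) 2 γ := by simpa using memLp_id_pow 1 2 (by simp)
  have hL : MemLp (fun z : ℝ => c + q * z) 2 γ := (memLp_const c).add (hx.const_mul q)
  have hgL : MemLp (fun z : ℝ => g (c + q * z)) 2 γ := hg.memLp_comp hL
  have hgL' : MemLp (fun z : ℝ => g' (c + q * z)) 1 γ := hg.memLp_comp' hL.1
  have i1 : Integrable (fun z : ℝ => z * g (c + q * z)) γ := hx.integrable_mul (q := 2) hgL
  have hd : ∀ z, HasDerivAt (fun z => g (c + q * z)) (q * g' (c + q * z)) z := fun z => by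
    have h1 : HasDerivAt (fun z => c + q * z) q z := by
      simpa using ((hasDerivAt_id z).const_mul q).const_add c
    exact ((hg.hasDerivAt _).comp z h1).congr_deriv (mul_comm _ _)
  rw [gaussian_integral_mul_self hd (hgL.integrable one_le_two) i1
    ((hgL'.integrable le_rfl).const_mul q), integral_const_mul]

variable {Ω : Type*} [MeasurableSpace Ω] {μ : Measure Ω} [IsProbabilityMeasure μ] {S : Ω → ℝ}

theorem SteinTest.hasDerivAt_integral_rotation (hg : SteinTest g g')
    (hf : ∀ x, HasDerivAt f (g x) x) {X Y : Ω → ℝ} (hX : MemLp X 2 μ) (hY : MemLp Y 2 μ) (θ : ℝ) :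
    HasDerivAt (fun θ => ∫ ω, f (Real.sin θ * X ω + Real.cos θ * Y ω) ∂μ)
      (∫ ω, g (Real.sin θ * X ω + Real.cos θ * Y ω) *
        (Real.cos θ * X ω - Real.sin θ * Y ω) ∂μ) θ := by
  have hL : ∀ θ, MemLp (fun ω => Real.sin θ * X ω + Real.cos θ * Y ω) 2 μ :=
    fun θ => (hX.const_mul _).add (hY.const_mul _)
  have hD : MemLp (fun ω => Real.cos θ * X ω - Real.sin θ * Y ω) 2 μ :=
    (hX.const_mul _).sub (hY.const_mul _)
  have hI : ∀ θ, Integrable (fun ω => f (Real.sin θ * X ω + Real.cos θ * Y ω)) μ :=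
    fun θ => hg.integrable_comp hf (hL θ)
  have hgL : MemLp (fun ω => g (Real.sin θ * X ω + Real.cos θ * Y ω)) 2 μ := hg.memLp_comp (hL θ)
  have hm : AEStronglyMeasurable (fun ω => g (Real.sin θ * X ω + Real.cos θ * Y ω) *
      (Real.cos θ * X ω - Real.sin θ * Y ω)) μ := hgL.1.mul hD.1
  have hsum : MemLp (fun ω => |X ω| + |Y ω|) 2 μ := hX.abs.add hY.abs
  have hsum1 : MemLp (fun ω => |g 0| + (|X ω| + |Y ω|)) 2 μ := (memLp_const |g 0|).add hsum
  have hbi : Integrable (fun ω => (|g 0| + (|X ω| + |Y ω|)) * (|X ω| + |Y ω|)) μ :=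
    hsum1.integrable_mul (q := 2) hsum
  have hb : ∀ x y a b : ℝ, |x| ≤ 1 → |y| ≤ 1 → |x * a| + |y * b| ≤ |a| + |b| := by
    intro x y a b hx hy
    rw [abs_mul, abs_mul]
    exact add_le_add (mul_le_of_le_one_left (abs_nonneg _) hx)
      (mul_le_of_le_one_left (abs_nonneg _) hy)
  have hbound : ∀ ω θ, ‖g (Real.sin θ * X ω + Real.cos θ * Y ω) *
      (Real.cos θ * X ω - Real.sin θ * Y ω)‖ ≤ (|g 0| + (|X ω| + |Y ω|)) * (|X ω| + |Y ω|) := by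
    intro ω θ
    have hs := Real.abs_sin_le_one θ
    have hc := Real.abs_cos_le_one θ
    have h1 : |Real.sin θ * X ω + Real.cos θ * Y ω| ≤ |X ω| + |Y ω| :=
      (abs_add_le _ _).trans (hb _ _ _ _ hs hc)
    have h2 : |Real.cos θ * X ω - Real.sin θ * Y ω| ≤ |X ω| + |Y ω| :=
      (abs_sub _ _).trans (hb _ _ _ _ hc hs)
    rw [norm_mul, Real.norm_eq_abs, Real.norm_eq_abs]
    exact mul_le_mul ((hg.abs_le_add _).trans (by linarith)) h2 (abs_nonneg _) (by positivity)
  have hd : ∀ ω θ, HasDerivAt (fun θ => f (Real.sin θ * X ω + Real.cos θ * Y ω))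
      (g (Real.sin θ * X ω + Real.cos θ * Y ω) * (Real.cos θ * X ω - Real.sin θ * Y ω)) θ := by
    intro ω θ
    have h1 : HasDerivAt (fun θ => Real.sin θ * X ω + Real.cos θ * Y ω)
        (Real.cos θ * X ω - Real.sin θ * Y ω) θ := by
      have := ((Real.hasDerivAt_sin θ).mul_const (X ω)).add
        ((Real.hasDerivAt_cos θ).mul_const (Y ω))
      exact this.congr_deriv (by ring)
    exact (hf _).comp θ h1
  exact (hasDerivAt_integral_of_dominated_loc_of_deriv_le (s := Set.univ)
    Filter.univ_mem (Filter.Eventually.of_forall fun θ => (hI θ).1) (hI θ) hm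
    (ae_of_all _ fun ω θ _ => hbound ω θ) hbi (ae_of_all _ fun ω θ _ => hd ω θ)).2

/-- The derivative of the interpolation between `S` and a Gaussian variable of variance `q ^ 2`. -/
theorem abs_integral_interpolation_deriv_le (hS : MemLp S 2 μ) {q ε : ℝ}
    (hst : ∀ g g', SteinTest g g' → |(∫ ω, S ω * g (S ω) ∂μ) - q ^ 2 * ∫ ω, g' (S ω) ∂μ| ≤ ε)
    (hg : SteinTest g g') {s t : ℝ} (hs1 : |s| ≤ 1) (ht1 : |t| ≤ 1) :
    |∫ p, g (s * S p.1 + t * (q * p.2)) * (t * S p.1 - s * (q * p.2)) ∂(μ.prod γ)| ≤ ε := by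
  have hx : MemLp (fun x : ℝ => x) 2 γ := by simpa using memLp_id_pow 1 2 (by simp)
  have hS1 : MemLp (fun p : Ω × ℝ => S p.1) 2 (μ.prod γ) :=
    hS.comp_measurePreserving measurePreserving_fst
  have hZ1 : MemLp (fun p : Ω × ℝ => p.2) 2 (μ.prod γ) :=
    hx.comp_measurePreserving measurePreserving_snd
  have hY : MemLp (fun p : Ω × ℝ => s * S p.1 + t * (q * p.2)) 2 (μ.prod γ) :=
    (hS1.const_mul s).add ((hZ1.const_mul q).const_mul t)
  have hgY : MemLp (fun p : Ω × ℝ => g (s * S p.1 + t * (q * p.2))) 2 (μ.prod γ) :=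
    hg.memLp_comp hY
  have hgY' : MemLp (fun p : Ω × ℝ => g' (s * S p.1 + t * (q * p.2))) 1 (μ.prod γ) :=
    hg.memLp_comp' hY.1
  have i1 : Integrable (fun p : Ω × ℝ => S p.1 * g (s * S p.1 + t * (q * p.2))) (μ.prod γ) :=
    hS1.integrable_mul (q := 2) hgY
  have i2 : Integrable (fun p : Ω × ℝ => p.2 * g (s * S p.1 + t * (q * p.2))) (μ.prod γ) :=
    hZ1.integrable_mul (q := 2) hgY
  have i3 : Integrable (fun p : Ω × ℝ => g' (s * S p.1 + t * (q * p.2))) (μ.prod γ) :=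
    hgY'.integrable le_rfl
  have e0 : ∫ p, g (s * S p.1 + t * (q * p.2)) * (t * S p.1 - s * (q * p.2)) ∂(μ.prod γ) =
      t * (∫ p, S p.1 * g (s * S p.1 + t * (q * p.2)) ∂(μ.prod γ)) -
      s * q * ∫ p, p.2 * g (s * S p.1 + t * (q * p.2)) ∂(μ.prod γ) := by
    rw [← integral_const_mul, ← integral_const_mul, ← integral_sub (i1.const_mul _)
      (i2.const_mul _)]
    congr 1; ext p; ring
  have e1 : ∫ p, p.2 * g (s * S p.1 + t * (q * p.2)) ∂(μ.prod γ) =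
      t * q * ∫ p, g' (s * S p.1 + t * (q * p.2)) ∂(μ.prod γ) := by
    rw [integral_prod _ i2, integral_prod _ i3, ← integral_const_mul]
    refine integral_congr_ae (ae_of_all _ fun ω => ?_)
    simpa only [mul_assoc] using hg.integral_mul_comp_affine (s * S ω) (t * q)
  have j1 : Integrable (fun z => ∫ ω, S ω * g (s * S ω + t * (q * z)) ∂μ) γ :=
    i1.integral_prod_right
  have j2 : Integrable (fun z => ∫ ω, g' (s * S ω + t * (q * z)) ∂μ) γ := i3.integral_prod_right
  have e3 : ∫ p, S p.1 * g (s * S p.1 + t * (q * p.2)) ∂(μ.prod γ) =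
      ∫ z, ∫ ω, S ω * g (s * S ω + t * (q * z)) ∂μ ∂γ := integral_prod_symm _ i1
  have e4 : ∫ p, g' (s * S p.1 + t * (q * p.2)) ∂(μ.prod γ) =
      ∫ z, ∫ ω, g' (s * S ω + t * (q * z)) ∂μ ∂γ := integral_prod_symm _ i3
  have e5 : ∫ z, ((∫ ω, S ω * g (s * S ω + t * (q * z)) ∂μ) -
        q ^ 2 * (s * ∫ ω, g' (s * S ω + t * (q * z)) ∂μ)) ∂γ =
      (∫ z, ∫ ω, S ω * g (s * S ω + t * (q * z)) ∂μ ∂γ) -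
        q ^ 2 * (s * ∫ z, ∫ ω, g' (s * S ω + t * (q * z)) ∂μ ∂γ) := by
    rw [integral_sub j1 ((j2.const_mul s).const_mul (q ^ 2)), integral_const_mul,
      integral_const_mul]
  -- Exact integration by parts in the Gaussian variable turns the integrand, for each frozen `z`,
  -- into the Stein discrepancy of `S` for the test `x ↦ g (s x + t q z)`.
  have e6 : ∫ p, g (s * S p.1 + t * (q * p.2)) * (t * S p.1 - s * (q * p.2)) ∂(μ.prod γ) =
      t * ∫ z, ((∫ ω, S ω * g (s * S ω + t * (q * z)) ∂μ) -
        q ^ 2 * (s * ∫ ω, g' (s * S ω + t * (q * z)) ∂μ)) ∂γ := by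
    rw [e0, e1, e5, e3, e4]; ring
  rw [e6, abs_mul, ← one_mul ε]
  refine mul_le_mul ht1 ?_ (abs_nonneg _) zero_le_one
  rw [← Real.norm_eq_abs]
  refine (norm_integral_le_of_norm_le_const (C := ε) (ae_of_all _ fun z => ?_)).trans (by simp)
  have := hst _ _ (hg.comp_affine hs1 (t * (q * z)))
  rwa [integral_const_mul] at this

/-- If `S` satisfies the Stein equation of a Gaussian variable of variance `q ^ 2` up to `ε`, then
the expectations of a smooth function differ by at most `2 ε`. -/
theorem abs_integral_comp_sub_gaussian_le (hS : MemLp S 2 μ) {q ε : ℝ}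
    (hst : ∀ g g', SteinTest g g' → |(∫ ω, S ω * g (S ω) ∂μ) - q ^ 2 * ∫ ω, g' (S ω) ∂μ| ≤ ε)
    (hg : SteinTest g g') (hf : ∀ x, HasDerivAt f (g x) x) :
    |(∫ ω, f (S ω) ∂μ) - ∫ z, f (q * z) ∂γ| ≤ 2 * ε := by
  have hε : 0 ≤ ε := (abs_nonneg _).trans (hst g g' hg)
  have hx : MemLp (fun x : ℝ => x) 2 γ := by simpa using memLp_id_pow 1 2 (by simp)
  have hS1 : MemLp (fun p : Ω × ℝ => S p.1) 2 (μ.prod γ) :=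
    hS.comp_measurePreserving measurePreserving_fst
  have hZ0 : MemLp (fun p : Ω × ℝ => p.2) 2 (μ.prod γ) :=
    hx.comp_measurePreserving measurePreserving_snd
  have hZ1 : MemLp (fun p : Ω × ℝ => q * p.2) 2 (μ.prod γ) := hZ0.const_mul q
  -- The interpolation is the Gaussian variable at `θ = 0` and `S` at `θ = π/2`. The mean value
  -- inequality gives `ε π/2 ≤ 2 ε`, without solving the Stein equation.
  have hbound := (convex_univ (𝕜 := ℝ)).norm_image_sub_le_of_norm_hasDerivWithin_le
    (C := ε) (s := Set.univ) (x := 0) (y := Real.pi / 2)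
    (fun θ _ => (hg.hasDerivAt_integral_rotation hf hS1 hZ1 θ).hasDerivWithinAt)
    (fun θ _ => abs_integral_interpolation_deriv_le hS hst hg (Real.abs_sin_le_one θ)
      (Real.abs_cos_le_one θ)) trivial trivial
  simp only [Real.sin_pi_div_two, Real.cos_pi_div_two, Real.sin_zero, Real.cos_zero, one_mul,
    zero_mul, add_zero, zero_add] at hbound
  have e1 : ∫ p, f (S p.1) ∂(μ.prod γ) = ∫ ω, f (S ω) ∂μ := by
    rw [integral_prod _ (hg.integrable_comp hf hS1)]; simp
  have e0 : ∫ p, f (q * p.2) ∂(μ.prod γ) = ∫ z, f (q * z) ∂γ := by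
    rw [integral_prod_symm _ (hg.integrable_comp hf hZ1)]; simp
  rw [e1, e0, Real.norm_eq_abs, sub_zero, Real.norm_of_nonneg (by positivity)] at hbound
  refine hbound.trans ?_
  nlinarith [Real.pi_le_four]

end

end

section

/-! ### Slices of the Gaussian equivalent -/

section

variable {ι : Type*} [Fintype ι] {P : Measure (EuclideanSpace ℝ ι)}
  [IsProbabilityMeasure P]

/-- The covariance matrix of `P`. -/
noncomputable def covMatrix (P : Measure (EuclideanSpace ℝ ι)) : Matrix ι ι ℝ :=
  Matrix.of fun i j => cov[fun x => x i, fun x => x j; P]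

theorem covarianceBilin_eq_dotProduct (hP : MemLp id 2 P) (x y : EuclideanSpace ℝ ι) :
    covarianceBilin P x y = x ⬝ᵥ covMatrix P *ᵥ y := by
  have hX : ∀ i, MemLp (fun x : EuclideanSpace ℝ ι => x i) 2 P := fun i => hP.eval_piLp i
  have h := covarianceBilin_apply_pi hX x y
  have e : (fun ω : EuclideanSpace ℝ ι => WithLp.toLp 2 fun i => ω i) = id := rfl
  rw [e, Measure.map_id] at h
  rw [h]
  simp only [dotProduct, Matrix.mulVec, covMatrix, Matrix.of_apply, Finset.mul_sum]
  exact Finset.sum_congr rfl fun i _ => Finset.sum_congr rfl fun j _ => by ring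

theorem covMatrix_posSemidef (hP : MemLp id 2 P) : (covMatrix P).PosSemidef := by
  refine Matrix.PosSemidef.of_dotProduct_mulVec_nonneg ?_ fun x => ?_
  · ext i j
    simp only [Matrix.conjTranspose_apply, covMatrix, Matrix.of_apply, star_trivial]
    exact covariance_comm _ _
  · have := covarianceBilin_self_nonneg (μ := P) (WithLp.toLp 2 x)
    rwa [covarianceBilin_eq_dotProduct hP] at this

theorem slice_gaussianEquivalent [DecidableEq ι] (hP : MemLp id 2 P) (α : EuclideanSpace ℝ ι) :
    slice (gaussianEquivalent P) α =
      gaussianReal (∫ x, ⟪α, x⟫ ∂P) (Var[fun x => ⟪α, x⟫; P]).toNNReal := by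
  have hS := covMatrix_posSemidef hP
  have hG : gaussianEquivalent P = multivariateGaussian (∫ x, x ∂P) (covMatrix P) := rfl
  have hL : (fun x : EuclideanSpace ℝ ι => ⟪α, x⟫) = innerSL ℝ α := rfl
  rw [slice, hG, hL, IsGaussian.map_eq_gaussianReal]
  congr 1
  · rw [ContinuousLinearMap.integral_comp_comm _ IsGaussian.integrable_fun_id,
      integral_id_multivariateGaussian]
    exact ((innerSL ℝ α).integral_comp_comm (hP.integrable one_le_two)).symm
  · rw [← hL, ← covarianceBilin_self IsGaussian.memLp_two_id,
      covarianceBilin_multivariateGaussian hS, ← covarianceBilin_eq_dotProduct hP,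
      covarianceBilin_self hP]

end

/-- Take `g = f'`; the bound on `f'''` becomes the Lipschitz bound on `f''` by the mean value
inequality, without continuity of `f'''`. -/
theorem TestFunction.exists_steinTest {f : ℝ → ℝ} (hf : TestFunction f) :
    ∃ g g', SteinTest g g' ∧ ∀ x, HasDerivAt f (g x) x := by
  obtain ⟨hd, h2, h3⟩ := hf
  have e : ∀ k < 3, ∀ x, HasDerivAt (iteratedDeriv k f) (iteratedDeriv (k + 1) f x) x :=
    fun k hk x => by
      rw [iteratedDeriv_succ]
      exact (hd k hk x).hasDerivAt
  refine ⟨iteratedDeriv 1 f, iteratedDeriv 2 f, ⟨e 1 (by norm_num), h2, fun x y => ?_⟩, fun x => ?_⟩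
  · have := (convex_univ (𝕜 := ℝ)).norm_image_sub_le_of_norm_hasDerivWithin_le
      (C := 1) (s := Set.univ) (x := y) (y := x)
      (fun z _ => (e 2 (by norm_num) z).hasDerivWithinAt) (fun z _ => h3 z) trivial trivial
    simpa using this
  · simpa using e 0 (by norm_num) x

theorem SteinTest.comp_const_add {g g' : ℝ → ℝ} (hg : SteinTest g g') (m : ℝ) :
    SteinTest (fun x => g (m + x)) (fun x => g' (m + x)) := by
  simpa [add_comm] using hg.comp_affine (s := 1) (by simp) m

theorem dist1_map_le {Ω : Type*} [MeasurableSpace Ω] {μ : Measure Ω} [IsProbabilityMeasure μ]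
    {S : Ω → ℝ} (hS : MemLp S 2 μ) (m : ℝ) {ε : ℝ}
    (hst : ∀ g g', SteinTest g g' → |(∫ ω, S ω * g (S ω) ∂μ) -
      (∫ ω, S ω ^ 2 ∂μ) * ∫ ω, g' (S ω) ∂μ| ≤ ε) :
    dist1 (μ.map fun ω => m + S ω) (gaussianReal m (∫ ω, S ω ^ 2 ∂μ).toNNReal) ≤
      ENNReal.ofReal (2 * ε) := by
  refine iSup₂_le fun f hf => ?_
  obtain ⟨g, g', hg, hfg⟩ := hf.exists_steinTest
  have hfc : Continuous f := continuous_iff_continuousAt.2 fun x => (hfg x).continuousAt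
  have hV : 0 ≤ ∫ ω, S ω ^ 2 ∂μ := integral_nonneg fun _ => sq_nonneg _
  have hgm := hg.comp_const_add m
  have hfm : ∀ x, HasDerivAt (fun x => f (m + x)) (g (m + x)) x := fun x =>
    HasDerivAt.comp_const_add m x (hfg (m + x))
  set V := ∫ ω, S ω ^ 2 ∂μ
  have hq : √V ^ 2 = V := Real.sq_sqrt hV
  have hx : MemLp (fun x : ℝ => x) 2 γ := by simpa using memLp_id_pow 1 2 (by simp)
  have hmap : (γ).map (fun z => m + √V * z) = gaussianReal m V.toNNReal := by
    have := map_affine m (v := V.toNNReal)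
    rwa [Real.coe_toNNReal _ hV] at this
  have hm1 : AEMeasurable (fun ω => m + S ω) μ := hS.1.aemeasurable.const_add m
  have hm2 : AEMeasurable (fun z => m + √V * z) γ := by fun_prop
  have hf1 : AEStronglyMeasurable f (μ.map fun ω => m + S ω) := hfc.aestronglyMeasurable
  have hf2 : AEStronglyMeasurable f ((γ).map fun z => m + √V * z) := hfc.aestronglyMeasurable
  have i1 : Integrable f (μ.map fun ω => m + S ω) :=
    (integrable_map_measure hf1 hm1).2 (hgm.integrable_comp hfm hS)
  have i2 : Integrable f ((γ).map fun z => m + √V * z) :=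
    (integrable_map_measure hf2 hm2).2 (hgm.integrable_comp hfm (hx.const_mul √V))
  -- Both integrability facts are needed here, since the gap is `∞` otherwise.
  rw [← hmap, expectationGap, if_pos ⟨i1, i2⟩, integral_map hm1 hf1, integral_map hm2 hf2]
  refine ENNReal.ofReal_le_ofReal ?_
  exact abs_integral_comp_sub_gaussian_le hS (by rw [hq]; exact hst) hgm hfm

/-- Every slice of the Gaussian equivalent is the normal law with the mean and variance of the
corresponding slice, so a Stein bound uniform in `α` is all that is required. -/
theorem distMS_gaussianEquivalent_le {ι Ω : Type*} [Fintype ι] [DecidableEq ι] [MeasurableSpace Ω]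
    {μ : Measure Ω} [IsProbabilityMeasure μ] {X : Ω → EuclideanSpace ℝ ι} (hXm : Measurable X)
    (hX : MemLp X 2 μ) {ε : ℝ}
    (h : ∀ α : EuclideanSpace ℝ ι, ‖α‖ ≤ 1 → ∃ (m : ℝ) (S : Ω → ℝ),
      (∀ ω, ⟪α, X ω⟫ = m + S ω) ∧ MemLp S 2 μ ∧ ∫ ω, S ω ∂μ = 0 ∧
      ∀ g g', SteinTest g g' → |(∫ ω, S ω * g (S ω) ∂μ) -
        (∫ ω, S ω ^ 2 ∂μ) * ∫ ω, g' (S ω) ∂μ| ≤ ε) :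
    distMS (μ.map X) (gaussianEquivalent (μ.map X)) ≤ ENNReal.ofReal (2 * ε) := by
  refine iSup₂_le fun α hα => ?_
  obtain ⟨m, S, hmS, hS, hS0, hst⟩ := h α hα
  have : IsProbabilityMeasure (μ.map X) := Measure.isProbabilityMeasure_map hXm.aemeasurable
  have hP : MemLp id 2 (μ.map X) :=
    (memLp_map_measure_iff aestronglyMeasurable_id hXm.aemeasurable).2 hX
  have hin : Measurable fun x : EuclideanSpace ℝ ι => ⟪α, x⟫ := by fun_prop
  have e1 : slice (μ.map X) α = μ.map fun ω => m + S ω := by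
    rw [slice, Measure.map_map hin hXm]
    congr 1; ext ω; exact hmS ω
  have e2 : ∫ x, ⟪α, x⟫ ∂(μ.map X) = m := by
    rw [integral_map hXm.aemeasurable hin.aestronglyMeasurable]
    simp only [hmS]
    rw [integral_add (integrable_const _) (hS.integrable one_le_two), hS0]
    simp
  have e3 : Var[fun x => ⟪α, x⟫; μ.map X] = ∫ ω, S ω ^ 2 ∂μ := by
    rw [variance_eq_integral hin.aemeasurable, e2,
      integral_map hXm.aemeasurable (by fun_prop)]
    simp only [hmS, add_sub_cancel_left]
  rw [slice_gaussianEquivalent hP, e1, e2, e3]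
  exact dist1_map_le hS m hst

end

section

/-! ### Hermite coefficients of the activation function -/

theorem integrable_id_pow_mul (k : ℕ) {f : ℝ → ℝ} (hf : MemLp f 2 γ) :
    Integrable (fun x => x ^ k * f x) γ :=
  (memLp_id_pow k 2 (by simp)).integrable_mul (q := 2) hf

theorem integrable_id_mul {f : ℝ → ℝ} (hf : MemLp f 2 γ) : Integrable (fun x => x * f x) γ := by
  simpa using integrable_id_pow_mul 1 hf

theorem integral_id_pow_three : ∫ x : ℝ, x ^ 3 ∂γ = 0 := by
  have := gaussian_integral_mul_self (h := fun x => x ^ 2) (h' := fun x => 2 * x)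
    (fun x => by simpa using hasDerivAt_pow 2 x)
    (integrable_id_pow 2) (by simpa [← pow_succ'] using integrable_id_pow 3)
    (by simpa using (integrable_id_pow 1).const_mul 2)
  rw [integral_const_mul, integral_id_gaussianReal] at this
  simpa [← pow_succ'] using this

namespace Activation

variable {σ σ' σ'' : ℝ → ℝ} {B : ℝ}

theorem integral_deriv2_eq (h : Activation σ σ' σ'' B) :
    ∫ x, σ'' x ∂γ = ∫ x, x * σ' x ∂γ :=
  (gaussian_integral_mul_self h.hasDerivAt' (h.memLp'.integrable one_le_two)
    (integrable_id_mul h.memLp') (h.memLp''.integrable one_le_two)).symm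

theorem integral_id_mul_deriv_eq (h : Activation σ σ' σ'' B) :
    ∫ x, x * σ' x ∂γ = √2 * hermite2 σ := by
  have hd : ∀ x, HasDerivAt (fun x => x * σ x) (σ x + x * σ' x) x := fun x => by
    simpa using (hasDerivAt_id x).fun_mul (h.hasDerivAt x)
  have i0 := h.memLp.integrable one_le_two
  have i1 := integrable_id_mul h.memLp'
  have i2 := integrable_id_pow_mul 2 h.memLp
  have i3 : Integrable (fun x => x * (x * σ x)) γ := by simpa only [sq, mul_assoc] using i2
  have key := gaussian_integral_mul_self hd (integrable_id_mul h.memLp) i3 (i0.add i1)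
  rw [integral_add i0 i1] at key
  have e : ∀ x, σ x * (x ^ 2 - 1) = x * (x * σ x) - σ x := fun x => by ring
  rw [hermite2, ← mul_assoc, mul_one_div_cancel (by positivity), one_mul]
  simp only [e]
  rw [integral_sub i3 i0, key]
  ring

/-- Integrate `x σ'` and `x² σ` by parts; the surplus terms cancel because `E[σ'] = E[x σ]`. -/
theorem integral_id_mul_deriv2_eq (h : Activation σ σ' σ'' B) :
    ∫ x, x * σ'' x ∂γ = √6 * hermite3 σ := by
  have hd1 : ∀ x, HasDerivAt (fun x => x * σ' x) (σ' x + x * σ'' x) x := fun x => by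
    simpa using (hasDerivAt_id x).fun_mul (h.hasDerivAt' x)
  have hd2 : ∀ x, HasDerivAt (fun x => x ^ 2 * σ x) (2 * (x * σ x) + x ^ 2 * σ' x) x := fun x => by
    simpa [mul_assoc] using (hasDerivAt_pow 2 x).fun_mul (h.hasDerivAt x)
  have i0 := h.memLp'.integrable one_le_two
  have i1 := integrable_id_mul h.memLp''
  have i2 := integrable_id_pow_mul 2 h.memLp'
  have i2' : Integrable (fun x => x * (x * σ' x)) γ := by simpa only [sq, mul_assoc] using i2
  have i3 := integrable_id_mul h.memLp
  have i4 : Integrable (fun x => x * (x ^ 2 * σ x)) γ := by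
    simpa only [pow_succ', pow_zero, mul_one, mul_assoc] using integrable_id_pow_mul 3 h.memLp
  have key1 := gaussian_integral_mul_self hd1 (integrable_id_mul h.memLp') i2' (i0.add i1)
  have key2 := gaussian_integral_mul_self hd2 (integrable_id_pow_mul 2 h.memLp) i4
    ((i3.const_mul 2).add i2)
  rw [integral_add i0 i1, ← h.integral_mul_id_eq] at key1
  rw [integral_add (i3.const_mul 2) i2, integral_const_mul] at key2
  have e : ∀ x, σ x * (x ^ 3 - 3 * x) = x * (x ^ 2 * σ x) - 3 * (x * σ x) := fun x => by ring
  rw [hermite3, ← mul_assoc, mul_one_div_cancel (by positivity), one_mul]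
  simp only [e]
  rw [integral_sub i4 (i3.const_mul 3), integral_const_mul, key2]
  simp only [sq, mul_assoc, mul_comm (σ _)] at key1 ⊢
  linarith

end Activation

/-! ### Centring the activation function -/

section Center

variable {σ : ℝ → ℝ}

/-- Applied to Hermite polynomials of positive degree, which have mean zero: centring `σ` changes
none of the three coefficients. -/
theorem integral_sub_const_mul (hσ : MemLp σ 2 γ) (m : ℝ) {p : ℝ → ℝ} (hp : MemLp p 2 γ)
    (h0 : ∫ x, p x ∂γ = 0) : ∫ x, (σ x - m) * p x ∂γ = ∫ x, σ x * p x ∂γ := by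
  have i1 : Integrable (fun x => σ x * p x) γ := hσ.integrable_mul (q := 2) hp
  have i2 := (hp.integrable one_le_two).const_mul m
  simp only [sub_mul]
  rw [integral_sub i1 i2, integral_const_mul, h0, mul_zero, sub_zero]

theorem hermite1_sub_const (hσ : MemLp σ 2 γ) (m : ℝ) :
    hermite1 (fun x => σ x - m) = hermite1 σ :=
  integral_sub_const_mul hσ m (p := fun x => x) (by simpa using memLp_id_pow 1 2 (by simp))
    integral_id_gaussianReal

theorem hermite2_sub_const (hσ : MemLp σ 2 γ) (m : ℝ) :
    hermite2 (fun x => σ x - m) = hermite2 σ := by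
  have hp : MemLp (fun x : ℝ => x ^ 2 - 1) 2 γ :=
    (memLp_id_pow 2 2 (by simp)).sub (memLp_const (1 : ℝ))
  rw [hermite2, integral_sub_const_mul hσ m (p := fun x => x ^ 2 - 1) hp, hermite2]
  rw [integral_sub (integrable_id_pow 2) (integrable_const 1), integral_id_sq]
  simp

theorem hermite3_sub_const (hσ : MemLp σ 2 γ) (m : ℝ) :
    hermite3 (fun x => σ x - m) = hermite3 σ := by
  have h1 : MemLp (fun x : ℝ => x) 2 γ := by simpa using memLp_id_pow 1 2 (by simp)
  have hp : MemLp (fun x : ℝ => x ^ 3 - 3 * x) 2 γ :=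
    (memLp_id_pow 3 2 (by simp)).sub (h1.const_mul 3)
  rw [hermite3, integral_sub_const_mul hσ m (p := fun x => x ^ 3 - 3 * x) hp, hermite3]
  rw [integral_sub (integrable_id_pow 3) ((h1.integrable one_le_two).const_mul 3),
    integral_id_pow_three, integral_const_mul, integral_id_gaussianReal]
  simp

theorem sub_pow_four_le (x y : ℝ) : (x - y) ^ 4 ≤ 8 * (x ^ 4 + y ^ 4) := by
  nlinarith [sq_nonneg (x ^ 2 - y ^ 2), sq_nonneg (x + y), sq_nonneg ((x + y) ^ 2),
    mul_nonneg (sq_nonneg (x + y)) (sq_nonneg (x - y)), sq_nonneg (x ^ 2 + y ^ 2), sq_nonneg (x * y)]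

variable {B : ℝ}

namespace SmoothBounded

theorem continuous (h : SmoothBounded σ B) : Continuous σ := by
  simpa using (h.differentiable 0 (by norm_num)).continuous

theorem integrable_pow_four (h : SmoothBounded σ B) : Integrable (fun x => σ x ^ 4) γ := by
  have e : ∀ x : ℝ, |x| ^ 4 = x ^ 4 := fun x => Even.pow_abs (by decide) x
  simpa only [e] using h.integrable_zero

theorem integral_pow_four_le (h : SmoothBounded σ B) : ∫ x, σ x ^ 4 ∂γ ≤ B := by
  have e : ∀ x : ℝ, |x| ^ 4 = x ^ 4 := fun x => Even.pow_abs (by decide) x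
  simpa only [e] using h.le_zero

theorem memLp_sq (h : SmoothBounded σ B) : MemLp (fun x => σ x ^ 2) 2 γ := by
  have hm : AEStronglyMeasurable (fun x => σ x ^ 2) γ := (h.continuous.pow 2).aestronglyMeasurable
  rw [memLp_two_iff_integrable_sq hm]
  simpa only [← pow_mul] using h.integrable_pow_four

theorem memLp (h : SmoothBounded σ B) : MemLp σ 2 γ :=
  (memLp_two_iff_integrable_sq h.continuous.aestronglyMeasurable).2
    (h.memLp_sq.integrable one_le_two)

theorem integral_pow_four_le' (h : SmoothBounded σ B) : (∫ x, σ x ∂γ) ^ 4 ≤ B := by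
  have h1 : ∀ f : ℝ → ℝ, MemLp f 2 γ → (∫ x, f x ∂γ) ^ 2 ≤ ∫ x, f x ^ 2 ∂γ := by
    intro f hf
    have := variance_nonneg f γ
    rw [variance_eq_sub hf] at this
    simpa using this
  have h2 := h1 σ h.memLp
  have h3 := h1 _ h.memLp_sq
  simp only [← pow_mul] at h3
  calc (∫ x, σ x ∂γ) ^ 4 = ((∫ x, σ x ∂γ) ^ 2) ^ 2 := by ring
    _ ≤ (∫ x, σ x ^ 2 ∂γ) ^ 2 := by gcongr
    _ ≤ _ := h3
    _ ≤ B := h.integral_pow_four_le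

/-- The constant is `8 (B + B)` from `(σ - m)⁴ ≤ 8 (σ⁴ + m⁴)` with `m⁴ ≤ B`, plus `1` so that the
bound is at least `1`. -/
theorem activation (h : SmoothBounded σ B) :
    Activation (fun x => σ x - ∫ y, σ y ∂γ) (deriv σ) (iteratedDeriv 2 σ) (16 * |B| + 1) := by
  have d0 : Differentiable ℝ σ := by simpa using h.differentiable 0 (by norm_num)
  have d1 : Differentiable ℝ (deriv σ) := by
    simpa [iteratedDeriv_one] using h.differentiable 1 (by norm_num)
  have c2 := (h.differentiable 2 (by norm_num)).continuous
  have hB := le_abs_self B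
  have hB0 := abs_nonneg B
  have i4 : Integrable (fun x => 8 * (σ x ^ 4 + (∫ y, σ y ∂γ) ^ 4)) γ :=
    (h.integrable_pow_four.add (integrable_const ((∫ y, σ y ∂γ) ^ 4))).const_mul 8
  have hc : Continuous (fun x => (σ x - ∫ y, σ y ∂γ) ^ 4) :=
    (h.continuous.sub continuous_const).pow 4
  have j4 : Integrable (fun x => (σ x - ∫ y, σ y ∂γ) ^ 4) γ :=
    i4.mono' hc.aestronglyMeasurable (ae_of_all _ fun x => by
      rw [Real.norm_of_nonneg (by positivity)]
      exact sub_pow_four_le _ _)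
  refine ⟨by linarith, fun x => (d0 x).hasDerivAt.sub_const _, fun x => ?_, c2, ?_, j4, ?_, ?_, ?_,
    ?_, ?_⟩
  · rw [iteratedDeriv_succ, iteratedDeriv_one]
    exact (d1 x).hasDerivAt
  · rw [integral_sub (h.memLp.integrable one_le_two) (integrable_const (∫ y, σ y ∂γ))]
    simp
  · refine (integral_mono j4 i4 fun x => sub_pow_four_le _ _).trans ?_
    rw [integral_const_mul, integral_add h.integrable_pow_four
      (integrable_const ((∫ y, σ y ∂γ) ^ 4))]
    have := h.integral_pow_four_le
    have := h.integral_pow_four_le'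
    simp
    linarith
  · exact (memLp_two_iff_integrable_sq d1.continuous.aestronglyMeasurable).2
      (by simpa only [sq_abs] using h.integrable_one)
  · have := h.le_one
    simp only [sq_abs] at this
    linarith
  · exact (memLp_two_iff_integrable_sq c2.aestronglyMeasurable).2
      (by simpa only [sq_abs] using h.integrable_two)
  · have := h.le_two
    simp only [sq_abs] at this
    linarith

end SmoothBounded

end Center

end

section

/-! ### Quadratic forms and operator norms -/

section

variable {m n : Type*} [Fintype m] [Fintype n] [DecidableEq m] [DecidableEq n]

theorem vecMul_dotProduct_self_le (Q : Matrix m n ℝ) {α : m → ℝ} (hα : ‖WithLp.toLp 2 α‖ ≤ 1) :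
    (α ᵥ* Q) ⬝ᵥ (α ᵥ* Q) ≤ ‖Q‖ ^ 2 := by
  have h := Matrix.l2_opNorm_mulVec Qᵀ (WithLp.toLp 2 α)
  have hQ : ‖Qᵀ‖ = ‖Q‖ := by
    rw [← Matrix.conjTranspose_eq_transpose_of_trivial, Matrix.l2_opNorm_conjTranspose]
  rw [hQ] at h
  have h1 : ‖WithLp.toLp 2 (α ᵥ* Q)‖ ≤ ‖Q‖ := by
    have : ‖WithLp.toLp 2 (Qᵀ *ᵥ α)‖ ≤ ‖Q‖ * ‖WithLp.toLp 2 α‖ := h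
    rw [Matrix.mulVec_transpose] at this
    exact this.trans (mul_le_of_le_one_right (norm_nonneg _) hα)
  have h2 : (α ᵥ* Q) ⬝ᵥ (α ᵥ* Q) = ‖WithLp.toLp 2 (α ᵥ* Q)‖ ^ 2 := by
    rw [EuclideanSpace.real_norm_sq_eq]
    simp [dotProduct, sq]
  rw [h2]
  gcongr

/-- The quadratic form of `R` at `s αᵀ W` is the squared norm of `αᵀ (s W R^{1/2})`, and `‖α‖ ≤ 1`.
-/
theorem dotProduct_mulVec_le_opNorm_sq (W : Matrix m n ℝ) {R : Matrix n n ℝ} (hR : R.PosSemidef)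
    (s : ℝ) {α : m → ℝ} (hα : ‖WithLp.toLp 2 α‖ ≤ 1) :
    (s • (α ᵥ* W)) ⬝ᵥ R *ᵥ (s • (α ᵥ* W)) ≤ ‖s • (W * CFC.sqrt R)‖ ^ 2 := by
  refine le_of_eq_of_le ?_ (vecMul_dotProduct_self_le (s • (W * CFC.sqrt R)) hα)
  have h1 : CFC.sqrt R * CFC.sqrt R = R := CFC.sqrt_mul_sqrt_self R hR.nonneg
  have h2 : (CFC.sqrt R)ᵀ = CFC.sqrt R := by
    have := (Matrix.nonneg_iff_posSemidef.1 (CFC.sqrt_nonneg R)).isHermitian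
    rwa [Matrix.IsHermitian, Matrix.conjTranspose_eq_transpose_of_trivial] at this
  have h3 : α ᵥ* (s • (W * CFC.sqrt R)) = (s • (α ᵥ* W)) ᵥ* CFC.sqrt R := by
    rw [Matrix.vecMul_smul, ← Matrix.vecMul_vecMul, Matrix.smul_vecMul]
  have h4 : ∀ x : n → ℝ, x ᵥ* CFC.sqrt R = CFC.sqrt R *ᵥ x := fun x => by
    nth_rw 1 [← h2]
    rw [Matrix.vecMul_transpose]
  rw [h3, ← Matrix.dotProduct_mulVec, h4, Matrix.mulVec_mulVec, h1]

theorem dotProduct_sq_mulVec {S : Matrix n n ℝ} (hS : Sᵀ = S) (v : n → ℝ) :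
    v ⬝ᵥ (S ^ 2) *ᵥ v = ∑ k, (∑ i, v i * S i k) ^ 2 := by
  have h : v ⬝ᵥ (S ^ 2) *ᵥ v = (v ᵥ* S) ⬝ᵥ (v ᵥ* S) := by
    rw [sq, ← Matrix.mulVec_mulVec, Matrix.dotProduct_mulVec]
    nth_rw 2 [← hS]
    rw [Matrix.mulVec_transpose]
  rw [h]
  simp [dotProduct, Matrix.vecMul, sq]

/-- A Hadamard factor that is a Gram matrix attaches the vector `a i` to the scalar `v i * S i k`;
the `k`-sum of squares becomes a `k`-sum of squared norms. -/
theorem dotProduct_sq_hadamard_mulVec {E : Type*} [NormedAddCommGroup E] [InnerProductSpace ℝ E]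
    {S G : Matrix n n ℝ} (hS : Sᵀ = S) {a : n → E} (hG : ∀ i j, G i j = ⟪a i, a j⟫) (v : n → ℝ) :
    v ⬝ᵥ ((S ^ 2) ⊙ G) *ᵥ v = ∑ k, ‖∑ i, (v i * S i k) • a i‖ ^ 2 := by
  have hS' : ∀ i j, S i j = S j i := fun i j => by
    rw [← Matrix.transpose_apply S, hS]
  simp only [← real_inner_self_eq_norm_sq, sum_inner, inner_sum, inner_smul_left, inner_smul_right]
  simp only [dotProduct, Matrix.mulVec, Matrix.hadamard_apply, sq, Matrix.mul_apply, hG,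
    Finset.sum_mul, Finset.mul_sum]
  conv_rhs => rw [Finset.sum_comm]
  conv_rhs => enter [2, i]; rw [Finset.sum_comm]
  refine Finset.sum_congr rfl fun i _ => Finset.sum_congr rfl fun j _ =>
    Finset.sum_congr rfl fun k _ => ?_
  rw [hS' k j, real_inner_comm (a j) (a i)]
  simp
  ring

end

/-! ### The forms of `M₁`, `M₂` and the teacher term -/

section

variable {N D : ℕ}

theorem rho_apply (A : Matrix (Fin N) (Fin D) ℝ) (i j : Fin N) :
    rho A i j = ⟪WithLp.toLp 2 (A i), WithLp.toLp 2 (A j)⟫ := by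
  simp [rho, Matrix.mul_apply, PiLp.inner_apply, mul_comm]

variable {A : Matrix (Fin N) (Fin D) ℝ}

theorem rhoTilde_apply (hA : ∀ n, ‖WithLp.toLp 2 (A n)‖ = 1) (i j : Fin N) :
    rhoTilde A i j = offDiagGram (fun n => WithLp.toLp 2 (A n)) i j := by
  rw [rhoTilde, Matrix.sub_apply, rho_apply, offDiagGram]
  split_ifs with h
  · subst h
    rw [real_inner_self_eq_norm_sq, hA]
    simp
  · simp [h]

theorem rhoTilde_transpose (A : Matrix (Fin N) (Fin D) ℝ) : (rhoTilde A)ᵀ = rhoTilde A := by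
  have := rhoTilde_isHermitian A
  rwa [Matrix.IsHermitian, Matrix.conjTranspose_eq_transpose_of_trivial] at this

theorem sum_offDiag_pow_four (A : Matrix (Fin N) (Fin D) ℝ) :
    ∑ p ∈ (Finset.univ : Finset (Fin N)).offDiag, (A p.1 ⬝ᵥ A p.2) ^ 4 =
      ∑ i, ∑ j, offDiagGram (fun n => WithLp.toLp 2 (A n)) i j ^ 4 := by
  rw [← Finset.sum_product', Finset.univ_product_univ,
    ← Finset.sum_subset (Finset.subset_univ (Finset.univ : Finset (Fin N)).offDiag)]
  · refine Finset.sum_congr rfl fun p hp => ?_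
    rw [offDiagGram, ← rho_apply, if_neg (Finset.mem_offDiag.1 hp).2.2]
    simp [rho, Matrix.mul_apply, dotProduct]
  · intro p _ hp
    have : p.1 = p.2 := by simpa using hp
    simp [offDiagGram, this]

theorem dotProduct_matM1_mulVec (hA : ∀ n, ‖WithLp.toLp 2 (A n)‖ = 1) (σ : ℝ → ℝ) (v : Fin N → ℝ) :
    v ⬝ᵥ matM1 σ A *ᵥ v = (1 / √(N : ℝ)) *
      (hermite1 σ ^ 2 * ∑ n, (∑ i, v i * offDiagGram (fun n => WithLp.toLp 2 (A n)) i n) ^ 2 +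
        hermite2 σ ^ 2 * ∑ n, ‖∑ i, (v i * offDiagGram (fun n => WithLp.toLp 2 (A n)) i n) •
          WithLp.toLp 2 (A i)‖ ^ 2) := by
  have h := rhoTilde_transpose A
  simp only [matM1, Matrix.smul_mulVec, Matrix.add_mulVec, dotProduct_smul, dotProduct_add,
    dotProduct_sq_mulVec h, dotProduct_sq_hadamard_mulVec h (rho_apply A), rhoTilde_apply hA,
    smul_eq_mul]

theorem dotProduct_matM2_mulVec (hA : ∀ n, ‖WithLp.toLp 2 (A n)‖ = 1) (σ : ℝ → ℝ) (v : Fin N → ℝ) :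
    v ⬝ᵥ matM2 σ A *ᵥ v =
      hermite2 σ ^ 2 * ∑ n, (∑ i, v i * offDiagGram (fun n => WithLp.toLp 2 (A n)) i n ^ 2) ^ 2 +
        hermite3 σ ^ 2 * ∑ n, ‖∑ i, (v i * offDiagGram (fun n => WithLp.toLp 2 (A n)) i n ^ 2) •
          WithLp.toLp 2 (A i)‖ ^ 2 := by
  have h : (rhoTilde A ⊙ rhoTilde A)ᵀ = rhoTilde A ⊙ rhoTilde A := by
    rw [Matrix.transpose_hadamard, rhoTilde_transpose]
  simp only [matM2, Matrix.smul_mulVec, Matrix.add_mulVec, dotProduct_smul, dotProduct_add,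
    dotProduct_sq_mulVec h, dotProduct_sq_hadamard_mulVec h (rho_apply A), rhoTilde_apply hA,
    smul_eq_mul, Matrix.hadamard_apply, ← sq]

theorem sum_inner_sq_le {M : ℕ} (W' : Matrix (Fin M) (Fin D) ℝ) (s : ℝ) {α : Fin M → ℝ}
    (hα : ‖WithLp.toLp 2 α‖ ≤ 1) :
    ∑ n, ⟪WithLp.toLp 2 (s • (α ᵥ* W')), WithLp.toLp 2 (A n)⟫ ^ 2 ≤ ‖s • (W' * Aᵀ)‖ ^ 2 := by
  refine le_of_eq_of_le ?_ (vecMul_dotProduct_self_le (s • (W' * Aᵀ)) hα)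
  have h3 : α ᵥ* (s • (W' * Aᵀ)) = A *ᵥ (s • (α ᵥ* W')) := by
    rw [Matrix.vecMul_smul, ← Matrix.vecMul_vecMul, Matrix.vecMul_transpose, Matrix.mulVec_smul]
  rw [h3]
  simp only [dotProduct, Matrix.mulVec, ← sq, PiLp.inner_apply]
  simp

end

end

section

/-! ### Slices of the pre-activations -/

theorem sum_mul_mul_sum_eq {m n : Type*} [Fintype m] [Fintype n] (W : Matrix m n ℝ) (s : ℝ)
    (α : m → ℝ) (x : n → ℝ) :
    ∑ k, α k * (s * ∑ i, W k i * x i) = ∑ i, (s • (α ᵥ* W)) i * x i := by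
  simp only [Matrix.vecMul, dotProduct, Pi.smul_apply, smul_eq_mul, Finset.mul_sum, Finset.sum_mul]
  rw [Finset.sum_comm]
  exact Finset.sum_congr rfl fun i _ => Finset.sum_congr rfl fun j _ => by ring

theorem abs_smul_vecMul_le {m n : Type*} [Fintype m] [Fintype n] {W : Matrix m n ℝ} {s w : ℝ}
    {α : m → ℝ} (hα : ∀ k, |α k| ≤ 1) (hW : ∀ k i, |W k i| ≤ w) (hs : 0 ≤ s) (i : n) :
    |(s • (α ᵥ* W)) i| ≤ Fintype.card m * w * s := by
  have h : ∀ k, |α k * W k i| ≤ w := fun k => by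
    rw [abs_mul]
    exact (mul_le_of_le_one_left (abs_nonneg _) (hα k)).trans (hW k i)
  have h2 : |(α ᵥ* W) i| ≤ Fintype.card m * w := by
    refine (Finset.abs_sum_le_sum_abs _ _).trans ((Finset.sum_le_sum fun k _ => h k).trans ?_)
    simp
  rw [Pi.smul_apply, smul_eq_mul, abs_mul, abs_of_nonneg hs, mul_comm]
  gcongr

section

variable {m n : Type*} [Fintype m] [Fintype n]

theorem norm_inl_le (α : EuclideanSpace ℝ (m ⊕ n)) :
    ‖WithLp.toLp 2 (fun k => α (Sum.inl k))‖ ≤ ‖α‖ := by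
  refine le_of_sq_le_sq ?_ (norm_nonneg _)
  rw [EuclideanSpace.real_norm_sq_eq, EuclideanSpace.real_norm_sq_eq, Fintype.sum_sum_type]
  exact le_add_of_nonneg_right (Finset.sum_nonneg fun _ _ => sq_nonneg _)

theorem norm_inr_le (α : EuclideanSpace ℝ (m ⊕ n)) :
    ‖WithLp.toLp 2 (fun k => α (Sum.inr k))‖ ≤ ‖α‖ := by
  refine le_of_sq_le_sq ?_ (norm_nonneg _)
  rw [EuclideanSpace.real_norm_sq_eq, EuclideanSpace.real_norm_sq_eq, Fintype.sum_sum_type]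
  exact le_add_of_nonneg_left (Finset.sum_nonneg fun _ _ => sq_nonneg _)

end

variable {K M N D : ℕ} {σ : ℝ → ℝ} {A : Matrix (Fin N) (Fin D) ℝ} {W : Matrix (Fin K) (Fin N) ℝ}
  {W' : Matrix (Fin M) (Fin D) ℝ}

theorem sum_mul_eq_inner (x : Fin D → ℝ) (c : EuclideanSpace ℝ (Fin D)) :
    ∑ r, x r * c r = ⟪WithLp.toLp 2 x, c⟫ := by
  simp [PiLp.inner_apply, mul_comm]

theorem inner_preactivation (t : ℝ) (α : EuclideanSpace ℝ (Fin K ⊕ Fin M))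
    (c : EuclideanSpace ℝ (Fin D)) :
    ⟪α, preactivation σ A W W' c⟫ =
      t * (∑ i, ((1 / √(N : ℝ)) • ((fun k => α (Sum.inl k)) ᵥ* W)) i) +
        model (fun x => σ x - t) (fun n => WithLp.toLp 2 (A n))
          ((1 / √(N : ℝ)) • ((fun k => α (Sum.inl k)) ᵥ* W))
          (WithLp.toLp 2 ((1 / √(D : ℝ)) • ((fun k => α (Sum.inr k)) ᵥ* W'))) Finset.univ c := by
  have h1 : ⟪α, preactivation σ A W W' c⟫ =
      ∑ k, α (Sum.inl k) * ((1 / √(N : ℝ)) * ∑ i, W k i * σ ⟪WithLp.toLp 2 (A i), c⟫) +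
        ∑ k, α (Sum.inr k) * ((1 / √(D : ℝ)) * ∑ r, W' k r * c r) := by
    simp only [← sum_mul_eq_inner]
    simp [preactivation, PiLp.inner_apply, mul_comm]
  rw [h1, sum_mul_mul_sum_eq W _ (fun k => α (Sum.inl k)),
    sum_mul_mul_sum_eq W' _ (fun k => α (Sum.inr k)), model, ← sum_mul_eq_inner, ← add_assoc,
    Finset.mul_sum, ← Finset.sum_add_distrib]
  congr 1
  exact Finset.sum_congr rfl fun i _ => by ring

theorem continuous_preactivation (hσ : Continuous σ) : Continuous (preactivation σ A W W') := by
  refine (PiLp.continuous_toLp 2 _).comp (continuous_pi fun j => ?_)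
  cases j <;> simp only [Sum.elim_inl, Sum.elim_inr] <;> fun_prop

theorem memLp_preactivation (hσ : MemLp σ 2 γ) (hA : ∀ n, ‖WithLp.toLp 2 (A n)‖ = 1) :
    MemLp (preactivation σ A W W') 2 (stdGaussian (EuclideanSpace ℝ (Fin D))) := by
  refine MemLp.of_eval_piLp fun j => ?_
  cases j with
  | inl k =>
    simp only [preactivation, sum_mul_eq_inner, Sum.elim_inl]
    exact (memLp_finsetSum Finset.univ fun i _ =>
      (memLp_comp_inner (hA i) hσ).const_mul (W k i)).const_mul (1 / √(N : ℝ))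
  | inr k =>
    simp only [preactivation, sum_mul_eq_inner, Sum.elim_inr]
    exact (memLp_inner (WithLp.toLp 2 (W' k)) 2 (by simp)).const_mul (1 / √(D : ℝ))

theorem Activation.integral_model {E : Type*} [NormedAddCommGroup E] [InnerProductSpace ℝ E]
    [FiniteDimensional ℝ E] [MeasurableSpace E] [BorelSpace E] {ι : Type*} {a : ι → E}
    {σ' σ'' : ℝ → ℝ} {B : ℝ} (h : Activation σ σ' σ'' B) (ha : ∀ i, ‖a i‖ = 1) (v : ι → ℝ) (b : E)
    (I : Finset ι) : ∫ c, model σ a v b I c ∂(stdGaussian E) = 0 := by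
  have i1 : ∀ i ∈ I, Integrable (fun c => v i * σ ⟪a i, c⟫) (stdGaussian E) := fun i _ =>
    (integrable_comp_inner (ha i) (h.memLp.integrable one_le_two)).const_mul (v i)
  have i2 : Integrable (fun c => ⟪b, c⟫) (stdGaussian E) :=
    (memLp_inner b 2 (by simp)).integrable one_le_two
  simp only [model]
  rw [integral_add (integrable_finsetSum I i1) i2, integral_finsetSum I i1]
  have hb : ∫ c, ⟪b, c⟫ ∂(stdGaussian E) = 0 := by
    have hi : Integrable (fun c : E => c) (stdGaussian E) :=
      memLp_one_iff_integrable.1 (IsGaussian.memLp_id (stdGaussian E) 1 (by simp))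
    rw [integral_inner hi, integral_id_stdGaussian, inner_zero_right]
  rw [hb, add_zero]
  refine Finset.sum_eq_zero fun i _ => ?_
  rw [integral_const_mul, integral_comp_inner (ha i) h.continuous.aestronglyMeasurable, h.mean,
    mul_zero]

/-! ### Collecting the error terms -/

/-- Here `p = K |Bw|` and `s = 1/√N`, so that `κ = p s` and `L = p²`; `T` is the sum of fourth
powers, `h1, h2, h3` are the Hermite coefficients and `Q1, Q2, Q3` the operator norms in the error
bound. -/
theorem error_terms_le {p s T Z h1 h2 h3 X1 X2 Y1 Y2 Q1 Q2 Q3 : ℝ} (hp : 0 ≤ p) (hs : 0 ≤ s)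
    (hT : 0 ≤ T) (hQ1 : s * (h1 ^ 2 * X1 + h2 ^ 2 * X2) ≤ Q1 ^ 2) (hX1 : 0 ≤ X1)
    (hQ2 : h2 ^ 2 * Y1 + h3 ^ 2 * Y2 ≤ Q2 ^ 2) (hQ20 : 0 ≤ Q2) (hY1 : 0 ≤ Y1) (hZ : Z ≤ Q3 ^ 2) :
    p * s * (p ^ 2 * (1 + T) + Z + h1 ^ 2 * X1 + (√2 * h2) ^ 2 * X2) +
      √(p ^ 2) * √((√2 * h2) ^ 2 * Y1 + (√6 * h3) ^ 2 * Y2 + (p * s) ^ 2 * (1 + T) ^ 2) ≤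
    (p ^ 3 + p ^ 2 + 3 * p) * (Q1 ^ 2 + Q2 + s * Q3 ^ 2 + (1 + T) * s) := by
  have e2 : (√2 * h2) ^ 2 = 2 * h2 ^ 2 := by rw [mul_pow, Real.sq_sqrt (by norm_num)]
  have e6 : (√6 * h3) ^ 2 = 6 * h3 ^ 2 := by rw [mul_pow, Real.sq_sqrt (by norm_num)]
  rw [e2, e6, Real.sqrt_sq hp]
  -- The first two terms are at most `6 Q2² ≤ (3 Q2)²`.
  have hR : √(2 * h2 ^ 2 * Y1 + 6 * h3 ^ 2 * Y2 + (p * s) ^ 2 * (1 + T) ^ 2) ≤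
      3 * Q2 + p * s * (1 + T) := by
    refine Real.sqrt_le_iff.2 ⟨by positivity, ?_⟩
    have h0 : 0 ≤ Q2 * (p * s * (1 + T)) := by positivity
    have h4 : 0 ≤ h2 ^ 2 * Y1 := by positivity
    nlinarith [sq_nonneg Q2]
  have hR' := mul_le_mul_of_nonneg_left hR hp
  have h5 : p * (s * (h1 ^ 2 * X1 + h2 ^ 2 * X2)) ≤ p * Q1 ^ 2 :=
    mul_le_mul_of_nonneg_left hQ1 hp
  have h6 : p * s * Z ≤ p * s * Q3 ^ 2 := mul_le_mul_of_nonneg_left hZ (by positivity)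
  have h7 : 0 ≤ p * s * (h1 ^ 2 * X1) := by positivity
  have h8 : p * s * (p ^ 2 * (1 + T) + Z + h1 ^ 2 * X1 + 2 * h2 ^ 2 * X2) ≤
      p ^ 3 * ((1 + T) * s) + p * s * Q3 ^ 2 + 2 * (p * Q1 ^ 2) := by
    linear_combination h6 + 2 * h5 + h7
  have g1 : 0 ≤ (p ^ 3 + p ^ 2 + p) * Q1 ^ 2 := by positivity
  have g2 : 0 ≤ (p ^ 3 + p ^ 2) * Q2 := by positivity
  have g3 : 0 ≤ (p ^ 3 + p ^ 2 + 2 * p) * (s * Q3 ^ 2) := by positivity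
  have g4 : 0 ≤ 3 * p * ((1 + T) * s) := by positivity
  linear_combination h8 + hR' + g1 + g2 + g3 + g4

theorem stein_bound_preactivation {Bσ Bw : ℝ} (hN : 0 < N)
    (hA : ∀ n, ‖WithLp.toLp 2 (A n)‖ = 1) (hσ : SmoothBounded σ Bσ) (hW : ∀ k n, |W k n| ≤ Bw)
    {α : EuclideanSpace ℝ (Fin K ⊕ Fin M)} (hα : ‖α‖ ≤ 1) {S : EuclideanSpace ℝ (Fin D) → ℝ}
    (hS : S = model (fun x => σ x - ∫ y, σ y ∂γ) (fun n => WithLp.toLp 2 (A n))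
          ((1 / √(N : ℝ)) • ((fun k => α (Sum.inl k)) ᵥ* W))
          (WithLp.toLp 2 ((1 / √(D : ℝ)) • ((fun k => α (Sum.inr k)) ᵥ* W'))) Finset.univ)
    {g g' : ℝ → ℝ} (hg : SteinTest g g') :
    |(∫ c, S c * g (S c) ∂(stdGaussian (EuclideanSpace ℝ (Fin D)))) -
      (∫ c, S c ^ 2 ∂(stdGaussian (EuclideanSpace ℝ (Fin D)))) *
        ∫ c, g' (S c) ∂(stdGaussian (EuclideanSpace ℝ (Fin D)))| ≤
      40000000 * (16 * |Bσ| + 1) * (300000 * (16 * |Bσ| + 1) ^ 5) ^ 3 *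
        (((K * |Bw|) ^ 3 + (K * |Bw|) ^ 2 + 3 * (K * |Bw|)) * errorBound σ A W W') := by
  have hact := hσ.activation
  have hN' : (0 : ℝ) < N := Nat.cast_pos.2 hN
  have hL := (norm_inl_le α).trans hα
  have hR := (norm_inr_le α).trans hα
  have hα1 : ∀ k, |(fun k => α (Sum.inl k)) k| ≤ 1 := fun k =>
    (PiLp.norm_apply_le α (Sum.inl k)).trans hα
  have hv := abs_smul_vecMul_le hα1 (fun k i => (hW k i).trans (le_abs_self Bw))
    (by positivity : 0 ≤ 1 / √(N : ℝ))
  have hκ : 0 ≤ (Fintype.card (Fin K)) * |Bw| * (1 / √(N : ℝ)) := by positivity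
  have hcard : (Fintype.card (Fin N)) * ((Fintype.card (Fin K)) * |Bw| * (1 / √(N : ℝ))) ^ 2 ≤
      (K * |Bw|) ^ 2 := by
    rw [Fintype.card_fin, Fintype.card_fin, mul_pow _ (1 / √(N : ℝ)), div_pow,
      Real.sq_sqrt hN'.le]
    field_simp
    exact le_rfl
  subst hS
  refine (hact.stein_bound hA _ _ hκ hv hcard hg).trans ?_
  gcongr
  have e1 := hermite1_sub_const hσ.memLp (∫ y, σ y ∂γ)
  rw [hermite1] at e1
  rw [hact.integral_deriv2_eq, hact.integral_id_mul_deriv_eq, hact.integral_id_mul_deriv2_eq, e1,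
    hermite2_sub_const hσ.memLp, hermite3_sub_const hσ.memLp, Fintype.card_fin]
  have q1 := dotProduct_mulVec_le_opNorm_sq W (matM1_posSemidef σ A) (1 / √(N : ℝ)) hL
  have q2 := dotProduct_mulVec_le_opNorm_sq W (matM2_posSemidef σ A) (1 / √(N : ℝ)) hL
  rw [dotProduct_matM1_mulVec hA] at q1
  rw [dotProduct_matM2_mulVec hA] at q2
  have q3 := sum_inner_sq_le (A := A) W' (1 / √(D : ℝ)) hR
  rw [errorBound, sum_offDiag_pow_four, div_eq_mul_one_div (1 + _)]
  refine error_terms_le (by positivity) (by positivity) ?_ q1 ?_ q2 (norm_nonneg _) ?_ q3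
  · exact Finset.sum_nonneg fun i _ => Finset.sum_nonneg fun j _ => by positivity
  · exact Finset.sum_nonneg fun i _ => sq_nonneg _
  · exact Finset.sum_nonneg fun i _ => sq_nonneg _

end

end GaussianEquivalence

/-! ### The Gaussian equivalence theorem -/

open GaussianEquivalence in
theorem theorem1 (K : ℕ) (Bσ Bw : ℝ) :
    ∃ C : ℝ, ∀ (N D M : ℕ), 0 < N →
      ∀ (σ : ℝ → ℝ) (A : Matrix (Fin N) (Fin D) ℝ) (W : Matrix (Fin K) (Fin N) ℝ)
        (W' : Matrix (Fin M) (Fin D) ℝ),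
        (∀ n, ‖WithLp.toLp 2 (A n)‖ = 1) →
        GaussianEquivalence.SmoothBounded σ Bσ →
        (∀ k n, |W k n| ≤ Bw) →
        GaussianEquivalence.distMS (GaussianEquivalence.preactivationLaw σ A W W')
            (GaussianEquivalence.gaussianEquivalent
              (GaussianEquivalence.preactivationLaw σ A W W')) ≤
          ENNReal.ofReal (C * GaussianEquivalence.errorBound σ A W W') := by
  -- The factor `2` is the cost of passing from the Stein equation to test functions; the absolute
  -- values keep the constant valid without sign conditions on `Bσ` and `Bw`.
  refine ⟨2 * (40000000 * (16 * |Bσ| + 1) * (300000 * (16 * |Bσ| + 1) ^ 5) ^ 3 *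
    ((K * |Bw|) ^ 3 + (K * |Bw|) ^ 2 + 3 * (K * |Bw|))),
    fun N D M hN σ A W W' hA hσ hW => ?_⟩
  rw [mul_assoc 2, mul_assoc (40000000 * (16 * |Bσ| + 1) * (300000 * (16 * |Bσ| + 1) ^ 5) ^ 3)]
  refine distMS_gaussianEquivalent_le (continuous_preactivation hσ.continuous).measurable
    (memLp_preactivation hσ.memLp hA) fun α hα => ⟨_, _,
      inner_preactivation (∫ y, σ y ∂(gaussianReal 0 1)) α,
      hσ.activation.memLp_model hA _ _ _, hσ.activation.integral_model hA _ _ _,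
      fun g g' hg => stein_bound_preactivation hN hA hσ hW hα rfl hg⟩
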